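/- For $0<a<1$ put $\gamma=\frac{\pi}{2}\min\{\frac1a,\frac1{1-a}\}$ and consider the system of two strings with a common fixed endpoint at $a$: $$\begin{cases} u_{tt}-u_{xx}=0 & \text{in } (0,a)\times\mathbb R,\\ u_{tt}-u_{xx}=0 & \text{in } (a,1)\times\mathbb R,\\ u(0,\cdot)=u(a,\cdot)=u(1,\cdot)=0 & \text{in } \mathbb R,\\ u(\cdot,0)=u_{0,a},\quad u_t(\cdot,0)=u_{1,a} & \text{in } (0,a),\\ u(\cdot,0)=u_{0,1-a},\quad u_t(\cdot,0)=u_{1,1-a} & \text{in } (a,1). \end{cases}$$ For $i=0,1$ let $u_i$ be the function on $(0,1)$ equal to $u_{i,a}$ on $(0,a)$ and to $u_{i,1-a}$ on $(a,1)$. For $s>0$ let $H^{-s}(0,1)$ be the dual space of $H^s_0(0,1)$. **Theorem.** For almost every $a\in(0,1)$ the following holds for every $\varepsilon>0$. Let $0<\delta\le\pi/\gamma$, let $J$ be an integer with $J\delta>2\max\{a,1-a\}$, and let $t'\in\mathbb R$. There is a constant $C>0$, depending only on $a$, $\varepsilon$, $J\delta$ and $t'$, such that $$\|u_0\|_{H^{-\varepsilon}(0,1)}^2+\|u_1\|_{H^{-1-\varepsilon}(0,1)}^2\le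 C\,\delta\sum_{j=-J}^{J}\bigl|u_x(a-0,t'+j\delta)-u_x(a+0,t'+j\delta)\bigr|^2$$ for all solutions $u$ of the system whose initial data $u_{0,a}$, $u_{1,a}$ are linear combinations of the functions $$\sin\frac{n\pi x}{a},\qquad n=1,2,\dots,\quad n\le\frac a\delta-\frac14\min\Bigl\{1,\frac{a}{1-a}\Bigr\},$$ and whose initial data $u_{0,1-a}$, $u_{1,1-a}$ are linear combinations of the functions $$\sin\frac{m\pi (x-a)}{1-a},\qquad m=1,2,\dots,\quad m\le\frac{1-a}\delta-\frac14\min\Bigl\{1,\frac{1-a}{a}\Bigr\}.$$ (The one-sided limits $u_x(a\mp0,t)$ exist for these solutions for every $t$.) -/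

import Mathlib

open MeasureTheory Set Filter Topology
open scoped FourierTransform SchwartzMap Distributions ENNReal

noncomputable section

/-- The open interval `(l, r)` as an open set; `𝓓(openInterval l r, ℂ)` is the space of smooth
complex functions with compact support in `(l, r)`. -/
def openInterval (l r : ℝ) : TopologicalSpace.Opens ℝ := ⟨Ioo l r, isOpen_Ioo⟩

/-- The square of the `H^s(ℝ)` norm of a Schwartz function,
`∫ (1 + |ξ|²)^s |𝓕 Φ (ξ)|² dξ`. -/
def sobolevNormSq (s : ℝ) (Φ : 𝓢(ℝ, ℂ)) : ℝ :=
  ∫ ξ : ℝ, (1 + ξ ^ 2) ^ s * ‖𝓕 Φ ξ‖ ^ 2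

/-- The norm of `f` in `H^{-s}(0,1)`, the dual space of `H_0^s(0,1)`, with values in `[0, ∞]`.
`H_0^s(0,1)` is the closure of `C_c^∞(0,1)` in `H^s(0,1)`, the space of the restrictions to `(0,1)`
of the elements of `H^s(ℝ)` with the quotient norm. So the norm of `f` is the supremum of
`|∫₀¹ f φ|` over the `φ ∈ C_c^∞(0,1)` which have an extension `Φ` from `(0,1)` to `ℝ`
with `‖Φ‖_{H^s(ℝ)} ≤ 1` (by density it makes no difference that `Φ` is a Schwartz function). -/
def negSobolevNorm (s : ℝ) (f : ℝ → ℂ) : ℝ≥0∞ :=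
  ⨆ (φ : 𝓓(openInterval 0 1, ℂ)) (Φ : 𝓢(ℝ, ℂ)) (_ : EqOn Φ φ (Ioo 0 1))
    (_ : sobolevNormSq s Φ ≤ 1), ‖∫ x in (0 : ℝ)..1, f x * φ x‖ₑ

/-- `u = u(x,t)` is a (weak) solution on `(l, r) × ℝ` of the wave equation `u_tt = u_xx` with
`u(l,·) = u(r,·) = 0` and `u(·,0) = f`, `u_t(·,0) = g`. Only continuity of `u` is required, and the
equation and the condition on `u_t` are understood by testing against `ψ ∈ C_c^∞(l,r)`:
`d²/dt² ∫ u(x,t) ψ(x) dx = ∫ u(x,t) ψ''(x) dx`. Classical solutions, and the finite energy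
solutions in `C(ℝ; H_0^1(l,r)) ∩ C^1(ℝ; L²(l,r))` (in their continuous representatives),
are solutions in this sense. -/
structure IsStringSolution (l r : ℝ) (u : ℝ → ℝ → ℂ) (f g : ℝ → ℂ) : Prop where
  continuousOn : ContinuousOn (fun p : ℝ × ℝ => u p.1 p.2) (Icc l r ×ˢ univ)
  left : ∀ t, u l t = 0
  right : ∀ t, u r t = 0
  position : ∀ x ∈ Ioo l r, u x 0 = f x
  wave : ∀ ψ : 𝓓(openInterval l r, ℂ), ∃ v : ℝ → ℂ,
    (∀ t, HasDerivAt (fun s => ∫ x in l..r, u x s * ψ x) (v t) t) ∧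
    (∀ t, HasDerivAt v (∫ x in l..r, u x t * iteratedDeriv 2 ψ x) t) ∧
    v 0 = ∫ x in l..r, g x * ψ x

/-- `γ = (π / 2) min {1 / a, 1 / (1 - a)}`. -/
def stringGap (a : ℝ) : ℝ := Real.pi / 2 * min (1 / a) (1 / (1 - a))

/-- Linear combinations of the functions `sin (n π x / a)` with `n ≥ 1` and
`n ≤ a / δ - (1 / 4) min {1, a / (1 - a)}`. -/
def leftModes (a δ : ℝ) : Submodule ℂ (ℝ → ℂ) :=
  Submodule.span ℂ {f | ∃ n : ℕ, 1 ≤ n ∧ (n : ℝ) ≤ a / δ - 1 / 4 * min 1 (a / (1 - a)) ∧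
    f = fun x => (Real.sin (n * Real.pi * x / a) : ℂ)}

/-- Linear combinations of the functions `sin (m π (x - a) / (1 - a))` with `m ≥ 1` and
`m ≤ (1 - a) / δ - (1 / 4) min {1, (1 - a) / a}`. -/
def rightModes (a δ : ℝ) : Submodule ℂ (ℝ → ℂ) :=
  Submodule.span ℂ {f | ∃ m : ℕ, 1 ≤ m ∧
    (m : ℝ) ≤ (1 - a) / δ - 1 / 4 * min 1 ((1 - a) / a) ∧
    f = fun x => (Real.sin (m * Real.pi * (x - a) / (1 - a)) : ℂ)}

/-- The function on `(0,1)` equal to `f` on `(0,a)` and to `g` on `(a,1)`. -/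
def glue (a : ℝ) (f g : ℝ → ℂ) : ℝ → ℂ := fun x => if x < a then f x else g x

end

/-!
On each string a solution with finite sine sums as data is given by separation of variables, so the
observed jump of `u_x` at `a` is a sum of exponentials with frequencies in `(π / a) ℤ` and
`(π / (1 - a)) ℤ`. After a change of the unit of time these are `α ℤ` and `β ℤ` with `α, β ≥ π`, and
the time of observation is `[-τ, τ]` with `τ > 2`. Each family is `π`-separated, but their union has
no gap.

*Sampled exponentials.* The function `kernel T` is supported in `[-π, π]`, and its Fourier transform
is `T² - t²` times a square, hence nonpositive for `|t| ≥ T`. By Poisson summation the quadratic form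
of the kernel on the frequencies is at most a constant times the sum of squares of the samples in
`[-T, T]`, provided that the frequencies lie in an interval of length `2 π / h - π` (`form_le`). For two
families this form is a sum of squares (`two_family_estimate`): the close pairs contribute
`‖x + y‖²`, and what remains on the diagonal is nonnegative and quadratic in the distance to the other
family (`sum_kernel_le`). The resulting estimate is expressed by `PairBound`. The frequencies of the
problem occupy a slightly longer band. Short averaging filters remove the two frequencies at its lower
end, while `T < τ` leaves the time that they need; this gives the positive frequencies, and the
negative ones follow by time reversal (`pairBound_of_small_step`, `pairBound_shifted`). For large steps
there are finitely many cases, and it suffices that the nodes are distinct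
(`pairBound_of_fixed_step`).

*Coefficients.* For almost every `a` the distances between the two families are at least
`c n ^ (-(1 + s))` (`ae_dioph`), which bounds the coefficients of `u_0` and `u_1` with a loss of a small
power of `n` (`PairBound.weighted`). One combination of the coefficients is bounded without loss, since
close frequencies nearly cancel in it (`PairBound.pairing`).

*Sobolev norms.* A sine sum on an interval, tested against `Φ ∈ H^ε(ℝ)`, is bounded by the coefficients
with the weight `n ^ (-ε / 2)` (`exists_norm_integral_trig_le`); multiplication by the indicator function
of the interval costs a part of `ε`, and no boundary values are needed. For `u_1` one integrates by parts
first. The boundary terms at `a` are `Φ(a)` times the combination of coefficients that was bounded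
without loss (`exists_negSobolevNorm_le`).

*Solutions.* For a weak solution `u`, the test functions `sin (k (x - l))` have to be cut off near the
endpoints; as `u` is continuous and vanishes there, the error disappears in the limit
(`IsStringSolution.mode`). The completeness of the sines gives `IsStringSolution.eq_sum`.
-/

namespace StringObs

open Real

/-! ### The kernel -/

/-- The profile of the kernel, as a function of the distance `L` to the end of its support. -/
noncomputable def kernelProfile (σ L : ℝ) : ℝ :=
  4 * L - 2 * sin (2 * L) + σ * (L * (1 + cos (2 * L) / 2) - 3 / 4 * sin (2 * L))

/-- The kernel `G`, supported in `[-π, π]`. Up to a factor it is `T² (H ∗ H) + (H ∗ H)''` with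
`H x = cos² x` on `[-π/2, π/2]`, so that its Fourier transform is `T² - t²` times a square. -/
noncomputable def kernel (T x : ℝ) : ℝ := kernelProfile (T ^ 2 - 4) (max (π - |x|) 0)

lemma kernelProfile_zero (σ : ℝ) : kernelProfile σ 0 = 0 := by simp [kernelProfile]

lemma sub_mul_cos_nonneg {L : ℝ} (h0 : 0 ≤ L) (h1 : L ≤ π) : 0 ≤ sin L - L * cos L := by
  rcases le_total L (π / 2) with h | h
  · rcases h.lt_or_eq with h | rfl
    · have hc : 0 < cos L := cos_pos_of_mem_Ioo ⟨by linarith [pi_pos], h⟩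
      have := Real.le_tan h0 h
      rw [tan_eq_sin_div_cos, le_div_iff₀ hc] at this
      linarith
    · simp
  · have hc : cos L ≤ 0 := cos_nonpos_of_pi_div_two_le_of_le h (by linarith)
    have := sin_nonneg_of_nonneg_of_le_pi h0 h1
    nlinarith

lemma hasDerivAt_kernelProfile (σ L : ℝ) : HasDerivAt (kernelProfile σ)
    (8 * sin L ^ 2 + 2 * σ * (sin L * (sin L - L * cos L))) L := by
  have h2 : HasDerivAt (fun L : ℝ => 2 * L) 2 L := by simpa using (hasDerivAt_id L).const_mul 2
  have hs := h2.sin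
  have hc := h2.cos
  have := (((hasDerivAt_id L).const_mul 4).sub (hs.const_mul 2)).add
    ((((hasDerivAt_id L).mul ((hc.div_const 2).const_add 1)).sub (hs.const_mul (3 / 4))).const_mul σ)
  convert! this using 1
  simp only [id, sin_two_mul, cos_two_mul']
  have := sin_sq_add_cos_sq L
  linear_combination (4 + σ) * this

lemma kernelProfile_monotoneOn {σ : ℝ} (hσ : 0 ≤ σ) :
    MonotoneOn (kernelProfile σ) (Icc 0 π) := by
  apply monotoneOn_of_deriv_nonneg (convex_Icc 0 π)
  · exact fun x _ => (hasDerivAt_kernelProfile σ x).continuousAt.continuousWithinAt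
  · exact fun x _ => (hasDerivAt_kernelProfile σ x).differentiableAt.differentiableWithinAt
  · intro x hx
    rw [interior_Icc] at hx
    rw [(hasDerivAt_kernelProfile σ x).deriv]
    have h1 := sub_mul_cos_nonneg hx.1.le hx.2.le
    have h2 := sin_nonneg_of_nonneg_of_le_pi hx.1.le hx.2.le
    positivity

lemma kernelProfile_nonneg {σ L : ℝ} (hσ : 0 ≤ σ) (h0 : 0 ≤ L) (h1 : L ≤ π) :
    0 ≤ kernelProfile σ L := by
  rw [← kernelProfile_zero σ]
  exact kernelProfile_monotoneOn hσ ⟨le_rfl, pi_pos.le⟩ ⟨h0, h1⟩ h0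

/-- The identity behind the weakened gap condition: two neighbours at distances `L` and `π - L`
never outweigh the diagonal, and the deficit is quadratic in the smaller distance. -/
lemma kernelProfile_add (σ L : ℝ) :
    kernelProfile σ (π - L) + kernelProfile σ L = kernelProfile σ π - σ * π * sin L ^ 2 := by
  have h1 : sin (2 * (π - L)) = - sin (2 * L) := by
    rw [show 2 * (π - L) = 2 * π - 2 * L by ring, sin_two_pi_sub]
  have h2 : cos (2 * (π - L)) = cos (2 * L) := by
    rw [show 2 * (π - L) = 2 * π - 2 * L by ring, cos_two_pi_sub]
  simp only [kernelProfile, h1, h2, sin_two_pi, cos_two_pi]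
  rw [cos_two_mul']
  have := sin_sq_add_cos_sq L
  linear_combination σ * π * (1 / 2) * this

lemma kernel_nonneg {T : ℝ} (hT : 2 ≤ T) (x : ℝ) : 0 ≤ kernel T x :=
  kernelProfile_nonneg (by nlinarith) (le_max_right _ _)
    (max_le (by linarith [abs_nonneg x]) pi_pos.le)

lemma kernel_neg (T x : ℝ) : kernel T (-x) = kernel T x := by simp [kernel]

lemma kernel_abs (T x : ℝ) : kernel T |x| = kernel T x := by simp [kernel]

lemma kernel_eq_zero {T x : ℝ} (hx : π ≤ |x|) : kernel T x = 0 := by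
  rw [kernel, max_eq_right (by linarith), kernelProfile_zero]

lemma kernel_zero (T : ℝ) : kernel T 0 = kernelProfile (T ^ 2 - 4) π := by
  simp [kernel, pi_pos.le]

lemma kernel_anti {T x y : ℝ} (hT : 2 ≤ T) (h : |x| ≤ |y|) : kernel T y ≤ kernel T x :=
  kernelProfile_monotoneOn (by nlinarith)
    ⟨le_max_right _ _, max_le (by linarith [abs_nonneg y]) pi_pos.le⟩
    ⟨le_max_right _ _, max_le (by linarith [abs_nonneg x]) pi_pos.le⟩
    (max_le_max (by linarith) le_rfl)

lemma kernel_pi_div_four_pos {T : ℝ} (hT : 2 ≤ T) : 0 < kernel T (π / 4) := by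
  have h1 : kernelProfile 0 (π * (3 / 4)) ≤ kernel T (π / 4) := by
    rw [kernel, abs_of_pos (by positivity), max_eq_left (by linarith [pi_pos]),
      show π - π / 4 = π * (3 / 4) by ring]
    have h2 : 0 ≤ kernelProfile 0 (π * (3 / 4)) :=
      kernelProfile_nonneg le_rfl (by positivity) (by linarith [pi_pos])
    have h3 : cos (2 * (π * (3 / 4))) = 0 := by
      rw [show 2 * (π * (3 / 4)) = π / 2 + π by ring, cos_add_pi, cos_pi_div_two, neg_zero]
    have h4 : sin (2 * (π * (3 / 4))) = -1 := by
      rw [show 2 * (π * (3 / 4)) = π / 2 + π by ring, sin_add_pi, sin_pi_div_two]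
    simp only [kernelProfile, h3, h4]
    have : 0 ≤ T ^ 2 - 4 := by nlinarith
    nlinarith [pi_pos, mul_nonneg this pi_pos.le]
  refine lt_of_lt_of_le ?_ h1
  simp only [kernelProfile]
  nlinarith [sin_le_one (2 * (π * (3 / 4))), pi_gt_three]

/-- A point of the line has at most two points of a `π`-separated set within distance `π`, one on each
side. This bounds the kernel at such a pair of neighbours, with distances `d` and `e`. -/
lemma kernel_add_kernel_le {T d e ρ : ℝ} (hT : 2 ≤ T) (hρ0 : 0 ≤ ρ) (hρ : ρ ≤ π / 2)
    (hd : ρ ≤ d) (he : ρ ≤ e) (hde : π ≤ d + e) :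
    kernel T d + kernel T e ≤ kernel T 0 - (T ^ 2 - 4) * π * sin ρ ^ 2 := by
  have hσ : 0 ≤ T ^ 2 - 4 := by nlinarith
  have hsρ : 0 ≤ sin ρ := sin_nonneg_of_nonneg_of_le_pi hρ0 (by linarith [pi_pos])
  -- `D` separates the two distances: `D ≤ d` and `π - D ≤ e`
  have key : ∀ D, 0 ≤ D → D ≤ π → D ≤ d → π - D ≤ e → sin ρ ≤ sin D →
      kernel T d + kernel T e ≤ kernel T 0 - (T ^ 2 - 4) * π * sin ρ ^ 2 := by
    intro D h0 h1 h2 h3 h4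
    have e1 : kernel T d ≤ kernelProfile (T ^ 2 - 4) (π - D) := by
      refine (kernel_anti hT (x := D) (by rw [abs_of_nonneg h0, abs_of_nonneg]; exacts [h2, by linarith])).trans_eq ?_
      rw [kernel, abs_of_nonneg h0, max_eq_left (by linarith)]
    have e2 : kernel T e ≤ kernelProfile (T ^ 2 - 4) D := by
      refine (kernel_anti hT (x := π - D) (by rw [abs_of_nonneg, abs_of_nonneg] <;> linarith)).trans_eq ?_
      rw [kernel, abs_of_nonneg (by linarith), max_eq_left (by linarith), sub_sub_cancel]
    have e3 := kernelProfile_add (T ^ 2 - 4) D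
    have e4 : (T ^ 2 - 4) * π * sin ρ ^ 2 ≤ (T ^ 2 - 4) * π * sin D ^ 2 := by gcongr
    rw [kernel_zero]
    linarith
  rcases le_total d (π / 2) with h | h
  · exact key d (by linarith) (by linarith [pi_pos]) le_rfl (by linarith)
      (sin_le_sin_of_le_of_le_pi_div_two (by linarith [pi_pos]) h hd)
  rcases le_total e (π / 2) with h' | h'
  · refine key (π - e) (by linarith) (by linarith) (by linarith) (by linarith) ?_
    rw [sin_pi_sub]
    exact sin_le_sin_of_le_of_le_pi_div_two (by linarith [pi_pos]) h' he
  · refine key (π / 2) (by linarith) (by linarith) h (by linarith) ?_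
    rw [sin_pi_div_two]
    exact sin_le_one ρ

/-- Diagonal dominance: the kernel summed over a `π`-separated set stays below its value at `0`, by
an amount quadratic in the distance to the set. -/
lemma sum_kernel_le {ι : Type*} (s : Finset ι) (μ : ι → ℝ) {T l ρ : ℝ} (hT : 2 ≤ T)
    (hsep : ∀ i ∈ s, ∀ j ∈ s, i ≠ j → π ≤ |μ i - μ j|) (hρ0 : 0 ≤ ρ) (hρ : ρ ≤ π / 2)
    (hdist : ∀ i ∈ s, ρ ≤ |l - μ i|) :
    4 * (T ^ 2 - 4) / π * ρ ^ 2 ≤ kernel T 0 - ∑ i ∈ s, kernel T (l - μ i) := by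
  classical
  have hσ : 0 ≤ T ^ 2 - 4 := by nlinarith
  have hjordan : 4 * (T ^ 2 - 4) / π * ρ ^ 2 ≤ (T ^ 2 - 4) * π * sin ρ ^ 2 := by
    have h1 := mul_le_sin hρ0 hρ
    have h2 : (2 / π * ρ) ^ 2 ≤ sin ρ ^ 2 := by gcongr
    calc 4 * (T ^ 2 - 4) / π * ρ ^ 2 = (T ^ 2 - 4) * π * (2 / π * ρ) ^ 2 := by
          field_simp; ring
      _ ≤ _ := by gcongr
  suffices h : ∑ i ∈ s, kernel T (l - μ i) ≤ kernel T 0 - (T ^ 2 - 4) * π * sin ρ ^ 2 by linarith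
  have hrρ : kernel T ρ ≤ kernel T 0 - (T ^ 2 - 4) * π * sin ρ ^ 2 := by
    have := kernel_add_kernel_le hT hρ0 hρ le_rfl (e := π - ρ) (by linarith) (by linarith)
    linarith [kernel_nonneg hT (π - ρ)]
  set A := s.filter fun i => l ≤ μ i ∧ μ i - l < π with hA
  set B := s.filter fun i => μ i < l ∧ l - μ i < π with hB
  have hAB : Disjoint A B := by
    rw [Finset.disjoint_left]
    intro i hi hi'
    simp only [hA, hB, Finset.mem_filter] at hi hi'
    linarith [hi.2.1, hi'.2.1]
  have hsum : ∑ i ∈ s, kernel T (l - μ i) =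
      ∑ i ∈ A, kernel T (l - μ i) + ∑ i ∈ B, kernel T (l - μ i) := by
    rw [← Finset.sum_union hAB]
    symm
    apply Finset.sum_subset
    · intro i hi
      rcases Finset.mem_union.1 hi with h | h <;> exact (Finset.mem_filter.1 h).1
    · intro i hi hi'
      apply kernel_eq_zero
      by_contra hlt
      rw [not_le, abs_lt] at hlt
      apply hi'
      rcases lt_or_ge (μ i) l with h | h
      · exact Finset.mem_union_right _ (Finset.mem_filter.2 ⟨hi, h, hlt.2⟩)
      · exact Finset.mem_union_left _ (Finset.mem_filter.2 ⟨hi, h, by linarith⟩)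
  have hA1 : A.card ≤ 1 := by
    rw [Finset.card_le_one]
    intro i hi j hj
    simp only [hA, Finset.mem_filter] at hi hj
    by_contra hne
    have := hsep i hi.1 j hj.1 hne
    have : |μ i - μ j| < π := by rw [abs_lt]; constructor <;> linarith
    linarith
  have hB1 : B.card ≤ 1 := by
    rw [Finset.card_le_one]
    intro i hi j hj
    simp only [hB, Finset.mem_filter] at hi hj
    by_contra hne
    have := hsep i hi.1 j hj.1 hne
    have : |μ i - μ j| < π := by rw [abs_lt]; constructor <;> linarith
    linarith
  have hone : ∀ i ∈ s, kernel T (l - μ i) ≤ kernel T ρ := fun i hi =>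
    kernel_anti hT (by rw [abs_of_nonneg hρ0]; exact hdist i hi)
  have hρT := kernel_nonneg hT ρ
  rw [hsum]
  have hcases : ∀ C : Finset ι, C.card ≤ 1 → C = ∅ ∨ ∃ i, C = {i} := fun C hC => by
    rcases Nat.le_one_iff_eq_zero_or_eq_one.1 hC with h | h
    · exact Or.inl (Finset.card_eq_zero.1 h)
    · exact Or.inr (Finset.card_eq_one.1 h)
  rcases hcases A hA1 with h | ⟨i, h⟩ <;> rcases hcases B hB1 with h' | ⟨j, h'⟩
  · rw [h, h']; simp only [Finset.sum_empty]; linarith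
  · rw [h, h']
    simp only [Finset.sum_empty, Finset.sum_singleton]
    have : j ∈ s := Finset.mem_of_mem_filter j (h' ▸ Finset.mem_singleton_self j : j ∈ B)
    linarith [hone j this]
  · rw [h, h']
    simp only [Finset.sum_empty, Finset.sum_singleton]
    have : i ∈ s := Finset.mem_of_mem_filter i (h ▸ Finset.mem_singleton_self i : i ∈ A)
    linarith [hone i this]
  · rw [h, h']
    simp only [Finset.sum_singleton]
    have h1 : i ∈ A := h ▸ Finset.mem_singleton_self i
    have h2 : j ∈ B := h' ▸ Finset.mem_singleton_self j
    simp only [hA, hB, Finset.mem_filter] at h1 h2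
    have hne : i ≠ j := by rintro rfl; linarith [h1.2.1, h2.2.1]
    have h3 := hsep i h1.1 j h2.1 hne
    rw [abs_of_nonneg (by linarith)] at h3
    have h4 := hdist i h1.1
    have h5 := hdist j h2.1
    rw [← kernel_abs T (l - μ i), ← kernel_abs T (l - μ j)]
    apply kernel_add_kernel_le hT hρ0 hρ h4 h5
    rw [abs_of_nonneg (by linarith : 0 ≤ l - μ j), abs_of_nonpos (by linarith : l - μ i ≤ 0)]
    linarith

/-! ### The Fourier transform of the kernel and Poisson summation -/

/-- The Fourier transform of the kernel, normalised so that
`kernel T x = ∫ kernelTransform T t * exp (i x t) dt`. -/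
noncomputable def kernelTransform (T t : ℝ) : ℝ := (1 / π) * ∫ x in (0 : ℝ)..π, kernel T x * cos (t * x)

lemma continuous_kernel (T : ℝ) : Continuous (kernel T) := by
  have : Continuous (kernelProfile (T ^ 2 - 4)) := by unfold kernelProfile; fun_prop
  exact this.comp (by fun_prop)

lemma abs_kernelTransform_le {T : ℝ} (hT : 2 ≤ T) (t : ℝ) :
    |kernelTransform T t| ≤ kernel T 0 := by
  have h : ‖∫ x in (0 : ℝ)..π, kernel T x * cos (t * x)‖ ≤ kernel T 0 * |π - 0| := by
    apply intervalIntegral.norm_integral_le_of_norm_le_const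
    intro x _
    rw [norm_mul, Real.norm_eq_abs, Real.norm_eq_abs, abs_of_nonneg (kernel_nonneg hT x)]
    have h1 := kernel_anti hT (x := 0) (y := x) (by simp)
    have h2 := abs_cos_le_one (t * x)
    have h3 := kernel_nonneg hT x
    nlinarith [abs_nonneg (cos (t * x))]
  rw [sub_zero, abs_of_pos pi_pos, Real.norm_eq_abs] at h
  rw [kernelTransform, abs_mul, abs_of_pos (by positivity : 0 < 1 / π)]
  rw [one_div_mul_eq_div, div_le_iff₀ pi_pos]
  exact h

lemma kernelTransform_eq {T t : ℝ} (ht : 2 < |t|) : kernelTransform T t =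
    16 / π * (T ^ 2 - t ^ 2) * (1 - cos (t * π)) / (t ^ 2 * (t ^ 2 - 4) ^ 2) := by
  have ht0 : t ≠ 0 := by rintro rfl; norm_num at ht
  have ht2 : t ^ 2 - 4 ≠ 0 := by
    have : 2 ^ 2 < |t| ^ 2 := by gcongr
    rw [sq_abs] at this
    linarith
  -- `F'' + T² F` is the kernel on `[0, π]`, and `F''' + 4 F' = -4 + 4 cos 2x`
  set F : ℝ → ℝ := fun x => (π - x) * (1 + cos (2 * x) / 2) + 3 / 4 * sin (2 * x) with hF
  set F1 : ℝ → ℝ := fun x => -1 + cos (2 * x) - (π - x) * sin (2 * x) with hF1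
  set F2 : ℝ → ℝ := fun x => - sin (2 * x) - 2 * (π - x) * cos (2 * x) with hF2
  set P : ℝ → ℝ := fun x => 4 * (cos (t * x) / t -
    (t * (cos (t * x) * cos (2 * x)) + 2 * (sin (t * x) * sin (2 * x))) / (t ^ 2 - 4)) with hP
  set Q : ℝ → ℝ := fun x => (T ^ 2 - t ^ 2) / (t * (t ^ 2 - 4)) *
    (P x - F2 x * sin (t * x) + t * (F1 x * cos (t * x)) + (t ^ 2 - 4) * (F x * sin (t * x))) +
    F1 x * cos (t * x) + t * (F x * sin (t * x)) with hQ
  have key : ∫ x in (0 : ℝ)..π, kernel T x * cos (t * x) = Q π - Q 0 := by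
    have e : ∫ x in (0 : ℝ)..π, kernel T x * cos (t * x) =
        ∫ x in (0 : ℝ)..π, (T ^ 2 * F x + F2 x) * cos (t * x) := by
      apply intervalIntegral.integral_congr
      intro x hx
      rw [uIcc_of_le pi_pos.le] at hx
      have h1 : sin (2 * (π - x)) = - sin (2 * x) := by
        rw [show 2 * (π - x) = 2 * π - 2 * x by ring, sin_two_pi_sub]
      have h2 : cos (2 * (π - x)) = cos (2 * x) := by
        rw [show 2 * (π - x) = 2 * π - 2 * x by ring, cos_two_pi_sub]
      simp only [kernel, abs_of_nonneg hx.1, max_eq_left (by linarith [hx.2] : 0 ≤ π - x),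
        kernelProfile, h1, h2, hF, hF2]
      ring
    rw [e]
    apply intervalIntegral.integral_eq_sub_of_hasDerivAt
    · intro x _
      have d2 : HasDerivAt (fun x : ℝ => 2 * x) 2 x := by simpa using (hasDerivAt_id x).const_mul 2
      have dt : HasDerivAt (fun x : ℝ => t * x) t x := by simpa using (hasDerivAt_id x).const_mul t
      have dp : HasDerivAt (fun x : ℝ => π - x) (-1) x := by
        simpa using (hasDerivAt_id x).const_sub π
      have s2 := d2.sin
      have c2 := d2.cos
      have st := dt.sin
      have ct := dt.cos
      have dF : HasDerivAt F (F1 x) x := by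
        convert! (dp.mul ((c2.div_const 2).const_add 1)).add (s2.const_mul (3 / 4)) using 1
        simp only [hF1]; ring
      have dF1 : HasDerivAt F1 (F2 x) x := by
        convert! (c2.const_add (-1)).sub (dp.mul s2) using 1
        simp only [hF2]; ring
      have dF2 : HasDerivAt F2 (4 * (π - x) * sin (2 * x)) x := by
        convert! s2.neg.sub ((dp.const_mul 2).mul c2) using 1
        ring
      have dP : HasDerivAt P (4 * (cos (2 * x) - 1) * sin (t * x)) x := by
        convert! ((ct.div_const t).sub ((((ct.mul c2).const_mul t).add
          ((st.mul s2).const_mul 2)).div_const (t ^ 2 - 4))).const_mul 4 using 1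
        field_simp
        ring
      convert! (((((dP.sub (dF2.mul st)).add ((dF1.mul ct).const_mul t)).add
        ((dF.mul st).const_mul (t ^ 2 - 4))).const_mul ((T ^ 2 - t ^ 2) / (t * (t ^ 2 - 4)))).add
        (dF1.mul ct)).add ((dF.mul st).const_mul t) using 1
      have h4 : 4 * (cos (2 * x) - 1) = 4 * F1 x + 4 * (π - x) * sin (2 * x) := by
        simp only [hF1]; ring
      rw [h4]
      field_simp
      ring
    · apply Continuous.intervalIntegrable
      simp only [hF, hF2]
      fun_prop
  rw [kernelTransform, key]
  simp only [hQ, hP, hF, hF1, hF2, mul_zero, sin_zero, cos_zero, sin_two_pi, cos_two_pi, sub_self]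
  field_simp
  ring

lemma kernelTransform_nonpos {T t : ℝ} (hT : 2 < T) (ht : T ≤ |t|) : kernelTransform T t ≤ 0 := by
  rw [kernelTransform_eq (hT.trans_le ht)]
  have h1 : T ^ 2 - t ^ 2 ≤ 0 := by
    have : T ^ 2 ≤ |t| ^ 2 := by gcongr
    rw [sq_abs] at this; linarith
  have h2 : 0 ≤ 1 - cos (t * π) := by linarith [cos_le_one (t * π)]
  apply div_nonpos_of_nonpos_of_nonneg
  · exact mul_nonpos_of_nonpos_of_nonneg
      (mul_nonpos_of_nonneg_of_nonpos (by positivity) h1) h2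
  · positivity

lemma abs_kernelTransform_decay {T t : ℝ} (hT : 2 ≤ T) (ht : 4 ≤ |t|) :
    |kernelTransform T t| ≤ 16 * T ^ 2 / t ^ 2 := by
  rw [kernelTransform_eq (by linarith)]
  have ht2 : 16 ≤ t ^ 2 := by
    have : 4 ^ 2 ≤ |t| ^ 2 := by gcongr
    rw [sq_abs] at this; linarith
  have h0 : (0 : ℝ) < t ^ 2 := by linarith
  have h1 : |T ^ 2 - t ^ 2| ≤ T ^ 2 * t ^ 2 := by
    have hT2 : 4 ≤ T ^ 2 := by nlinarith
    rw [abs_le]; constructor <;> nlinarith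
  have h2 : |1 - cos (t * π)| ≤ 2 := by
    rw [abs_le]; constructor <;> linarith [cos_le_one (t * π), neg_one_le_cos (t * π)]
  have h3 : t ^ 2 * 2 ≤ (t ^ 2 - 4) ^ 2 := by nlinarith
  have h4 : (0 : ℝ) ≤ (t ^ 2 - 4) ^ 2 := by positivity
  rw [abs_div, abs_mul, abs_mul, abs_of_pos (by positivity : 0 < 16 / π),
    abs_of_nonneg (mul_nonneg h0.le h4)]
  have h5 : 16 / π ≤ 16 := by
    rw [div_le_iff₀ pi_pos]; linarith [pi_gt_three]
  calc 16 / π * |T ^ 2 - t ^ 2| * |1 - cos (t * π)| / (t ^ 2 * (t ^ 2 - 4) ^ 2)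
      ≤ 16 * (T ^ 2 * t ^ 2) * 2 / (t ^ 2 * (t ^ 2 * 2)) := by gcongr
    _ = 16 * T ^ 2 / t ^ 2 := by field_simp

lemma fourier_kernel_comp {T h : ℝ} (hh : 0 < h) (ξ : ℝ) :
    𝓕 (fun v : ℝ => (kernel T (2 * π / h * v) : ℂ)) ξ = (h * kernelTransform T (h * ξ) : ℝ) := by
  have hP : 0 < 2 * π / h := by positivity
  rw [Real.fourier_real_eq_integral_exp_smul]
  have e1 : ∀ v : ℝ, Complex.exp (↑(-2 * π * v * ξ) * Complex.I) • (kernel T (2 * π / h * v) : ℂ) =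
      (fun x : ℝ => Complex.exp (-(↑(h * ξ * x) * Complex.I)) * (kernel T x : ℂ)) (2 * π / h * v) := by
    intro v
    simp only [smul_eq_mul]
    congr 2
    have : h * ξ * (2 * π / h * v) = 2 * π * v * ξ := by field_simp
    rw [this]
    push_cast
    ring
  simp_rw [e1]
  rw [MeasureTheory.Measure.integral_comp_mul_left (fun x : ℝ =>
    Complex.exp (-(↑(h * ξ * x) * Complex.I)) * (kernel T x : ℂ)) (2 * π / h)]
  set w : ℝ → ℂ := fun x : ℝ => Complex.exp (-(↑(h * ξ * x) * Complex.I)) * (kernel T x : ℂ) with hw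
  have hwc : Continuous w := by
    have := continuous_kernel T
    simp only [hw]; fun_prop
  have e2 : ∫ x, w x = ∫ x in (-π)..π, w x := by
    rw [intervalIntegral.integral_of_le (by linarith [pi_pos])]
    symm
    apply setIntegral_eq_integral_of_forall_compl_eq_zero
    intro x hx
    have : π ≤ |x| := by
      by_contra hlt
      rw [not_le, abs_lt] at hlt
      exact hx ⟨hlt.1, hlt.2.le⟩
    simp [hw, kernel_eq_zero this]
  have e3 : ∫ x in (-π)..π, w x = ∫ x in (0 : ℝ)..π, (w (-x) + w x) := by
    have hwn : Continuous fun x => w (-x) := hwc.comp continuous_neg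
    rw [← intervalIntegral.integral_add_adjacent_intervals (hwc.intervalIntegrable (-π) 0)
      (hwc.intervalIntegrable 0 π), intervalIntegral.integral_add
      (hwn.intervalIntegrable 0 π) (hwc.intervalIntegrable 0 π),
      intervalIntegral.integral_comp_neg, neg_zero]
  have e4 : ∀ x, w (-x) + w x = ((2 * (kernel T x * cos (h * ξ * x)) : ℝ) : ℂ) := by
    intro x
    simp only [hw, kernel_neg]
    push_cast
    rw [← add_mul, mul_neg, neg_mul, neg_neg, ← Complex.ofReal_mul, ← Complex.ofReal_mul]
    have := Complex.two_cos ((h * ξ * x : ℝ) : ℂ)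
    rw [neg_mul] at this
    push_cast at this ⊢
    rw [← this]
    ring
  rw [e2, e3, intervalIntegral.integral_congr (fun x _ => e4 x), intervalIntegral.integral_ofReal,
    intervalIntegral.integral_const_mul, kernelTransform, abs_of_pos (inv_pos.2 hP)]
  rw [Complex.real_smul, ← Complex.ofReal_mul]
  congr 1
  field_simp

/-- Poisson summation: the samples of `kernelTransform` are the Fourier coefficients of the
periodised kernel, which agrees with the kernel as long as no translate of its support interferes. -/
lemma hasSum_kernelTransform {T h μ : ℝ} (hT : 2 ≤ T) (hh : 0 < h)
    (hμ : |μ| ≤ 2 * π / h - π) :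
    HasSum (fun j : ℤ => ((h * kernelTransform T (h * j) : ℝ) : ℂ) *
      Complex.exp (Complex.I * (μ * (j * h) : ℝ))) (kernel T μ) := by
  set P : ℝ := 2 * π / h with hPdef
  have hP : 0 < P := by positivity
  set f : ℝ → ℂ := fun v => (kernel T (P * v) : ℂ) with hf
  have hfc : Continuous f := by
    have := continuous_kernel T
    simp only [hf]; fun_prop
  have hF : ∀ ξ, 𝓕 f ξ = (h * kernelTransform T (h * ξ) : ℝ) := fun ξ => fourier_kernel_comp hh ξ
  have hb1 : f =O[cocompact ℝ] (|·| ^ (-(2 : ℝ))) := by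
    have : f =ᶠ[cocompact ℝ] fun _ => 0 := by
      have h1 := (tendsto_norm_cocompact_atTop (E := ℝ)).eventually_ge_atTop (π / P)
      filter_upwards [h1] with v hv
      simp only [hf]
      rw [kernel_eq_zero, Complex.ofReal_zero]
      rw [Real.norm_eq_abs, div_le_iff₀ hP] at hv
      rw [abs_mul, abs_of_pos hP]; linarith
    exact this.trans_isBigO (Asymptotics.isBigO_zero _ _)
  have hb2 : (𝓕 f) =O[cocompact ℝ] (|·| ^ (-(2 : ℝ))) := by
    apply Asymptotics.IsBigO.of_bound (16 * T ^ 2 / h)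
    have h1 := (tendsto_norm_cocompact_atTop (E := ℝ)).eventually_ge_atTop (4 / h)
    filter_upwards [h1, (tendsto_norm_cocompact_atTop (E := ℝ)).eventually_gt_atTop 0] with ξ hξ hξ0
    rw [Real.norm_eq_abs] at hξ hξ0
    rw [div_le_iff₀ hh] at hξ
    have h2 : 4 ≤ |h * ξ| := by rw [abs_mul, abs_of_pos hh]; linarith
    have h3 := abs_kernelTransform_decay hT h2
    rw [hF, Complex.norm_real, Real.norm_eq_abs, abs_mul, abs_of_pos hh, Real.norm_eq_abs,
      abs_of_nonneg (rpow_nonneg (abs_nonneg ξ) _), rpow_neg (abs_nonneg _), rpow_two, sq_abs]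
    have hξ2 : ξ ≠ 0 := abs_pos.1 hξ0
    calc h * |kernelTransform T (h * ξ)| ≤ h * (16 * T ^ 2 / (h * ξ) ^ 2) := by gcongr
      _ = _ := by field_simp
  have hsum : Summable fun n : ℤ => 𝓕 f n * fourier n ((μ / P : ℝ) : UnitAddCircle) := by
    have h1 : Summable fun n : ℤ => 𝓕 f n := summable_of_isBigO
      (Real.summable_abs_int_rpow one_lt_two) (hb2.comp_tendsto Int.tendsto_coe_cofinite)
    refine Summable.of_norm_bounded h1.norm fun n => ?_
    rw [norm_mul, fourier_coe_apply]
    have e : 2 * (π : ℂ) * Complex.I * n * ((μ / P : ℝ) : ℂ) / (1 : ℝ) =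
        ((2 * π * n * (μ / P) : ℝ) : ℂ) * Complex.I := by push_cast; ring
    rw [e, Complex.norm_exp_ofReal_mul_I, mul_one]
  have hpoisson := Real.tsum_eq_tsum_fourier_of_rpow_decay hfc one_lt_two hb1 hb2 (μ / P)
  have hleft : ∑' n : ℤ, f (μ / P + n) = kernel T μ := by
    rw [tsum_eq_single 0]
    · simp only [hf, Int.cast_zero, add_zero]
      rw [mul_div_cancel₀ _ hP.ne']
    · intro n hn
      simp only [hf]
      rw [kernel_eq_zero, Complex.ofReal_zero]
      have h1 : (1 : ℝ) ≤ |(n : ℝ)| := by exact_mod_cast Int.one_le_abs hn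
      have h2 : P * (μ / P + n) = P * n - (-μ) := by field_simp; ring
      rw [h2]
      have h3 := abs_sub_abs_le_abs_sub (P * n) (-μ)
      rw [abs_mul, abs_of_pos hP, abs_neg] at h3
      nlinarith
  rw [hleft] at hpoisson
  rw [hpoisson]
  convert hsum.hasSum using 1
  ext j
  rw [hF, fourier_coe_apply]
  congr 2
  simp only [hPdef]
  push_cast
  field_simp

/-! ### The quadratic form of the sampled kernel -/

/-- `cis θ = exp (i θ)` for real `θ`. -/
noncomputable def cis (θ : ℝ) : ℂ := Complex.exp (Complex.I * θ)

@[simp] lemma norm_cis (θ : ℝ) : ‖cis θ‖ = 1 := by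
  rw [cis, mul_comm, Complex.norm_exp_ofReal_mul_I]

@[simp] lemma cis_zero : cis 0 = 1 := by simp [cis]

lemma cis_add (a b : ℝ) : cis (a + b) = cis a * cis b := by
  rw [cis, cis, cis, ← Complex.exp_add]; push_cast; ring_nf

lemma conj_cis (a : ℝ) : (starRingEnd ℂ) (cis a) = cis (-a) := by
  rw [cis, cis, ← Complex.exp_conj]; simp

lemma cis_nat_mul (n : ℕ) (a : ℝ) : cis (n * a) = cis a ^ n := by
  rw [cis, cis, ← Complex.exp_nat_mul]; push_cast; ring_nf

lemma cis_eq (θ : ℝ) : cis θ = (cos θ : ℂ) + (sin θ : ℂ) * Complex.I := by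
  rw [cis, mul_comm, Complex.exp_mul_I]; push_cast; rfl

lemma continuous_cis : Continuous cis := by unfold cis; fun_prop

lemma hasDerivAt_cis (c x : ℝ) : HasDerivAt (fun x : ℝ => cis (c * x)) (Complex.I * c * cis (c * x)) x := by
  have h1 : HasDerivAt (fun x : ℝ => Complex.I * ((c * x : ℝ) : ℂ)) (Complex.I * c) x := by
    have : HasDerivAt (fun x : ℝ => c * x) c x := by simpa using (hasDerivAt_id x).const_mul c
    exact this.ofReal_comp.const_mul Complex.I
  convert! h1.cexp using 1
  rw [cis]; ring

lemma norm_cis_sub_one_le (θ : ℝ) : ‖cis θ - 1‖ ≤ |θ| := by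
  rw [cis]; exact Real.norm_exp_I_mul_ofReal_sub_one_le

lemma norm_cis_sub_cis_le (a b : ℝ) : ‖cis a - cis b‖ ≤ |a - b| := by
  have : cis a - cis b = cis b * (cis (a - b) - 1) := by
    rw [mul_sub, ← cis_add]; simp
  rw [this, norm_mul, norm_cis, one_mul]
  exact norm_cis_sub_one_le _

/-- The quadratic form of the kernel as a sum over all samples, with the weights
`h * kernelTransform T (h * j)`. -/
lemma hasSum_form {ι : Type*} (s : Finset ι) (ν : ι → ℝ) (z : ι → ℂ) {T h lo hi : ℝ} (hT : 2 ≤ T)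
    (hh : 0 < h) (hν : ∀ i ∈ s, ν i ∈ Icc lo hi) (hband : hi - lo ≤ 2 * π / h - π) :
    HasSum (fun j : ℤ => h * kernelTransform T (h * j) * ‖∑ i ∈ s, z i * cis (ν i * (j * h))‖ ^ 2)
      (∑ i ∈ s, ∑ k ∈ s, kernel T (ν i - ν k) * (z i * (starRingEnd ℂ) (z k)).re) := by
  have h1 : HasSum (fun j : ℤ => ∑ i ∈ s, ∑ k ∈ s, z i * (starRingEnd ℂ) (z k) *
      (((h * kernelTransform T (h * j) : ℝ) : ℂ) * cis ((ν i - ν k) * (j * h))))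
      (∑ i ∈ s, ∑ k ∈ s, z i * (starRingEnd ℂ) (z k) * (kernel T (ν i - ν k) : ℂ)) := by
    refine hasSum_sum fun i hi => hasSum_sum fun k hk => HasSum.mul_left _ ?_
    have h1 := hν i hi
    have h2 := hν k hk
    exact hasSum_kernelTransform hT hh
      (by rw [abs_le]; constructor <;> linarith [h1.1, h1.2, h2.1, h2.2])
  have h2 := Complex.hasSum_re h1
  convert h2 using 1
  · ext j
    have e : ∑ i ∈ s, ∑ k ∈ s, z i * (starRingEnd ℂ) (z k) *
        (((h * kernelTransform T (h * j) : ℝ) : ℂ) * cis ((ν i - ν k) * (j * h))) =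
        ((h * kernelTransform T (h * j) * ‖∑ i ∈ s, z i * cis (ν i * (j * h))‖ ^ 2 : ℝ) : ℂ) := by
      rw [Complex.ofReal_mul (h * kernelTransform T (h * j)), Complex.ofReal_pow, ← Complex.mul_conj', map_sum,
        Finset.sum_mul_sum, Finset.mul_sum]
      refine Finset.sum_congr rfl fun i _ => ?_
      rw [Finset.mul_sum]
      refine Finset.sum_congr rfl fun k _ => ?_
      rw [map_mul, conj_cis, show (ν i - ν k) * (j * h) = ν i * (j * h) + -(ν k * (j * h)) by ring,
        cis_add]
      ring
    rw [e, Complex.ofReal_re]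
  · rw [Complex.re_sum]
    refine Finset.sum_congr rfl fun i _ => ?_
    rw [Complex.re_sum]
    refine Finset.sum_congr rfl fun k _ => ?_
    rw [Complex.re_mul_ofReal, mul_comm]

/-- The weights of the samples with `T ≤ |j| h` are nonpositive, so that finitely many samples bound
the form. -/
lemma form_le {ι : Type*} (s : Finset ι) (ν : ι → ℝ) (z : ι → ℂ) {T h lo hi : ℝ} (hT : 2 < T)
    (hh : 0 < h) (J : ℤ) (hJ : T ≤ J * h) (hν : ∀ i ∈ s, ν i ∈ Icc lo hi)
    (hband : hi - lo ≤ 2 * π / h - π) :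
    ∑ i ∈ s, ∑ k ∈ s, kernel T (ν i - ν k) * (z i * (starRingEnd ℂ) (z k)).re ≤
      kernel T 0 * (h * ∑ j ∈ Finset.Icc (-J) J, ‖∑ i ∈ s, z i * cis (ν i * (j * h))‖ ^ 2) := by
  have h1 := hasSum_form s ν z hT.le hh hν hband
  have h2 : ∑ i ∈ s, ∑ k ∈ s, kernel T (ν i - ν k) * (z i * (starRingEnd ℂ) (z k)).re ≤
      ∑ j ∈ Finset.Icc (-J) J,
        h * kernelTransform T (h * j) * ‖∑ i ∈ s, z i * cis (ν i * (j * h))‖ ^ 2 := by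
    rw [← neg_le_neg_iff, ← Finset.sum_neg_distrib]
    refine sum_le_hasSum _ (fun j hj => ?_) h1.neg
    rw [Left.nonneg_neg_iff]
    apply mul_nonpos_of_nonpos_of_nonneg _ (by positivity)
    apply mul_nonpos_of_nonneg_of_nonpos hh.le
    apply kernelTransform_nonpos hT
    rw [Finset.mem_Icc, not_and_or, not_le, not_le] at hj
    have h3 : J ≤ |j| := by rcases hj with h | h <;> [rw [le_abs']; rw [le_abs]] <;> omega
    have h4 : (J : ℝ) ≤ |(j : ℝ)| := by exact_mod_cast h3
    rw [abs_mul, abs_of_pos hh]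
    nlinarith
  refine h2.trans ?_
  rw [Finset.mul_sum, Finset.mul_sum]
  refine Finset.sum_le_sum fun j _ => ?_
  have h3 := (le_abs_self _).trans (abs_kernelTransform_le hT.le (h * j))
  have h4 : 0 ≤ h * ‖∑ i ∈ s, z i * cis (ν i * (j * h))‖ ^ 2 := by positivity
  nlinarith

lemma re_mul_conj_add (x y : ℂ) : (x * (starRingEnd ℂ) y).re + (y * (starRingEnd ℂ) x).re =
    ‖x + y‖ ^ 2 - ‖x‖ ^ 2 - ‖y‖ ^ 2 := by
  simp only [← Complex.normSq_eq_norm_sq, Complex.normSq_apply, Complex.mul_re, Complex.conj_re,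
    Complex.conj_im, Complex.add_re, Complex.add_im]
  ring

lemma re_mul_conj_self (x : ℂ) : (x * (starRingEnd ℂ) x).re = ‖x‖ ^ 2 := by
  simp only [← Complex.normSq_eq_norm_sq, Complex.normSq_apply, Complex.mul_re, Complex.conj_re,
    Complex.conj_im]
  ring

lemma form_diag {ι : Type*} {T : ℝ} (s : Finset ι) (l : ι → ℝ) (x : ι → ℂ)
    (hs : ∀ i ∈ s, ∀ j ∈ s, i ≠ j → π ≤ |l i - l j|) (i : ι) (hi : i ∈ s) :
    ∑ j ∈ s, kernel T (l i - l j) * (x i * (starRingEnd ℂ) (x j)).re = kernel T 0 * ‖x i‖ ^ 2 := by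
  rw [Finset.sum_eq_single_of_mem i hi]
  · rw [sub_self, re_mul_conj_self]
  · intro j hj hne
    rw [kernel_eq_zero (hs i hi j hj hne.symm), zero_mul]

/-- For two `π`-separated families of frequencies the form of the kernel is a sum of squares: the
neighbouring terms are written through `‖x + y‖²`, and what is left on the diagonal is nonnegative
by `sum_kernel_le`. -/
theorem two_family_estimate {ι κ : Type*} (s : Finset ι) (t : Finset κ) (l : ι → ℝ) (μ : κ → ℝ)
    (x : ι → ℂ) (y : κ → ℂ) {T h lo hi : ℝ} (hT : 2 < T) (hh : 0 < h) (J : ℤ) (hJ : T ≤ J * h)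
    (hl : ∀ i ∈ s, l i ∈ Icc lo hi) (hμ : ∀ k ∈ t, μ k ∈ Icc lo hi)
    (hls : ∀ i ∈ s, ∀ j ∈ s, i ≠ j → π ≤ |l i - l j|)
    (hμs : ∀ i ∈ t, ∀ j ∈ t, i ≠ j → π ≤ |μ i - μ j|)
    (hband : hi - lo ≤ 2 * π / h - π) :
    ∑ i ∈ s, (kernel T 0 - ∑ k ∈ t, kernel T (l i - μ k)) * ‖x i‖ ^ 2 +
      ∑ k ∈ t, (kernel T 0 - ∑ i ∈ s, kernel T (μ k - l i)) * ‖y k‖ ^ 2 +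
      ∑ i ∈ s, ∑ k ∈ t, kernel T (l i - μ k) * ‖x i + y k‖ ^ 2 ≤
      kernel T 0 * (h * ∑ j ∈ Finset.Icc (-J) J,
        ‖∑ i ∈ s, x i * cis (l i * (j * h)) + ∑ k ∈ t, y k * cis (μ k * (j * h))‖ ^ 2) := by
  classical
  have h1 := form_le (s.disjSum t) (Sum.elim l μ) (Sum.elim x y) hT hh J hJ (lo := lo) (hi := hi)
    (by
      intro i hi
      rcases i with i | i
      · exact hl i (by simpa using hi)
      · exact hμ i (by simpa using hi)) hband
  simp only [Finset.sum_disjSum, Sum.elim_inl, Sum.elim_inr] at h1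
  refine le_trans (le_of_eq ?_) h1
  have e1 : ∑ i ∈ s, ((∑ j ∈ s, kernel T (l i - l j) * (x i * (starRingEnd ℂ) (x j)).re) +
      ∑ k ∈ t, kernel T (l i - μ k) * (x i * (starRingEnd ℂ) (y k)).re) =
      ∑ i ∈ s, kernel T 0 * ‖x i‖ ^ 2 +
      ∑ i ∈ s, ∑ k ∈ t, kernel T (l i - μ k) * (x i * (starRingEnd ℂ) (y k)).re := by
    rw [← Finset.sum_add_distrib]
    refine Finset.sum_congr rfl fun i hi => ?_
    rw [form_diag s l x hls i hi]
  have e2 : ∑ k ∈ t, ((∑ i ∈ s, kernel T (μ k - l i) * (y k * (starRingEnd ℂ) (x i)).re) +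
      ∑ j ∈ t, kernel T (μ k - μ j) * (y k * (starRingEnd ℂ) (y j)).re) =
      ∑ i ∈ s, ∑ k ∈ t, kernel T (l i - μ k) * (y k * (starRingEnd ℂ) (x i)).re +
      ∑ k ∈ t, kernel T 0 * ‖y k‖ ^ 2 := by
    rw [Finset.sum_comm (s := s), ← Finset.sum_add_distrib]
    refine Finset.sum_congr rfl fun k hk => ?_
    rw [form_diag t μ y hμs k hk]
    congr 1
    refine Finset.sum_congr rfl fun i _ => ?_
    rw [← kernel_neg T (μ k - l i), neg_sub]
  rw [e1, e2]
  have e3 : ∑ k ∈ t, (kernel T 0 - ∑ i ∈ s, kernel T (μ k - l i)) * ‖y k‖ ^ 2 =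
      ∑ k ∈ t, kernel T 0 * ‖y k‖ ^ 2 - ∑ i ∈ s, ∑ k ∈ t, kernel T (l i - μ k) * ‖y k‖ ^ 2 := by
    rw [Finset.sum_comm (s := s), ← Finset.sum_sub_distrib]
    refine Finset.sum_congr rfl fun k _ => ?_
    rw [sub_mul, Finset.sum_mul]
    congr 1
    refine Finset.sum_congr rfl fun i _ => ?_
    rw [← kernel_neg T (μ k - l i), neg_sub]
  have e4 : ∑ i ∈ s, (kernel T 0 - ∑ k ∈ t, kernel T (l i - μ k)) * ‖x i‖ ^ 2 =
      ∑ i ∈ s, kernel T 0 * ‖x i‖ ^ 2 - ∑ i ∈ s, ∑ k ∈ t, kernel T (l i - μ k) * ‖x i‖ ^ 2 := by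
    rw [← Finset.sum_sub_distrib]
    refine Finset.sum_congr rfl fun k _ => ?_
    rw [sub_mul, Finset.sum_mul]
  have e5 : ∑ i ∈ s, ∑ k ∈ t, kernel T (l i - μ k) * ‖x i + y k‖ ^ 2 =
      ∑ i ∈ s, ∑ k ∈ t, kernel T (l i - μ k) * (x i * (starRingEnd ℂ) (y k)).re +
      ∑ i ∈ s, ∑ k ∈ t, kernel T (l i - μ k) * (y k * (starRingEnd ℂ) (x i)).re +
      ∑ i ∈ s, ∑ k ∈ t, kernel T (l i - μ k) * ‖x i‖ ^ 2 +
      ∑ i ∈ s, ∑ k ∈ t, kernel T (l i - μ k) * ‖y k‖ ^ 2 := by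
    simp only [← Finset.sum_add_distrib]
    refine Finset.sum_congr rfl fun i _ => Finset.sum_congr rfl fun k _ => ?_
    linear_combination (-kernel T (l i - μ k)) * re_mul_conj_add (x i) (y k)
  rw [e3, e4, e5]
  ring

/-! ### Averaging filters -/

/-- The multiplier of `filt`: one minus the average of `exp (i k θ)`, `1 ≤ k ≤ r`. -/
noncomputable def filtMult (r : ℕ) (θ : ℝ) : ℂ :=
  1 - (1 / r : ℂ) * ∑ i ∈ Finset.range r, cis ((i + 1) * θ)

/-- Subtraction of a modulated one-sided average over `r` samples; it annihilates the samples of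
`exp (i μ t)`. -/
noncomputable def filt (r : ℕ) (h μ : ℝ) (F : ℤ → ℂ) (j : ℤ) : ℂ :=
  F j - (1 / r : ℂ) * ∑ i ∈ Finset.range r, cis (-(μ * ((i + 1) * h))) * F (j + (i + 1))

lemma filtMult_zero {r : ℕ} (hr : 1 ≤ r) : filtMult r 0 = 0 := by
  have : (r : ℂ) ≠ 0 := by exact_mod_cast (by omega : r ≠ 0)
  simp [filtMult, this]

lemma norm_filtMult_le (r : ℕ) (θ : ℝ) : ‖filtMult r θ‖ ≤ 2 := by
  have h1 : ‖(1 / r : ℂ) * ∑ i ∈ Finset.range r, cis ((i + 1) * θ)‖ ≤ 1 := by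
    rw [norm_mul]
    have h2 : ‖∑ i ∈ Finset.range r, cis ((i + 1) * θ)‖ ≤ r := by
      refine (norm_sum_le _ _).trans ?_
      simp
    have h3 : ‖(1 / r : ℂ)‖ = 1 / r := by simp
    rw [h3]
    rcases Nat.eq_zero_or_pos r with rfl | hr
    · simp
    · have : (0 : ℝ) < r := by exact_mod_cast hr
      rw [one_div_mul_eq_div, div_le_one this]
      exact h2
  calc ‖filtMult r θ‖ ≤ ‖(1 : ℂ)‖ + _ := norm_sub_le _ _
    _ ≤ 1 + 1 := by rw [norm_one]; gcongr
    _ = 2 := by norm_num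

lemma norm_filtMult_sub_le (r : ℕ) (θ θ' : ℝ) :
    ‖filtMult r θ - filtMult r θ'‖ ≤ r * |θ - θ'| := by
  have e : filtMult r θ - filtMult r θ' =
      (1 / r : ℂ) * ∑ i ∈ Finset.range r, (cis ((i + 1) * θ') - cis ((i + 1) * θ)) := by
    rw [filtMult, filtMult, Finset.sum_sub_distrib]; ring
  rcases Nat.eq_zero_or_pos r with rfl | hr
  · simp [filtMult]
  have hr' : (0 : ℝ) < r := by exact_mod_cast hr
  have h2 : ‖∑ i ∈ Finset.range r, (cis ((i + 1) * θ') - cis ((i + 1) * θ))‖ ≤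
      r * (r * |θ - θ'|) := by
    refine (norm_sum_le _ _).trans ?_
    refine (Finset.sum_le_card_nsmul _ _ (r * |θ - θ'|) fun i hi => ?_).trans (by simp)
    refine (norm_cis_sub_cis_le _ _).trans ?_
    rw [← mul_sub, abs_mul, abs_sub_comm]
    have : ((i : ℝ) + 1) ≤ r := by exact_mod_cast Finset.mem_range.1 hi
    rw [abs_of_nonneg (by positivity)]
    gcongr
  rw [e, norm_mul, show ‖(1 / r : ℂ)‖ = 1 / r by simp, one_div_mul_eq_div, div_le_iff₀ hr']
  linarith

lemma re_filtMult {r : ℕ} (hr : 1 ≤ r) (θ : ℝ) :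
    (filtMult r θ).re = (1 / r) * ∑ i ∈ Finset.range r, (1 - cos ((i + 1) * θ)) := by
  have hr' : (r : ℝ) ≠ 0 := by exact_mod_cast (by omega : r ≠ 0)
  have : (1 / r : ℂ) = ((1 / r : ℝ) : ℂ) := by push_cast; rfl
  rw [filtMult, this, Complex.sub_re, Complex.re_ofReal_mul, Complex.re_sum]
  simp only [cis_eq, Complex.one_re, Complex.add_re, Complex.ofReal_re, Complex.re_ofReal_mul,
    Complex.I_re, mul_zero, add_zero, Finset.sum_sub_distrib, Finset.sum_const, Finset.card_range,
    nsmul_eq_mul, mul_one]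
  rw [mul_sub, one_div_mul_cancel hr']

/-- The real part is an average of `2 sin² ((i + 1) x)`. Terms with indices `k` apart are paired, where
`k = ⌈b / x⌉` is such that `k x` stays away from the multiples of `π`. -/
lemma re_filtMult_ge_aux {r : ℕ} (hr : 4 ≤ r) {b x : ℝ} (hb : 0 < b) (hb' : b ≤ π / 4)
    (hx : 4 * b ≤ r * x) (hx' : x ≤ π / 2) : (1 - cos b) / 2 ≤ (filtMult r (2 * x)).re := by
  have hr4 : (4 : ℝ) ≤ r := by exact_mod_cast hr
  have hx0 : 0 < x := by
    by_contra h
    nlinarith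
  set k := ⌈b / x⌉₊ with hk
  have hk1 : b ≤ k * x := by
    have := Nat.le_ceil (b / x)
    rwa [div_le_iff₀ hx0] at this
  have hk2 : k * x < b + x := by
    have := Nat.ceil_lt_add_one (by positivity : 0 ≤ b / x)
    rw [← hk] at this
    calc (k : ℝ) * x < (b / x + 1) * x := by gcongr
      _ = b + x := by field_simp
  have hk3 : (k : ℝ) ≤ r / 2 := by
    have h1 := Nat.ceil_lt_add_one (by positivity : 0 ≤ b / x)
    have h2 : b / x ≤ r / 4 := by rw [div_le_iff₀ hx0]; linarith
    rw [← hk] at h1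
    linarith
  have hkr : k ≤ r := by
    have : (k : ℝ) ≤ r := by linarith
    exact_mod_cast this
  have hcos : |cos (k * x)| ≤ cos b := by
    rw [abs_le]
    constructor
    · rw [← cos_pi_sub]
      exact cos_le_cos_of_nonneg_of_le_pi (by linarith) (by linarith) (by linarith)
    · exact cos_le_cos_of_nonneg_of_le_pi hb.le (by linarith) hk1
  have hpair : ∀ A : ℝ, 1 - cos b ≤ sin A ^ 2 + sin (A + k * x) ^ 2 := by
    intro A
    have e : sin A ^ 2 + sin (A + k * x) ^ 2 = 1 - cos (2 * A + k * x) * cos (k * x) := by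
      have h1 := cos_two_mul' A
      have h2 := cos_two_mul' (A + k * x)
      have h3 := sin_sq_add_cos_sq A
      have h4 := sin_sq_add_cos_sq (A + k * x)
      have h5 := cos_add (2 * A + k * x) (k * x)
      have h6 := cos_sub (2 * A + k * x) (k * x)
      rw [show 2 * A + k * x + k * x = 2 * (A + k * x) by ring] at h5
      rw [show 2 * A + k * x - k * x = 2 * A by ring] at h6
      linarith
    rw [e]
    have h1 : |cos (2 * A + k * x) * cos (k * x)| ≤ 1 * cos b := by
      rw [abs_mul]; exact mul_le_mul (abs_cos_le_one _) hcos (abs_nonneg _) zero_le_one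
    linarith [le_abs_self (cos (2 * A + k * x) * cos (k * x))]
  set g : ℕ → ℝ := fun i => sin ((i + 1) * x) ^ 2 with hg
  have hg0 : ∀ i, 0 ≤ g i := fun i => sq_nonneg _
  have hsum : (r - k : ℝ) * (1 - cos b) ≤ 2 * ∑ i ∈ Finset.range r, g i := by
    have h1 : ∑ i ∈ Finset.range (r - k), (g i + g (i + k)) ≤ 2 * ∑ i ∈ Finset.range r, g i := by
      rw [Finset.sum_add_distrib, two_mul]
      apply add_le_add
      · exact Finset.sum_le_sum_of_subset_of_nonneg
          (Finset.range_subset_range.2 (Nat.sub_le r k)) fun i _ _ => hg0 i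
      · have h2 := Finset.sum_range_add_sum_Ico g hkr
        rw [Finset.sum_Ico_eq_sum_range] at h2
        have h3 : 0 ≤ ∑ i ∈ Finset.range k, g i := Finset.sum_nonneg fun i _ => hg0 i
        simp_rw [add_comm k] at h2
        linarith
    refine le_trans ?_ h1
    have h2 := Finset.card_nsmul_le_sum (Finset.range (r - k)) (fun i => g i + g (i + k))
      (1 - cos b) (fun i _ => by
        have := hpair ((i + 1) * x)
        simp only [hg]
        push_cast
        rw [show ((i : ℝ) + k + 1) * x = (i + 1) * x + k * x by ring]
        exact this)
    rw [Finset.card_range, nsmul_eq_mul, Nat.cast_sub hkr] at h2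
    exact h2
  rw [re_filtMult (by omega)]
  have e : ∀ i : ℕ, 1 - cos ((i + 1) * (2 * x)) = 2 * g i := by
    intro i
    simp only [hg]
    rw [show ((i : ℝ) + 1) * (2 * x) = 2 * ((i + 1) * x) by ring, cos_two_mul, cos_sq']
    ring
  simp_rw [e]
  rw [← Finset.mul_sum, one_div_mul_eq_div, le_div_iff₀ (by linarith)]
  have h1 : 0 ≤ 1 - cos b := by linarith [cos_le_one b]
  nlinarith

/-- The multiplier is bounded below away from the multiples of `2 π`. -/
lemma norm_filtMult_ge {r : ℕ} (hr : 4 ≤ r) {b x : ℝ} (hb : 0 < b) (hb' : b ≤ π / 4)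
    (hx : 4 * b ≤ r * x) (hx' : 4 * b ≤ r * (π - x)) :
    (1 - cos b) / 2 ≤ ‖filtMult r (2 * x)‖ := by
  refine le_trans ?_ ((le_abs_self _).trans (Complex.abs_re_le_norm _))
  rcases le_total x (π / 2) with h | h
  · exact re_filtMult_ge_aux hr hb hb' hx h
  · have h1 := re_filtMult_ge_aux hr hb hb' hx' (by linarith)
    refine h1.trans_eq ?_
    rw [re_filtMult (by omega), re_filtMult (by omega)]
    congr 1
    refine Finset.sum_congr rfl fun i _ => ?_
    rw [show ((i : ℝ) + 1) * (2 * (π - x)) = ((i + 1 : ℕ) : ℝ) * (2 * π) - (i + 1) * (2 * x) by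
      push_cast; ring, cos_nat_mul_two_pi_sub]

/-- A filter costs `r` samples on the right and a factor in the sum of squares. -/
lemma sum_norm_filt_le {r : ℕ} (hr : 1 ≤ r) (h μ : ℝ) (F : ℤ → ℂ) (J : ℤ) :
    ∑ j ∈ Finset.Icc (-J) J, ‖filt r h μ F j‖ ^ 2 ≤
      4 * ∑ j ∈ Finset.Icc (-(J + r)) (J + r), ‖F j‖ ^ 2 := by
  have hr' : (0 : ℝ) < r := by exact_mod_cast hr
  set S := ∑ j ∈ Finset.Icc (-(J + r)) (J + r), ‖F j‖ ^ 2 with hS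
  have hpt : ∀ j, ‖filt r h μ F j‖ ^ 2 ≤
      2 * ‖F j‖ ^ 2 + 2 * (1 / r * ∑ i ∈ Finset.range r, ‖F (j + (i + 1))‖ ^ 2) := by
    intro j
    have h1 : ‖(1 / r : ℂ) * ∑ i ∈ Finset.range r, cis (-(μ * ((i + 1) * h))) * F (j + (i + 1))‖ ^ 2 ≤
        1 / r * ∑ i ∈ Finset.range r, ‖F (j + (i + 1))‖ ^ 2 := by
      have h2 : ‖∑ i ∈ Finset.range r, cis (-(μ * ((i + 1) * h))) * F (j + (i + 1))‖ ≤
          ∑ i ∈ Finset.range r, ‖F (j + (i + 1))‖ := by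
        refine (norm_sum_le _ _).trans_eq ?_
        simp
      have h3 := sq_sum_le_card_mul_sum_sq (s := Finset.range r)
        (f := fun i : ℕ => ‖F (j + (i + 1))‖)
      rw [Finset.card_range] at h3
      rw [norm_mul, show ‖(1 / r : ℂ)‖ = 1 / r by simp, mul_pow]
      calc (1 / r : ℝ) ^ 2 * ‖∑ i ∈ Finset.range r, cis (-(μ * ((i + 1) * h))) * F (j + (i + 1))‖ ^ 2
          ≤ (1 / r : ℝ) ^ 2 * (r * ∑ i ∈ Finset.range r, ‖F (j + (i + 1))‖ ^ 2) := by
            gcongr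
            exact (pow_le_pow_left₀ (norm_nonneg _) h2 2).trans h3
        _ = _ := by field_simp
    have h4 := norm_sub_le (F j)
      ((1 / r : ℂ) * ∑ i ∈ Finset.range r, cis (-(μ * ((i + 1) * h))) * F (j + (i + 1)))
    have h5 : ‖filt r h μ F j‖ ^ 2 ≤ (‖F j‖ +
      ‖(1 / r : ℂ) * ∑ i ∈ Finset.range r, cis (-(μ * ((i + 1) * h))) * F (j + (i + 1))‖) ^ 2 :=
      pow_le_pow_left₀ (norm_nonneg _) h4 2
    nlinarith [add_sq_le (a := ‖F j‖) (b := ‖(1 / r : ℂ) * ∑ i ∈ Finset.range r, cis (-(μ * ((i + 1) * h))) * F (j + (i + 1))‖)]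
  have hsub : ∀ d : ℤ, 0 ≤ d → d ≤ r → ∑ j ∈ Finset.Icc (-J) J, ‖F (j + d)‖ ^ 2 ≤ S := by
    intro d hd hd'
    have e : ∑ j ∈ Finset.Icc (-J) J, ‖F (j + d)‖ ^ 2 =
        ∑ j ∈ (Finset.Icc (-J) J).map (addRightEmbedding d), ‖F j‖ ^ 2 := by
      rw [Finset.sum_map]; rfl
    rw [e, Finset.map_add_right_Icc]
    apply Finset.sum_le_sum_of_subset_of_nonneg
    · apply Finset.Icc_subset_Icc <;> omega
    · intros; positivity
  calc ∑ j ∈ Finset.Icc (-J) J, ‖filt r h μ F j‖ ^ 2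
      ≤ ∑ j ∈ Finset.Icc (-J) J,
        (2 * ‖F j‖ ^ 2 + 2 * (1 / r * ∑ i ∈ Finset.range r, ‖F (j + (i + 1))‖ ^ 2)) :=
        Finset.sum_le_sum fun j _ => hpt j
    _ = 2 * ∑ j ∈ Finset.Icc (-J) J, ‖F j‖ ^ 2 + 2 * (1 / r * ∑ i ∈ Finset.range r,
        ∑ j ∈ Finset.Icc (-J) J, ‖F (j + (i + 1))‖ ^ 2) := by
        rw [Finset.sum_add_distrib, ← Finset.mul_sum, ← Finset.mul_sum, ← Finset.mul_sum,
          Finset.sum_comm]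
    _ ≤ 2 * S + 2 * (1 / r * ∑ i ∈ Finset.range r, S) := by
        gcongr with i hi
        · simpa using hsub 0 le_rfl (by positivity)
        · rw [Finset.mem_range] at hi
          exact hsub (i + 1) (by positivity) (by exact_mod_cast hi)
    _ = 4 * S := by
        rw [Finset.sum_const, Finset.card_range, nsmul_eq_mul]
        field_simp
        ring

lemma filt_cis (r : ℕ) (h μ ω : ℝ) (j : ℤ) :
    filt r h μ (fun j => cis (ω * (j * h))) j = filtMult r ((ω - μ) * h) * cis (ω * (j * h)) := by
  rw [filt, filtMult, sub_mul, one_mul, mul_assoc, Finset.sum_mul]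
  congr 2
  refine Finset.sum_congr rfl fun i _ => ?_
  rw [← cis_add, ← cis_add]
  congr 1
  push_cast
  ring

/-- The nonzero integers in `[-N, N]`. -/
noncomputable def modes (N : ℕ) : Finset ℤ := (Finset.Icc (-(N : ℤ)) N).erase 0

/-- The samples, with step `h`, of a sum of exponentials with frequencies in `α ℤ` and `β ℤ`. -/
noncomputable def trigSum (α β h : ℝ) (N M : ℕ) (x y : ℤ → ℂ) (j : ℤ) : ℂ :=
  ∑ n ∈ modes N, x n * cis (α * n * (j * h)) + ∑ m ∈ modes M, y m * cis (β * m * (j * h))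

lemma filt_add (r : ℕ) (h μ : ℝ) (F G : ℤ → ℂ) (j : ℤ) :
    filt r h μ (fun j => F j + G j) j = filt r h μ F j + filt r h μ G j := by
  simp only [filt, mul_add, Finset.sum_add_distrib]; ring

lemma filt_sum {ι : Type*} (s : Finset ι) (r : ℕ) (h μ : ℝ) (c : ι → ℂ) (F : ι → ℤ → ℂ) (j : ℤ) :
    filt r h μ (fun j => ∑ i ∈ s, c i * F i j) j = ∑ i ∈ s, c i * filt r h μ (F i) j := by
  simp only [filt, mul_sub, Finset.sum_sub_distrib, Finset.mul_sum]
  rw [Finset.sum_comm]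
  congr 1
  refine Finset.sum_congr rfl fun i _ => Finset.sum_congr rfl fun k _ => ?_
  ring

lemma filt_trigSum (α β h : ℝ) (N M : ℕ) (x y : ℤ → ℂ) (r : ℕ) (μ : ℝ) (j : ℤ) :
    filt r h μ (trigSum α β h N M x y) j = trigSum α β h N M
      (fun n => filtMult r ((α * n - μ) * h) * x n) (fun m => filtMult r ((β * m - μ) * h) * y m) j := by
  unfold trigSum
  rw [filt_add, filt_sum, filt_sum]
  simp only [filt_cis]
  congr 1 <;> refine Finset.sum_congr rfl fun i _ => by ring

/-! ### Estimates for the positive frequencies -/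

/-- `B` bounds the coefficients of the positive frequencies `α n` and `β m` in the sense of the
weakened gap condition: single coefficients are weighted with the square of (a lower bound for) the
distance to the other family, and for close frequencies the sum of the coefficients is bounded
without a weight. -/
def PairBound (α β : ℝ) (N M : ℕ) (x y : ℤ → ℂ) (B : ℝ) : Prop :=
  ∀ ρ ρ' : ℤ → ℝ,
    (∀ n ∈ Finset.Icc (1 : ℤ) N, 0 ≤ ρ n ∧ ρ n ≤ π / 2 ∧
      ∀ m ∈ Finset.Icc (1 : ℤ) M, ρ n ≤ |α * n - β * m|) →
    (∀ m ∈ Finset.Icc (1 : ℤ) M, 0 ≤ ρ' m ∧ ρ' m ≤ π / 2 ∧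
      ∀ n ∈ Finset.Icc (1 : ℤ) N, ρ' m ≤ |α * n - β * m|) →
    ∑ n ∈ Finset.Icc (1 : ℤ) N, ρ n ^ 2 * ‖x n‖ ^ 2 +
      ∑ m ∈ Finset.Icc (1 : ℤ) M, ρ' m ^ 2 * ‖y m‖ ^ 2 +
      ∑ n ∈ Finset.Icc (1 : ℤ) N, ∑ m ∈ Finset.Icc (1 : ℤ) M,
        (if |α * n - β * m| ≤ π / 4 then ‖x n + y m‖ ^ 2 else 0) ≤ B

lemma PairBound.mono {α β : ℝ} {N M : ℕ} {x y : ℤ → ℂ} {B B' : ℝ} (h : PairBound α β N M x y B)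
    (hB : B ≤ B') : PairBound α β N M x y B' := fun ρ ρ' h1 h2 => (h ρ ρ' h1 h2).trans hB

lemma abs_mul_sub_mul_ge {α : ℝ} (hα : π ≤ α) {n k : ℤ} (h : n ≠ k) :
    π ≤ |α * n - α * k| := by
  rw [← mul_sub, abs_mul, abs_of_nonneg (pi_pos.le.trans hα)]
  have : (1 : ℝ) ≤ |(n : ℝ) - k| := by
    exact_mod_cast Int.one_le_abs (sub_ne_zero.2 h)
  nlinarith [pi_pos]

/-- A frequency `ω` has at most one partner in `α ℤ`. -/
lemma partner_unique {α ω : ℝ} (hα : π ≤ α) {n k : ℤ} (hn : |α * n - ω| ≤ π / 4)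
    (hk : |α * k - ω| ≤ π / 2) : n = k := by
  by_contra h
  have h1 := abs_mul_sub_mul_ge hα h
  have h2 := abs_sub_le (α * n) ω (α * k)
  rw [abs_sub_comm ω] at h2
  linarith [pi_pos]

/-- A weight which is admissible in `PairBound` and at least the distance to the partner, for the
points that have a partner. -/
lemma exists_partnerGap {α : ℝ} (hα : π ≤ α) (N : ℕ) (f : ℤ → ℝ) :
    ∃ σ : ℤ → ℝ, ∀ m, (0 ≤ σ m ∧ σ m ≤ π / 2 ∧ ∀ n ∈ Finset.Icc (1 : ℤ) N, σ m ≤ |α * n - f m|) ∧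
      ∑ n ∈ Finset.Icc (1 : ℤ) N, (if |α * n - f m| ≤ π / 4 then |α * n - f m| ^ 2 else 0) ≤
        σ m ^ 2 := by
  have : ∀ m, ∃ s : ℝ, (0 ≤ s ∧ s ≤ π / 2 ∧ ∀ n ∈ Finset.Icc (1 : ℤ) N, s ≤ |α * n - f m|) ∧
      ∑ n ∈ Finset.Icc (1 : ℤ) N, (if |α * n - f m| ≤ π / 4 then |α * n - f m| ^ 2 else 0) ≤
        s ^ 2 := by
    intro m
    by_cases h : ∃ n ∈ Finset.Icc (1 : ℤ) N, |α * n - f m| ≤ π / 4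
    · obtain ⟨n, hn, hnm⟩ := h
      refine ⟨|α * n - f m|, ⟨abs_nonneg _, by linarith [pi_pos], fun k _ => ?_⟩, ?_⟩
      · by_contra hlt
        rw [not_le] at hlt
        have := partner_unique hα hnm (by linarith [pi_pos] : |α * k - f m| ≤ π / 2)
        subst this
        exact lt_irrefl _ hlt
      · rw [Finset.sum_eq_single_of_mem n hn, if_pos hnm]
        intro k _ hk
        rw [if_neg]
        intro hkm
        exact hk (partner_unique hα hkm (by linarith [pi_pos]))
    · push Not at h
      refine ⟨0, ⟨le_rfl, by positivity, fun _ _ => abs_nonneg _⟩, ?_⟩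
      rw [Finset.sum_eq_zero]
      · norm_num
      · intro n hn
        rw [if_neg (not_le.2 (h n hn))]
  choose σ hσ using this
  exact ⟨σ, hσ⟩

/-- Multipliers which are bounded below and Lipschitz in the frequency do not affect the estimate. -/
lemma PairBound.of_mult {α β : ℝ} (hα : π ≤ α) {N M : ℕ} {x y p q : ℤ → ℂ}
    {B c K : ℝ} (hc : 0 < c) (hp : ∀ n ∈ Finset.Icc (1 : ℤ) N, c ≤ ‖p n‖)
    (hq : ∀ m ∈ Finset.Icc (1 : ℤ) M, c ≤ ‖q m‖)
    (hpq : ∀ n ∈ Finset.Icc (1 : ℤ) N, ∀ m ∈ Finset.Icc (1 : ℤ) M,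
      ‖p n - q m‖ ≤ K * |α * n - β * m|)
    (h : PairBound α β N M (fun n => p n * x n) (fun m => q m * y m) B) :
    PairBound α β N M x y ((3 + 2 * K ^ 2 / c ^ 2) / c ^ 2 * B) := by
  intro ρ ρ' hρ hρ'
  have h1 := h ρ ρ' hρ hρ'
  obtain ⟨σ, hσ⟩ := exists_partnerGap hα N (fun m => β * m)
  have h2 := h (fun _ => 0) σ (fun n _ => ⟨le_rfl, by positivity, fun _ _ => abs_nonneg _⟩)
    (fun m _ => (hσ m).1)
  simp only [norm_mul, mul_pow] at h1 h2
  set A3 := ∑ n ∈ Finset.Icc (1 : ℤ) N, ∑ m ∈ Finset.Icc (1 : ℤ) M,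
        (if |α * n - β * m| ≤ π / 4 then ‖p n * x n + q m * y m‖ ^ 2 else 0) with hA3
  have hA3' : 0 ≤ A3 := Finset.sum_nonneg fun n _ => Finset.sum_nonneg fun m _ => by
    split_ifs <;> positivity
  have e1 : c ^ 2 * ∑ n ∈ Finset.Icc (1 : ℤ) N, ρ n ^ 2 * ‖x n‖ ^ 2 ≤
      ∑ n ∈ Finset.Icc (1 : ℤ) N, ρ n ^ 2 * (‖p n‖ ^ 2 * ‖x n‖ ^ 2) := by
    rw [Finset.mul_sum]
    refine Finset.sum_le_sum fun n hn => ?_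
    have := pow_le_pow_left₀ hc.le (hp n hn) 2
    have h3 : 0 ≤ ρ n ^ 2 * ‖x n‖ ^ 2 := by positivity
    nlinarith
  have e2 : ∀ ρ' : ℤ → ℝ, c ^ 2 * ∑ n ∈ Finset.Icc (1 : ℤ) M, ρ' n ^ 2 * ‖y n‖ ^ 2 ≤
      ∑ n ∈ Finset.Icc (1 : ℤ) M, ρ' n ^ 2 * (‖q n‖ ^ 2 * ‖y n‖ ^ 2) := by
    intro ρ'
    rw [Finset.mul_sum]
    refine Finset.sum_le_sum fun n hn => ?_
    have := pow_le_pow_left₀ hc.le (hq n hn) 2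
    have h3 : 0 ≤ ρ' n ^ 2 * ‖y n‖ ^ 2 := by positivity
    nlinarith
  have e3 : c ^ 2 * ∑ n ∈ Finset.Icc (1 : ℤ) N, ∑ m ∈ Finset.Icc (1 : ℤ) M,
        (if |α * n - β * m| ≤ π / 4 then ‖x n + y m‖ ^ 2 else 0) ≤
      2 * A3 + 2 * K ^ 2 * ∑ m ∈ Finset.Icc (1 : ℤ) M, σ m ^ 2 * ‖y m‖ ^ 2 := by
    have e4 : ∑ n ∈ Finset.Icc (1 : ℤ) N, ∑ m ∈ Finset.Icc (1 : ℤ) M,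
        (if |α * n - β * m| ≤ π / 4 then |α * n - β * m| ^ 2 else 0) * ‖y m‖ ^ 2 ≤
        ∑ m ∈ Finset.Icc (1 : ℤ) M, σ m ^ 2 * ‖y m‖ ^ 2 := by
      rw [Finset.sum_comm]
      refine Finset.sum_le_sum fun m _ => ?_
      rw [← Finset.sum_mul]
      exact mul_le_mul_of_nonneg_right (hσ m).2 (by positivity)
    refine le_trans ?_ (add_le_add le_rfl (mul_le_mul_of_nonneg_left e4 (by positivity)))
    rw [hA3, Finset.mul_sum, Finset.mul_sum, Finset.mul_sum, ← Finset.sum_add_distrib]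
    refine Finset.sum_le_sum fun n hn => ?_
    rw [Finset.mul_sum, Finset.mul_sum, Finset.mul_sum, ← Finset.sum_add_distrib]
    refine Finset.sum_le_sum fun m hm => ?_
    split_ifs with hnm
    · have e5 : p n * (x n + y m) = (p n * x n + q m * y m) + (p n - q m) * y m := by ring
      have e6 : c * ‖x n + y m‖ ≤ ‖p n * x n + q m * y m‖ + K * |α * n - β * m| * ‖y m‖ := by
        calc c * ‖x n + y m‖ ≤ ‖p n‖ * ‖x n + y m‖ := by gcongr; exact hp n hn
          _ = ‖(p n * x n + q m * y m) + (p n - q m) * y m‖ := by rw [← norm_mul, e5]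
          _ ≤ ‖p n * x n + q m * y m‖ + ‖(p n - q m) * y m‖ := norm_add_le _ _
          _ ≤ _ := by rw [norm_mul (p n - q m)]; gcongr; exact hpq n hn m hm
      have e7 := pow_le_pow_left₀ (by positivity) e6 2
      have e8 := add_sq_le (a := ‖p n * x n + q m * y m‖) (b := K * |α * n - β * m| * ‖y m‖)
      calc c ^ 2 * ‖x n + y m‖ ^ 2 = (c * ‖x n + y m‖) ^ 2 := by ring
        _ ≤ _ := e7.trans e8
        _ = _ := by ring
    · simp
  have e9 := e2 σ
  have e10 := e2 ρ'
  simp only [ne_eq, OfNat.ofNat_ne_zero, not_false_eq_true, zero_pow, zero_mul,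
    Finset.sum_const_zero, zero_add] at h2
  have hc2 : 0 < c ^ 2 := by positivity
  have e11 : ∑ m ∈ Finset.Icc (1 : ℤ) M, σ m ^ 2 * ‖y m‖ ^ 2 ≤ B / c ^ 2 := by
    rw [le_div_iff₀ hc2]; linarith
  have e12 : 2 * K ^ 2 * ∑ m ∈ Finset.Icc (1 : ℤ) M, σ m ^ 2 * ‖y m‖ ^ 2 ≤ 2 * K ^ 2 * (B / c ^ 2) := by
    gcongr
  have hσ0 : 0 ≤ ∑ m ∈ Finset.Icc (1 : ℤ) M, σ m ^ 2 * (‖q m‖ ^ 2 * ‖y m‖ ^ 2) :=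
    Finset.sum_nonneg fun m _ => by positivity
  have e13 : (3 + 2 * K ^ 2 / c ^ 2) / c ^ 2 * B = (3 * B + 2 * K ^ 2 * (B / c ^ 2)) / c ^ 2 := by
    ring
  rw [e13, le_div_iff₀ hc2]
  linarith

lemma mem_modes {N : ℕ} {n : ℤ} : n ∈ modes N ↔ n ≠ 0 ∧ -(N : ℤ) ≤ n ∧ n ≤ N := by
  simp [modes]

/-- The estimate when the lowest frequencies `-α N` and `-β M` are absent, so that all frequencies
lie in an interval which is short enough for Poisson summation without interference. -/
lemma pairBound_of_lowest_zero {T : ℝ} (hT : 2 < T) : ∃ C : ℝ, 0 < C ∧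
    ∀ {α β h : ℝ} {N M : ℕ} {J : ℤ} {x y : ℤ → ℂ}, π ≤ α → π ≤ β → 0 < h → T ≤ J * h →
      α * N ≤ π / h - π / 4 → β * M ≤ π / h - π / 4 → x (-N) = 0 → y (-M) = 0 →
      PairBound α β N M x y
        (C * (h * ∑ j ∈ Finset.Icc (-J) J, ‖trigSum α β h N M x y j‖ ^ 2)) := by
  have hσ : 0 < T ^ 2 - 4 := by nlinarith
  have hG0 : 0 < kernel T 0 := (kernel_pi_div_four_pos hT.le).trans_le
    (kernel_anti hT.le (by simp))
  set c := min (4 * (T ^ 2 - 4) / π) (kernel T (π / 4)) with hc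
  have hc0 : 0 < c := lt_min (by positivity) (kernel_pi_div_four_pos hT.le)
  refine ⟨kernel T 0 / c, by positivity, ?_⟩
  intro α β h N M J x y hα hβ hh hJ hN hM hx hy
  have hband : ∀ {γ : ℝ} {N : ℕ}, π ≤ γ → γ * N ≤ π / h - π / 4 →
      ∀ n ∈ (modes N).erase (-(N : ℤ)), γ * n ∈ Icc (-(π / h - 5 * π / 4)) (π / h - π / 4) := by
    intro γ N hγ hN n hn
    rw [Finset.mem_erase, mem_modes] at hn
    have h1 : -(N : ℤ) + 1 ≤ n := by omega
    have h2 : -(N : ℝ) + 1 ≤ n := by exact_mod_cast h1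
    have h3 : (n : ℝ) ≤ N := by exact_mod_cast hn.2.2.2
    have hγ0 : 0 ≤ γ := pi_pos.le.trans hγ
    constructor <;> nlinarith
  have hsub : ∀ N : ℕ, Finset.Icc (1 : ℤ) N ⊆ (modes N).erase (-(N : ℤ)) := by
    intro N n hn
    rw [Finset.mem_Icc] at hn
    rw [Finset.mem_erase, mem_modes]
    omega
  intro ρ ρ' hρ hρ'
  have key := two_family_estimate ((modes N).erase (-(N : ℤ))) ((modes M).erase (-(M : ℤ)))
    (fun n => α * n) (fun m => β * m) x y hT hh J hJ (hband hα hN) (hband hβ hM)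
    (fun i _ j _ hij => abs_mul_sub_mul_ge hα hij) (fun i _ j _ hij => abs_mul_sub_mul_ge hβ hij)
    (by
      have : 2 * π / h = π / h + π / h := by ring
      rw [this]; linarith [pi_pos])
  have etrig : ∀ j : ℤ, ∑ i ∈ (modes N).erase (-(N : ℤ)), x i * cis (α * i * (j * h)) +
      ∑ k ∈ (modes M).erase (-(M : ℤ)), y k * cis (β * k * (j * h)) = trigSum α β h N M x y j := by
    intro j
    rw [trigSum, Finset.sum_erase _ (by rw [hx, zero_mul]), Finset.sum_erase _ (by rw [hy, zero_mul])]
  simp only [etrig] at key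
  have hmem : ∀ {n : ℤ} {N : ℕ}, n ∈ (modes N).erase (-(N : ℤ)) → n ≤ 0 ∨ n ∈ Finset.Icc (1 : ℤ) N := by
    intro n N hn
    rw [Finset.mem_erase, mem_modes] at hn
    rw [Finset.mem_Icc]; omega
  have hfar : ∀ {γ δ : ℝ} {n m : ℤ}, π ≤ γ → π ≤ δ → 1 ≤ n → m ≤ 0 → π / 2 ≤ |γ * n - δ * m| := by
    intro γ δ n m hγ hδ hn hm
    have h1 : (1 : ℝ) ≤ n := by exact_mod_cast hn
    have h2 : (m : ℝ) ≤ 0 := by exact_mod_cast hm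
    refine le_trans ?_ (le_abs_self _)
    nlinarith [pi_pos]
  have d1 : ∀ n ∈ Finset.Icc (1 : ℤ) N, c * ρ n ^ 2 ≤ kernel T 0 -
      ∑ k ∈ (modes M).erase (-(M : ℤ)), kernel T (α * n - β * k) := by
    intro n hn
    have h1 := sum_kernel_le ((modes M).erase (-(M : ℤ))) (fun m : ℤ => β * (m : ℝ)) hT.le
      (l := α * n) (fun i _ j _ hij => abs_mul_sub_mul_ge hβ hij) (hρ n hn).1 (hρ n hn).2.1 (by
        intro m hm
        rcases hmem hm with h | h
        · exact (hρ n hn).2.1.trans (hfar hα hβ (Finset.mem_Icc.1 hn).1 h)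
        · exact (hρ n hn).2.2 m h)
    refine le_trans ?_ h1
    gcongr
    exact min_le_left _ _
  have d2 : ∀ m ∈ Finset.Icc (1 : ℤ) M, c * ρ' m ^ 2 ≤ kernel T 0 -
      ∑ k ∈ (modes N).erase (-(N : ℤ)), kernel T (β * m - α * k) := by
    intro n hn
    have h1 := sum_kernel_le ((modes N).erase (-(N : ℤ))) (fun m : ℤ => α * (m : ℝ)) hT.le
      (l := β * n) (fun i _ j _ hij => abs_mul_sub_mul_ge hα hij) (hρ' n hn).1 (hρ' n hn).2.1 (by
        intro m hm
        rcases hmem hm with h | h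
        · exact (hρ' n hn).2.1.trans (hfar hβ hα (Finset.mem_Icc.1 hn).1 h)
        · rw [abs_sub_comm]; exact (hρ' n hn).2.2 m h)
    refine le_trans ?_ h1
    gcongr
    exact min_le_left _ _
  have dnn : ∀ {γ : ℝ} (N : ℕ) (ω : ℝ), π ≤ γ → 0 ≤ kernel T 0 -
      ∑ k ∈ (modes N).erase (-(N : ℤ)), kernel T (ω - γ * k) := by
    intro γ N ω hγ
    have h1 := sum_kernel_le ((modes N).erase (-(N : ℤ))) (fun m : ℤ => γ * (m : ℝ)) hT.le
      (l := ω) (fun i _ j _ hij => abs_mul_sub_mul_ge hγ hij) le_rfl (by positivity)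
      (fun _ _ => abs_nonneg _)
    simpa using h1
  have s1 : c * ∑ n ∈ Finset.Icc (1 : ℤ) N, ρ n ^ 2 * ‖x n‖ ^ 2 ≤
      ∑ n ∈ (modes N).erase (-(N : ℤ)), (kernel T 0 -
        ∑ k ∈ (modes M).erase (-(M : ℤ)), kernel T (α * n - β * k)) * ‖x n‖ ^ 2 := by
    rw [Finset.mul_sum]
    refine (Finset.sum_le_sum fun n hn => ?_).trans
      (Finset.sum_le_sum_of_subset_of_nonneg (hsub N) fun n _ _ =>
        mul_nonneg (dnn M _ hβ) (by positivity))
    rw [← mul_assoc]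
    exact mul_le_mul_of_nonneg_right (d1 n hn) (by positivity)
  have s2 : c * ∑ n ∈ Finset.Icc (1 : ℤ) M, ρ' n ^ 2 * ‖y n‖ ^ 2 ≤
      ∑ n ∈ (modes M).erase (-(M : ℤ)), (kernel T 0 -
        ∑ k ∈ (modes N).erase (-(N : ℤ)), kernel T (β * n - α * k)) * ‖y n‖ ^ 2 := by
    rw [Finset.mul_sum]
    refine (Finset.sum_le_sum fun n hn => ?_).trans
      (Finset.sum_le_sum_of_subset_of_nonneg (hsub M) fun n _ _ =>
        mul_nonneg (dnn N _ hα) (by positivity))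
    rw [← mul_assoc]
    exact mul_le_mul_of_nonneg_right (d2 n hn) (by positivity)
  have s3 : c * ∑ n ∈ Finset.Icc (1 : ℤ) N, ∑ m ∈ Finset.Icc (1 : ℤ) M,
        (if |α * n - β * m| ≤ π / 4 then ‖x n + y m‖ ^ 2 else 0) ≤
      ∑ n ∈ (modes N).erase (-(N : ℤ)), ∑ k ∈ (modes M).erase (-(M : ℤ)),
        kernel T (α * n - β * k) * ‖x n + y k‖ ^ 2 := by
    have hnn : ∀ n k : ℤ, 0 ≤ kernel T (α * n - β * k) * ‖x n + y k‖ ^ 2 := fun n k =>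
      mul_nonneg (kernel_nonneg hT.le _) (by positivity)
    refine le_trans ?_ (Finset.sum_le_sum_of_subset_of_nonneg (hsub N) fun n _ _ =>
      Finset.sum_nonneg fun k _ => hnn n k)
    rw [Finset.mul_sum]
    refine Finset.sum_le_sum fun n _ => ?_
    refine le_trans ?_ (Finset.sum_le_sum_of_subset_of_nonneg (hsub M) fun k _ _ => hnn n k)
    rw [Finset.mul_sum]
    refine Finset.sum_le_sum fun m _ => ?_
    split_ifs with hnm
    · have h1 : c ≤ kernel T (α * n - β * m) := (min_le_right _ _).trans
        (kernel_anti hT.le (by rwa [abs_of_pos (by positivity : 0 < π / 4)]))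
      gcongr
    · rw [mul_zero]; exact hnn n m
  rw [div_mul_eq_mul_div, le_div_iff₀ hc0]
  linarith

/-- The estimate for small steps. The filters remove the two lowest frequencies, which are too close
to the top of the band modulo `2 π / h`; their multipliers are bounded below on the positive
frequencies because `π / h` is at distance at least `π / 4` from all frequencies. -/
theorem pairBound_of_small_step {τ : ℝ} (hτ : 2 < τ) : ∃ h₀ C : ℝ, 0 < h₀ ∧ 0 < C ∧
    ∀ {α β h : ℝ} {N M : ℕ} {J : ℤ} (x y : ℤ → ℂ), π ≤ α → π ≤ β → 0 < h → h ≤ h₀ → J * h = τ →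
      α * N ≤ π / h - π / 4 → β * M ≤ π / h - π / 4 →
      PairBound α β N M x y
        (C * (h * ∑ j ∈ Finset.Icc (-J) J, ‖trigSum α β h N M x y j‖ ^ 2)) := by
  obtain ⟨C, hC, hbound⟩ := pairBound_of_lowest_zero (T := (τ + 2) / 2) (by linarith)
  set σ := (τ - 2) / 2 with hσ
  have hσ0 : 0 < σ := by rw [hσ]; linarith
  set b := min (π / 4) (π * σ / 64) with hb
  have hb0 : 0 < b := lt_min (by positivity) (by positivity)
  have hcb : cos b < 1 := by
    have hb4 : b ≤ π / 4 := min_le_left _ _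
    rw [← cos_zero]
    exact cos_lt_cos_of_nonneg_of_le_pi le_rfl (by linarith [pi_pos]) hb0
  set c := (1 - cos b) / 2 with hc
  have hc0 : 0 < c := by rw [hc]; linarith
  refine ⟨σ / 16, (3 + 2 * (4 * τ) ^ 2 / (c ^ 2) ^ 2) / (c ^ 2) ^ 2 * (16 * C), by positivity,
    by positivity, ?_⟩
  intro α β h N M J x y hα hβ hh hh0 hJ hN hM
  -- the spare time is `τ - (τ + 2) / 2 = σ`, which suffices for two filters of length `r h ≤ σ / 2`
  set r := ⌊σ / (2 * h)⌋₊ with hr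
  have hr1 : (r : ℝ) * h ≤ σ / 2 := by
    have := Nat.floor_le (by positivity : 0 ≤ σ / (2 * h))
    rw [← hr, le_div_iff₀ (by positivity)] at this
    linarith
  have hr2 : σ / 4 ≤ r * h := by
    have := Nat.lt_floor_add_one (σ / (2 * h))
    rw [← hr, div_lt_iff₀ (by positivity)] at this
    linarith
  have hr4 : 4 ≤ r := by
    apply Nat.le_floor
    push_cast
    rw [le_div_iff₀ (by positivity)]
    linarith
  set A : ℝ := α * N with hA
  set A' : ℝ := β * M with hA'
  have hA0 : 0 ≤ A := mul_nonneg (pi_pos.le.trans hα) (by positivity)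
  have hA0' : 0 ≤ A' := mul_nonneg (pi_pos.le.trans hβ) (by positivity)
  set P : ℝ → ℂ := fun ω => filtMult r ((ω - -A) * h) * filtMult r ((ω - -A') * h) with hP
  have hlow1 : ∀ ω B : ℝ, π ≤ ω → ω ≤ π / h - π / 4 → 0 ≤ B → B ≤ π / h - π / 4 →
      c ≤ ‖filtMult r ((ω - -B) * h)‖ := by
    intro ω B h1 h2 h3 h4
    have e : (ω - -B) * h = 2 * ((ω + B) * h / 2) := by ring
    rw [e]
    have hbσ : 4 * b ≤ r * h * (π / 4) := by
      have h5 : b ≤ π * σ / 64 := min_le_right _ _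
      have h6 : σ / 4 * (π / 4) ≤ r * h * (π / 4) := by gcongr
      linarith
    have hπh : π / h * h = π := by field_simp
    have hr0 : (0 : ℝ) ≤ r := by positivity
    apply norm_filtMult_ge hr4 hb0 (min_le_left _ _)
    · have : π / 4 * h ≤ (ω + B) * h / 2 := by nlinarith [pi_pos]
      calc 4 * b ≤ r * (π / 4 * h) := by linarith
        _ ≤ _ := by gcongr
    · have : π / 4 * h ≤ π - (ω + B) * h / 2 := by
        have : (ω + B) * h ≤ (2 * (π / h) - π / 2) * h := by gcongr; linarith
        nlinarith
      calc 4 * b ≤ r * (π / 4 * h) := by linarith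
        _ ≤ _ := by gcongr
  have hlow : ∀ ω : ℝ, π ≤ ω → ω ≤ π / h - π / 4 → c ^ 2 ≤ ‖P ω‖ := by
    intro ω h1 h2
    simp only [hP, norm_mul]
    rw [sq]
    exact mul_le_mul (hlow1 ω A h1 h2 hA0 hN) (hlow1 ω A' h1 h2 hA0' hM) hc0.le (norm_nonneg _)
  have hlip : ∀ ω ω' : ℝ, ‖P ω - P ω'‖ ≤ 4 * τ * |ω - ω'| := by
    intro ω ω'
    have h1 : ∀ B, ‖filtMult r ((ω - B) * h) - filtMult r ((ω' - B) * h)‖ ≤ τ * |ω - ω'| := by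
      intro B
      refine (norm_filtMult_sub_le _ _ _).trans ?_
      rw [← sub_mul, sub_sub_sub_cancel_right, abs_mul, abs_of_pos hh]
      have : r * h ≤ τ := by rw [hσ] at hr1; linarith
      calc r * (|ω - ω'| * h) = (r * h) * |ω - ω'| := by ring
        _ ≤ _ := by gcongr
    have e : P ω - P ω' = (filtMult r ((ω - -A) * h) - filtMult r ((ω' - -A) * h)) *
        filtMult r ((ω - -A') * h) + filtMult r ((ω' - -A) * h) *
        (filtMult r ((ω - -A') * h) - filtMult r ((ω' - -A') * h)) := by simp only [hP]; ring
    rw [e]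
    refine (norm_add_le _ _).trans ?_
    rw [norm_mul, norm_mul]
    have h2 := mul_le_mul (h1 (-A)) (norm_filtMult_le r ((ω - -A') * h)) (norm_nonneg _)
      (by positivity)
    have h3 := mul_le_mul (norm_filtMult_le r ((ω' - -A) * h)) (h1 (-A')) (norm_nonneg _)
      (by positivity)
    linarith
  have hfreq : ∀ {γ : ℝ} {N : ℕ} {n : ℤ}, π ≤ γ → γ * N ≤ π / h - π / 4 →
      n ∈ Finset.Icc (1 : ℤ) N → π ≤ γ * n ∧ γ * n ≤ π / h - π / 4 := by
    intro γ N n hγ hN hn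
    rw [Finset.mem_Icc] at hn
    have h1 : (1 : ℝ) ≤ n := by exact_mod_cast hn.1
    have h2 : (n : ℝ) ≤ N := by exact_mod_cast hn.2
    constructor <;> nlinarith [pi_pos]
  refine (PairBound.of_mult (p := fun n => P (α * n)) (q := fun m => P (β * m)) (c := c ^ 2)
    (K := 4 * τ) hα (by positivity) (fun n hn => hlow _ (hfreq hα hN hn).1 (hfreq hα hN hn).2)
    (fun n hn => hlow _ (hfreq hβ hM hn).1 (hfreq hβ hM hn).2) (fun n _ m _ => hlip _ _)
    (B := (16 * C) * (h * ∑ j ∈ Finset.Icc (-J) J, ‖trigSum α β h N M x y j‖ ^ 2)) ?_).mono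
    (le_of_eq (by ring))
  have hz : filtMult r 0 = 0 := filtMult_zero (by omega)
  have hb1 := hbound (α := α) (β := β) (h := h) (N := N) (M := M) (J := J - r - r)
    (x := fun n => P (α * n) * x n) (y := fun m => P (β * m) * y m) hα hβ hh
    (by push_cast; nlinarith) hN hM
    (by simp [hP, hA, hz]) (by simp [hP, hA', hz])
  refine hb1.mono ?_
  have e : trigSum α β h N M (fun n => P (α * n) * x n) (fun m => P (β * m) * y m) =
      filt r h (-A) (filt r h (-A') (trigSum α β h N M x y)) := by
    ext j
    have : filt r h (-A') (trigSum α β h N M x y) = trigSum α β h N M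
      (fun n => filtMult r ((α * n - -A') * h) * x n)
      (fun m => filtMult r ((β * m - -A') * h) * y m) := funext fun j => filt_trigSum _ _ _ _ _ _ _ _ _ _
    rw [this, filt_trigSum]
    simp only [hP, mul_assoc]
  rw [e]
  have f1 := sum_norm_filt_le (by omega : 1 ≤ r) h (-A) (filt r h (-A') (trigSum α β h N M x y)) (J - r - r)
  have f2 := sum_norm_filt_le (by omega : 1 ≤ r) h (-A') (trigSum α β h N M x y) (J - r)
  rw [sub_add_cancel] at f1 f2
  calc C * (h * ∑ j ∈ Finset.Icc (-(J - r - r)) (J - r - r),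
        ‖filt r h (-A) (filt r h (-A') (trigSum α β h N M x y)) j‖ ^ 2)
      ≤ C * (h * (4 * (4 * ∑ j ∈ Finset.Icc (-J) J, ‖trigSum α β h N M x y j‖ ^ 2))) := by
        gcongr
        linarith
    _ = _ := by ring

/-! ### Large steps, and the discrete observability estimate -/

lemma cis_injOn {a b : ℝ} (ha : |a| < π) (hb : |b| < π) (h : cis a = cis b) : a = b := by
  rw [abs_lt] at ha hb
  unfold cis at h
  have := Complex.exp_inj_of_neg_pi_lt_of_le_pi (x := Complex.I * a) (y := Complex.I * b)
    (by simpa using ha.1) (by simpa using ha.2.le) (by simpa using hb.1) (by simpa using hb.2.le) h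
  have h2 := mul_left_cancel₀ Complex.I_ne_zero this
  exact_mod_cast h2

/-- Finitely many exponentials with distinct nodes: the polynomial with the other nodes as its zeros
recovers a coefficient from the samples. -/
lemma coeff_le_samples {ι : Type*} (S : Finset ι) (ν : ι → ℝ) (h : ℝ) (J : ℕ)
    (hinj : ∀ a ∈ S, ∀ b ∈ S, cis (ν a * h) = cis (ν b * h) → a = b) (hcard : S.card ≤ 2 * J + 1) :
    ∃ K : ℝ, 0 ≤ K ∧ ∀ x : ι → ℂ, ∀ a ∈ S,
      ‖x a‖ ^ 2 ≤ K * ∑ j ∈ Finset.Icc (-(J : ℤ)) J, ‖∑ b ∈ S, x b * cis (ν b * (j * h))‖ ^ 2 := by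
  classical
  have hone : ∀ a ∈ S, ∃ K : ℝ, 0 ≤ K ∧ ∀ x : ι → ℂ,
      ‖x a‖ ^ 2 ≤ K * ∑ j ∈ Finset.Icc (-(J : ℤ)) J, ‖∑ b ∈ S, x b * cis (ν b * (j * h))‖ ^ 2 := by
    intro a ha
    set Q : Polynomial ℂ := ∏ b ∈ S.erase a, (Polynomial.X - Polynomial.C (cis (ν b * h))) with hQ
    have hdeg : Q.natDegree < 2 * J + 1 := by
      rw [hQ, Polynomial.natDegree_prod_of_monic _ _ fun b _ => Polynomial.monic_X_sub_C _]
      simp only [Polynomial.natDegree_X_sub_C, Finset.sum_const, smul_eq_mul, mul_one]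
      rw [Finset.card_erase_of_mem ha]
      have := Finset.card_pos.2 ⟨a, ha⟩
      omega
    have hQa : Q.eval (cis (ν a * h)) ≠ 0 := by
      rw [hQ, Polynomial.eval_prod, Finset.prod_ne_zero_iff]
      intro b hb
      rw [Polynomial.eval_sub, Polynomial.eval_X, Polynomial.eval_C, sub_ne_zero]
      intro e
      exact (Finset.mem_erase.1 hb).1 (hinj a ha b (Finset.mem_erase.1 hb).2 e).symm
    have hQb : ∀ b ∈ S, b ≠ a → Q.eval (cis (ν b * h)) = 0 := by
      intro b hb hba
      rw [hQ, Polynomial.eval_prod]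
      exact Finset.prod_eq_zero (Finset.mem_erase.2 ⟨hba, hb⟩) (by simp)
    set K := (∑ i ∈ Finset.range (2 * J + 1), ‖Q.coeff i‖) / ‖Q.eval (cis (ν a * h))‖ with hK
    have hK0 : 0 ≤ K := div_nonneg (Finset.sum_nonneg fun i _ => norm_nonneg _) (norm_nonneg _)
    refine ⟨K ^ 2, by positivity, fun x => ?_⟩
    set F : ℤ → ℂ := fun j => ∑ b ∈ S, x b * cis (ν b * (j * h)) with hF
    set O := ∑ j ∈ Finset.Icc (-(J : ℤ)) J, ‖F j‖ ^ 2 with hO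
    have hid : ∑ i ∈ Finset.range (2 * J + 1), Q.coeff i * F ((i : ℤ) - J) =
        x a * cis (-(ν a * (J * h))) * Q.eval (cis (ν a * h)) := by
      have e1 : ∀ b, ∑ i ∈ Finset.range (2 * J + 1), Q.coeff i * (x b * cis (ν b * ((((i : ℤ) - J : ℤ) : ℝ) * h))) =
          x b * cis (-(ν b * (J * h))) * Q.eval (cis (ν b * h)) := by
        intro b
        rw [Polynomial.eval_eq_sum_range' hdeg, Finset.mul_sum]
        refine Finset.sum_congr rfl fun i _ => ?_
        rw [← cis_nat_mul, show ν b * ((((i : ℤ) - J : ℤ) : ℝ) * h) = -(ν b * (J * h)) + i * (ν b * h) by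
          push_cast; ring, cis_add]
        ring
      simp only [hF, Finset.mul_sum]
      rw [Finset.sum_comm, Finset.sum_eq_single_of_mem a ha, e1]
      intro b hb hba
      rw [e1, hQb b hb hba, mul_zero]
    have hFO : ∀ i ∈ Finset.range (2 * J + 1), ‖F ((i : ℤ) - J)‖ ≤ √O := by
      intro i hi
      rw [Finset.mem_range] at hi
      apply Real.le_sqrt_of_sq_le
      exact Finset.single_le_sum (f := fun j => ‖F j‖ ^ 2) (fun j _ => by positivity)
        (Finset.mem_Icc.2 ⟨by omega, by omega⟩)
    have hxa : ‖x a‖ ≤ K * √O := by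
      rw [hK, div_mul_eq_mul_div, le_div_iff₀ (norm_pos_iff.2 hQa)]
      calc ‖x a‖ * ‖Q.eval (cis (ν a * h))‖
          = ‖∑ i ∈ Finset.range (2 * J + 1), Q.coeff i * F ((i : ℤ) - J)‖ := by
            rw [hid, norm_mul, norm_mul, norm_cis, mul_one]
        _ ≤ ∑ i ∈ Finset.range (2 * J + 1), ‖Q.coeff i * F ((i : ℤ) - J)‖ := norm_sum_le _ _
        _ ≤ ∑ i ∈ Finset.range (2 * J + 1), ‖Q.coeff i‖ * √O := by
            refine Finset.sum_le_sum fun i hi => ?_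
            rw [norm_mul]
            exact mul_le_mul_of_nonneg_left (hFO i hi) (norm_nonneg _)
        _ = _ := by rw [Finset.sum_mul]
    calc ‖x a‖ ^ 2 ≤ (K * √O) ^ 2 := pow_le_pow_left₀ (norm_nonneg _) hxa 2
      _ = K ^ 2 * O := by
        rw [mul_pow, Real.sq_sqrt (Finset.sum_nonneg fun j _ => by positivity)]
  choose! K hK using hone
  refine ⟨∑ a ∈ S, K a, Finset.sum_nonneg fun a ha => (hK a ha).1, fun x a ha => ?_⟩
  refine ((hK a ha).2 x).trans ?_
  gcongr
  exact Finset.single_le_sum (fun b hb => (hK b hb).1) ha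

lemma card_modes (N : ℕ) : (modes N).card = 2 * N := by
  rw [modes, Finset.card_erase_of_mem (by simp)]
  simp
  omega

lemma Icc_subset_modes (N : ℕ) : Finset.Icc (1 : ℤ) N ⊆ modes N := by
  intro n hn
  rw [Finset.mem_Icc] at hn
  rw [mem_modes]
  omega

/-- The estimate for a single step, with a constant depending on it. -/
lemma pairBound_of_fixed_step {α β h τ : ℝ} {J : ℕ} (N M : ℕ) (hα : π ≤ α) (hβ : π ≤ β)
    (hne : ∀ n m : ℤ, 1 ≤ n → 1 ≤ m → α * n ≠ β * m) (hτ : 2 < τ) (hh : 0 < h) (hJ : J * h = τ)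
    (hN : α * N ≤ π / h - π / 4) (hM : β * M ≤ π / h - π / 4) : ∃ C : ℝ, 0 ≤ C ∧
    ∀ x y : ℤ → ℂ, PairBound α β N M x y
        (C * (h * ∑ j ∈ Finset.Icc (-(J : ℤ)) J, ‖trigSum α β h N M x y j‖ ^ 2)) := by
  classical
  have hα0 : 0 < α := pi_pos.trans_le hα
  have hβ0 : 0 < β := pi_pos.trans_le hβ
  set S := (modes N).disjSum (modes M)
  set ν : ℤ ⊕ ℤ → ℝ := Sum.elim (fun n => α * n) (fun m => β * m) with hν
  have hfreq : ∀ {γ : ℝ} {N : ℕ} {n : ℤ}, 0 < γ → γ * N ≤ π / h - π / 4 → n ∈ modes N →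
      |γ * n * h| < π := by
    intro γ N n hγ hN hn
    rw [mem_modes] at hn
    have h1 : |(n : ℝ)| ≤ N := by
      rw [abs_le]
      exact ⟨by exact_mod_cast hn.2.1, by exact_mod_cast hn.2.2⟩
    rw [abs_mul, abs_mul, abs_of_pos hγ, abs_of_pos hh]
    calc γ * |(n : ℝ)| * h ≤ γ * N * h := by gcongr
      _ ≤ (π / h - π / 4) * h := by gcongr
      _ < π := by
        rw [sub_mul, div_mul_cancel₀ _ hh.ne']
        have : 0 < π / 4 * h := by positivity
        linarith
  have hne' : ∀ n m : ℤ, n ≠ 0 → m ≠ 0 → α * n ≠ β * m := by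
    intro n m hn hm e
    rcases lt_or_gt_of_ne hn with h1 | h1 <;> rcases lt_or_gt_of_ne hm with h2 | h2
    · exact hne (-n) (-m) (by omega) (by omega) (by push_cast; linarith)
    · have h3 : (n : ℝ) < 0 := by exact_mod_cast h1
      have h4 : (0 : ℝ) < m := by exact_mod_cast h2
      nlinarith [mul_pos hβ0 h4]
    · have h3 : (m : ℝ) < 0 := by exact_mod_cast h2
      have h4 : (0 : ℝ) < n := by exact_mod_cast h1
      nlinarith [mul_pos hα0 h4]
    · exact hne n m (by omega) (by omega) e
  have hinj : ∀ a ∈ S, ∀ b ∈ S, cis (ν a * h) = cis (ν b * h) → a = b := by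
    intro a ha b hb e
    rcases a with a | a <;> rcases b with b | b <;> simp only [S, Finset.inl_mem_disjSum, Finset.inr_mem_disjSum] at ha hb <;>
      simp only [hν, Sum.elim_inl, Sum.elim_inr] at e
    · have := mul_right_cancel₀ hh.ne' (cis_injOn (hfreq hα0 hN ha) (hfreq hα0 hN hb) e)
      have := mul_left_cancel₀ hα0.ne' this
      rw [Int.cast_inj.1 this]
    · have := mul_right_cancel₀ hh.ne' (cis_injOn (hfreq hα0 hN ha) (hfreq hβ0 hM hb) e)
      exact absurd this (hne' a b (mem_modes.1 ha).1 (mem_modes.1 hb).1)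
    · have := mul_right_cancel₀ hh.ne' (cis_injOn (hfreq hβ0 hM ha) (hfreq hα0 hN hb) e)
      exact absurd this.symm (hne' b a (mem_modes.1 hb).1 (mem_modes.1 ha).1)
    · have := mul_right_cancel₀ hh.ne' (cis_injOn (hfreq hβ0 hM ha) (hfreq hβ0 hM hb) e)
      have := mul_left_cancel₀ hβ0.ne' this
      rw [Int.cast_inj.1 this]
  have hcnt : ∀ {γ : ℝ} {N : ℕ}, π ≤ γ → γ * N ≤ π / h - π / 4 → (N : ℝ) * h ≤ 1 := by
    intro γ N hγ hN
    have h1 : π * (N * h) ≤ π * 1 := by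
      calc π * (N * h) ≤ γ * (N * h) := by gcongr
        _ = γ * N * h := by ring
        _ ≤ (π / h - π / 4) * h := by gcongr
        _ ≤ π * 1 := by
          rw [sub_mul, div_mul_cancel₀ _ hh.ne']
          have : 0 < π / 4 * h := by positivity
          linarith
    exact le_of_mul_le_mul_left h1 pi_pos
  have hcard : S.card ≤ 2 * J + 1 := by
    rw [Finset.card_disjSum, card_modes, card_modes]
    have h1 := hcnt hα hN
    have h2 := hcnt hβ hM
    have h3 : ((N + M : ℕ) : ℝ) < J := by
      push_cast
      by_contra hcon
      rw [not_lt] at hcon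
      nlinarith
    have h4 : N + M < J := by exact_mod_cast h3
    omega
  obtain ⟨K, hK, hbound⟩ := coeff_le_samples S ν h J hinj hcard
  refine ⟨(3 * N + 3 * M + 4 * (N * M)) * K / h, by positivity, fun x y ρ ρ' hρ hρ' => ?_⟩
  set O := ∑ j ∈ Finset.Icc (-(J : ℤ)) J, ‖trigSum α β h N M x y j‖ ^ 2 with hO
  have hO' : ∀ a ∈ S, ‖Sum.elim x y a‖ ^ 2 ≤ K * O := by
    intro a ha
    refine (hbound (Sum.elim x y) a ha).trans_eq ?_
    rw [hO]
    congr 1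
    refine Finset.sum_congr rfl fun j _ => ?_
    rw [Finset.sum_disjSum]
    rfl
  have hx : ∀ n ∈ Finset.Icc (1 : ℤ) N, ‖x n‖ ^ 2 ≤ K * O := fun n hn =>
    hO' (Sum.inl n) (Finset.inl_mem_disjSum.2 (Icc_subset_modes N hn))
  have hy : ∀ n ∈ Finset.Icc (1 : ℤ) M, ‖y n‖ ^ 2 ≤ K * O := fun n hn =>
    hO' (Sum.inr n) (Finset.inr_mem_disjSum.2 (Icc_subset_modes M hn))
  have hKO : 0 ≤ K * O := mul_nonneg hK (Finset.sum_nonneg fun j _ => by positivity)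
  have hρ2 : ∀ {r : ℝ}, 0 ≤ r → r ≤ π / 2 → r ^ 2 ≤ 3 := by
    intro r h0 h1
    have : π ≤ 3.15 := pi_lt_d2.le
    nlinarith
  have b1 : ∑ n ∈ Finset.Icc (1 : ℤ) N, ρ n ^ 2 * ‖x n‖ ^ 2 ≤ N * (3 * (K * O)) := by
    refine (Finset.sum_le_card_nsmul _ _ (3 * (K * O)) fun n hn => ?_).trans (by simp)
    exact mul_le_mul (hρ2 (hρ n hn).1 (hρ n hn).2.1) (hx n hn) (by positivity) (by norm_num)
  have b2 : ∑ n ∈ Finset.Icc (1 : ℤ) M, ρ' n ^ 2 * ‖y n‖ ^ 2 ≤ M * (3 * (K * O)) := by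
    refine (Finset.sum_le_card_nsmul _ _ (3 * (K * O)) fun n hn => ?_).trans (by simp)
    exact mul_le_mul (hρ2 (hρ' n hn).1 (hρ' n hn).2.1) (hy n hn) (by positivity) (by norm_num)
  have b3 : ∑ n ∈ Finset.Icc (1 : ℤ) N, ∑ m ∈ Finset.Icc (1 : ℤ) M,
        (if |α * n - β * m| ≤ π / 4 then ‖x n + y m‖ ^ 2 else 0) ≤ N * (M * (4 * (K * O))) := by
    refine (Finset.sum_le_card_nsmul _ _ (M * (4 * (K * O))) fun n hn => ?_).trans (by simp)
    refine (Finset.sum_le_card_nsmul _ _ (4 * (K * O)) fun m hm => ?_).trans (by simp)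
    split_ifs
    · have h1 := pow_le_pow_left₀ (norm_nonneg _) (norm_add_le (x n) (y m)) 2
      have h2 := add_sq_le (a := ‖x n‖) (b := ‖y m‖)
      linarith [hx n hn, hy m hm]
    · linarith
  calc _ ≤ N * (3 * (K * O)) + M * (3 * (K * O)) + N * (M * (4 * (K * O))) := by gcongr
    _ = _ := by field_simp

/-- The discrete observability estimate for the union of two arithmetic progressions, with a
constant which does not depend on the step: below a threshold this is `pairBound_of_small_step`, and
above it there are finitely many possibilities for the step `τ / J` and for `N` and `M`. -/
theorem pairBound_uniform {α β τ : ℝ} (hα : π ≤ α) (hβ : π ≤ β)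
    (hne : ∀ n m : ℤ, 1 ≤ n → 1 ≤ m → α * n ≠ β * m) (hτ : 2 < τ) : ∃ C : ℝ, 0 < C ∧
    ∀ {h : ℝ} {N M : ℕ} {J : ℤ} (x y : ℤ → ℂ), 0 < h → J * h = τ →
      α * N ≤ π / h - π / 4 → β * M ≤ π / h - π / 4 →
      PairBound α β N M x y
        (C * (h * ∑ j ∈ Finset.Icc (-J) J, ‖trigSum α β h N M x y j‖ ^ 2)) := by
  obtain ⟨h₀, C₀, hh₀, hC₀, hsmall⟩ := pairBound_of_small_step hτ
  have hfix : ∀ J N M : ℕ, ∃ C : ℝ, 0 ≤ C ∧ ∀ h : ℝ, 0 < h → J * h = τ →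
      α * N ≤ π / h - π / 4 → β * M ≤ π / h - π / 4 → ∀ x y : ℤ → ℂ, PairBound α β N M x y
        (C * (h * ∑ j ∈ Finset.Icc (-(J : ℤ)) J, ‖trigSum α β h N M x y j‖ ^ 2)) := by
    intro J N M
    by_cases hex : ∃ h : ℝ, 0 < h ∧ J * h = τ ∧ α * N ≤ π / h - π / 4 ∧ β * M ≤ π / h - π / 4
    · obtain ⟨h, hh, hJ, hN, hM⟩ := hex
      obtain ⟨C, hC, hb⟩ := pairBound_of_fixed_step N M hα hβ hne hτ hh hJ hN hM
      refine ⟨C, hC, fun h' _ hJ' _ _ x y => ?_⟩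
      have hJ0 : (J : ℝ) ≠ 0 := by
        rintro e
        rw [e, zero_mul] at hJ
        linarith
      obtain rfl : h' = h := mul_left_cancel₀ hJ0 (hJ'.trans hJ.symm)
      exact hb x y
    · exact ⟨0, le_rfl, fun h h1 h2 h3 h4 => absurd ⟨h, h1, h2, h3, h4⟩ hex⟩
  choose C hC0 hC using hfix
  set X := ⌈τ / h₀⌉₊ + ⌈1 / h₀⌉₊ + 1 with hX
  refine ⟨C₀ + ∑ J ∈ Finset.range X, ∑ N ∈ Finset.range X, ∑ M ∈ Finset.range X, C J N M, ?_, ?_⟩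
  · have : 0 ≤ ∑ J ∈ Finset.range X, ∑ N ∈ Finset.range X, ∑ M ∈ Finset.range X, C J N M :=
      Finset.sum_nonneg fun J _ => Finset.sum_nonneg fun N _ => Finset.sum_nonneg fun M _ => hC0 _ _ _
    linarith
  intro h N M J x y hh hJ hN hM
  have hO : 0 ≤ h * ∑ j ∈ Finset.Icc (-J) J, ‖trigSum α β h N M x y j‖ ^ 2 :=
    mul_nonneg hh.le (Finset.sum_nonneg fun j _ => by positivity)
  have hS : 0 ≤ ∑ J ∈ Finset.range X, ∑ N ∈ Finset.range X, ∑ M ∈ Finset.range X, C J N M :=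
      Finset.sum_nonneg fun J _ => Finset.sum_nonneg fun N _ => Finset.sum_nonneg fun M _ => hC0 _ _ _
  rcases le_or_gt h h₀ with hle | hlt
  · refine (hsmall x y hα hβ hh hle hJ hN hM).mono ?_
    gcongr
    linarith
  · have hJ0 : 0 ≤ J := by
      by_contra hneg
      have : (J : ℝ) < 0 := by exact_mod_cast not_le.1 hneg
      nlinarith
    lift J to ℕ using hJ0
    rw [Int.cast_natCast] at hJ
    have hJX : J < X := by
      have h1 : (J : ℝ) ≤ τ / h₀ := by
        rw [le_div_iff₀ hh₀, ← hJ]; gcongr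
      have h2 : (J : ℝ) ≤ ⌈τ / h₀⌉₊ := h1.trans (Nat.le_ceil _)
      have h3 : J ≤ ⌈τ / h₀⌉₊ := by exact_mod_cast h2
      omega
    have hcnt : ∀ {γ : ℝ} {N : ℕ}, π ≤ γ → γ * N ≤ π / h - π / 4 → N < X := by
      intro γ N hγ hN
      have h1 : π * N ≤ π * (1 / h₀) := by
        calc π * N ≤ γ * N := by gcongr
          _ ≤ π / h - π / 4 := hN
          _ ≤ π / h := by linarith [pi_pos]
          _ ≤ π / h₀ := by gcongr
          _ = _ := by ring
      have h2 : (N : ℝ) ≤ ⌈1 / h₀⌉₊ := (le_of_mul_le_mul_left h1 pi_pos).trans (Nat.le_ceil _)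
      have h3 : N ≤ ⌈1 / h₀⌉₊ := by exact_mod_cast h2
      omega
    refine (hC J N M h hh hJ hN hM x y).mono ?_
    gcongr
    have h1 : C J N M ≤ ∑ M ∈ Finset.range X, C J N M :=
      Finset.single_le_sum (f := fun M => C J N M) (fun M _ => hC0 _ _ _)
        (Finset.mem_range.2 (hcnt hβ hM))
    have h2 : ∑ M ∈ Finset.range X, C J N M ≤ ∑ N ∈ Finset.range X, ∑ M ∈ Finset.range X, C J N M :=
      Finset.single_le_sum (f := fun N => ∑ M ∈ Finset.range X, C J N M)
        (fun N _ => Finset.sum_nonneg fun M _ => hC0 _ _ _) (Finset.mem_range.2 (hcnt hα hN))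
    have h3 := Finset.single_le_sum (f := fun J => ∑ N ∈ Finset.range X, ∑ M ∈ Finset.range X, C J N M)
        (fun J _ => Finset.sum_nonneg fun N _ => Finset.sum_nonneg fun M _ => hC0 _ _ _)
        (Finset.mem_range.2 hJX)
    linarith

/-! ### Consequences for the coefficients -/

lemma sum_Icc_int (N : ℕ) {E : Type*} [AddCommMonoid E] (f : ℤ → E) :
    ∑ n ∈ Finset.Icc (1 : ℤ) N, f n = ∑ n ∈ Finset.Icc 1 N, f n := by
  symm
  apply Finset.sum_bij (fun (n : ℕ) _ => (n : ℤ))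
  · intro n hn
    rw [Finset.mem_Icc] at hn ⊢
    omega
  · intro a _ b _ h
    exact_mod_cast h
  · intro b hb
    rw [Finset.mem_Icc] at hb
    exact ⟨b.toNat, by rw [Finset.mem_Icc]; omega, by omega⟩
  · intros; rfl

lemma sum_inv_sq_le (N : ℕ) : ∑ n ∈ Finset.Icc 1 N, (1 / (n : ℝ)) ^ 2 ≤ 2 := by
  have h : ∀ N : ℕ, ∑ n ∈ Finset.Icc 1 (N + 1), (1 / (n : ℝ)) ^ 2 ≤ 2 - 1 / ((N : ℝ) + 1) := by
    intro N
    induction N with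
    | zero => norm_num
    | succ k ih =>
      rw [Finset.sum_Icc_succ_top (by omega)]
      refine (add_le_add ih le_rfl).trans ?_
      push_cast
      have hk : (0 : ℝ) < k + 1 := by positivity
      have hk2 : (0 : ℝ) < k + 1 + 1 := by positivity
      have : 1 / ((k : ℝ) + 1) - 1 / (k + 1 + 1) = 1 / ((k + 1) * (k + 1 + 1)) := by
        field_simp; ring
      have h2 : (1 / ((k : ℝ) + 1 + 1)) ^ 2 ≤ 1 / ((k + 1) * (k + 1 + 1)) := by
        rw [div_pow, one_pow]
        apply one_div_le_one_div_of_le (by positivity)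
        nlinarith
      linarith
  rcases N with _ | N
  · norm_num
  · have := h N
    have h2 : (0 : ℝ) ≤ 1 / ((N : ℝ) + 1) := by positivity
    linarith

lemma sum_inv_freq_sq_le {α : ℝ} (hα : π ≤ α) (N : ℕ) :
    ∑ n ∈ Finset.Icc (1 : ℤ) N, (1 / (α * n)) ^ 2 ≤ 1 := by
  rw [sum_Icc_int N (fun n : ℤ => (1 / (α * n)) ^ 2)]
  have h1 : ∀ n ∈ Finset.Icc 1 N, (1 / (α * ((n : ℤ) : ℝ))) ^ 2 ≤ 1 / 2 * (1 / (n : ℝ)) ^ 2 := by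
    intro n _
    have h3 : (2 : ℝ) ≤ α ^ 2 := by nlinarith [pi_gt_three]
    have h4 : 1 / α ^ 2 ≤ 1 / 2 := one_div_le_one_div_of_le (by norm_num) h3
    calc (1 / (α * ((n : ℤ) : ℝ))) ^ 2 = 1 / α ^ 2 * (1 / (n : ℝ)) ^ 2 := by
          push_cast
          rw [div_pow, mul_pow, div_pow]; ring
      _ ≤ _ := by gcongr
  refine (Finset.sum_le_sum h1).trans ?_
  rw [← Finset.mul_sum]
  linarith [sum_inv_sq_le N]

lemma PairBound.symm {α β : ℝ} {N M : ℕ} {x y : ℤ → ℂ} {B : ℝ} (h : PairBound α β N M x y B) :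
    PairBound β α M N y x B := by
  intro ρ ρ' hρ hρ'
  have := h ρ' ρ
    (fun n hn => ⟨(hρ' n hn).1, (hρ' n hn).2.1, fun m hm => by
      rw [abs_sub_comm]; exact (hρ' n hn).2.2 m hm⟩)
    (fun n hn => ⟨(hρ n hn).1, (hρ n hn).2.1, fun m hm => by
      rw [abs_sub_comm]; exact (hρ n hn).2.2 m hm⟩)
  rw [Finset.sum_comm] at this
  simp only [abs_sub_comm (β * _), add_comm (y _)]
  linarith

/-- The contribution to `∑ n, x n / (α n)` of the `n` which have no `β m` within `π / 4`. The factor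
`1 - ∑ m, …` is the indicator function of these `n`, because there is at most one such `m`. -/
lemma PairBound.unpaired {α β : ℝ} (hα : π ≤ α) (hβ : π ≤ β) {N M : ℕ} {x y : ℤ → ℂ} {B : ℝ}
    (h : PairBound α β N M x y B) :
    ‖∑ n ∈ Finset.Icc (1 : ℤ) N, (1 - ∑ m ∈ Finset.Icc (1 : ℤ) M,
      (if |α * n - β * m| ≤ π / 4 then (1 : ℂ) else 0)) * (x n / (α * n : ℝ))‖ ^ 2 ≤ 2 * B := by
  classical
  set ρ : ℤ → ℝ := fun n => if ∃ m ∈ Finset.Icc (1 : ℤ) M, |α * n - β * m| ≤ π / 4 then 0 else π / 4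
    with hρ
  have h1 := h ρ (fun _ => 0) (fun n hn => by
      simp only [hρ]
      split_ifs with hex
      · exact ⟨le_rfl, by positivity, fun _ _ => abs_nonneg _⟩
      · push Not at hex
        exact ⟨by positivity, by linarith [pi_pos], fun m hm => (hex m hm).le⟩)
    (fun m _ => ⟨le_rfl, by positivity, fun _ _ => abs_nonneg _⟩)
  have h2 : ∑ n ∈ Finset.Icc (1 : ℤ) N, ρ n ^ 2 * ‖x n‖ ^ 2 ≤ B := by
    have h3 : 0 ≤ ∑ n ∈ Finset.Icc (1 : ℤ) N, ∑ m ∈ Finset.Icc (1 : ℤ) M,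
        (if |α * n - β * m| ≤ π / 4 then ‖x n + y m‖ ^ 2 else 0) :=
      Finset.sum_nonneg fun n _ => Finset.sum_nonneg fun m _ => by split_ifs <;> positivity
    simp only [ne_eq, OfNat.ofNat_ne_zero, not_false_eq_true, zero_pow, zero_mul,
      Finset.sum_const_zero, add_zero] at h1
    linarith
  have h3 : ‖∑ n ∈ Finset.Icc (1 : ℤ) N, (1 - ∑ m ∈ Finset.Icc (1 : ℤ) M,
      (if |α * n - β * m| ≤ π / 4 then (1 : ℂ) else 0)) * (x n / (α * n : ℝ))‖ ≤
      ∑ n ∈ Finset.Icc (1 : ℤ) N, (4 / π * (ρ n * ‖x n‖)) * (1 / (α * n)) := by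
    refine (norm_sum_le _ _).trans (Finset.sum_le_sum fun n hn => ?_)
    have hn1 : (1 : ℝ) ≤ n := by exact_mod_cast (Finset.mem_Icc.1 hn).1
    have hαn : 0 < α * n := mul_pos (pi_pos.trans_le hα) (by linarith)
    rw [norm_mul, norm_div, Complex.norm_real, Real.norm_eq_abs, abs_of_pos hαn]
    by_cases hex : ∃ m ∈ Finset.Icc (1 : ℤ) M, |α * n - β * m| ≤ π / 4
    · obtain ⟨m, hm, hnm⟩ := hex
      rw [Finset.sum_eq_single_of_mem m hm, if_pos hnm, sub_self, norm_zero, zero_mul]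
      · have : 0 ≤ ρ n := by simp only [hρ]; split_ifs <;> positivity
        positivity
      · intro k _ hk
        rw [if_neg]
        intro hkm
        rw [abs_sub_comm] at hkm hnm
        exact hk (partner_unique hβ hkm (by linarith [pi_pos]))
    · have hρn : ρ n = π / 4 := by simp only [hρ, if_neg hex]
      push Not at hex
      rw [Finset.sum_eq_zero fun m hm => if_neg (not_le.2 (hex m hm)), sub_zero, norm_one, one_mul, hρn]
      apply le_of_eq
      field_simp
  have h4 := Finset.sum_mul_sq_le_sq_mul_sq (Finset.Icc (1 : ℤ) N)
    (fun n => 4 / π * (ρ n * ‖x n‖)) (fun n => 1 / (α * n))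
  have h5 : ∑ n ∈ Finset.Icc (1 : ℤ) N, (4 / π * (ρ n * ‖x n‖)) ^ 2 ≤ 2 * B := by
    have e : ∑ n ∈ Finset.Icc (1 : ℤ) N, (4 / π * (ρ n * ‖x n‖)) ^ 2 =
        16 / π ^ 2 * ∑ n ∈ Finset.Icc (1 : ℤ) N, ρ n ^ 2 * ‖x n‖ ^ 2 := by
      rw [Finset.mul_sum]
      refine Finset.sum_congr rfl fun n _ => ?_
      rw [mul_pow, mul_pow, div_pow]; norm_num
    have h6 : 16 / π ^ 2 ≤ 2 := by
      rw [div_le_iff₀ (by positivity)]; nlinarith [pi_gt_three]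
    have h7 : 0 ≤ ∑ n ∈ Finset.Icc (1 : ℤ) N, ρ n ^ 2 * ‖x n‖ ^ 2 :=
      Finset.sum_nonneg fun n _ => by positivity
    rw [e]
    nlinarith
  have h6 := sum_inv_freq_sq_le hα N
  have h7 : 0 ≤ ∑ n ∈ Finset.Icc (1 : ℤ) N, (4 / π * (ρ n * ‖x n‖)) ^ 2 :=
      Finset.sum_nonneg fun n _ => by positivity
  calc _ ≤ (∑ n ∈ Finset.Icc (1 : ℤ) N, (4 / π * (ρ n * ‖x n‖)) * (1 / (α * n))) ^ 2 :=
        pow_le_pow_left₀ (norm_nonneg _) h3 2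
    _ ≤ (∑ n ∈ Finset.Icc (1 : ℤ) N, (4 / π * (ρ n * ‖x n‖)) ^ 2) * 1 :=
        h4.trans (mul_le_mul_of_nonneg_left h6 h7)
    _ ≤ 2 * B := by linarith

/-- The sum of the coefficients divided by their frequencies is bounded although the single
coefficients of close frequencies are not: for close `α n` and `β m` one has
`x / (α n) + y / (β m) = (x + y) / (α n) + y (α n - β m) / (α n β m)`, and `PairBound` controls both
`x + y` and `y (α n - β m)`. -/
lemma PairBound.pairing {α β : ℝ} (hα : π ≤ α) (hβ : π ≤ β) {N M : ℕ} {x y : ℤ → ℂ} {B : ℝ}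
    (h : PairBound α β N M x y B) :
    ‖∑ n ∈ Finset.Icc (1 : ℤ) N, x n / (α * n : ℝ) + ∑ m ∈ Finset.Icc (1 : ℤ) M, y m / (β * m : ℝ)‖ ^ 2
      ≤ 24 * B := by
  classical
  set e : ℤ → ℤ → ℂ := fun n m => if |α * n - β * m| ≤ π / 4 then (1 : ℂ) else 0 with he
  have h1 := h.unpaired hα hβ
  have h2 := h.symm.unpaired hβ hα
  simp only [abs_sub_comm (β * _)] at h2
  set I1 := ∑ n ∈ Finset.Icc (1 : ℤ) N, (1 - ∑ m ∈ Finset.Icc (1 : ℤ) M,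
      (if |α * n - β * m| ≤ π / 4 then (1 : ℂ) else 0)) * (x n / (α * n : ℝ)) with hI1
  set I2 := ∑ m ∈ Finset.Icc (1 : ℤ) M, (1 - ∑ n ∈ Finset.Icc (1 : ℤ) N,
      (if |α * n - β * m| ≤ π / 4 then (1 : ℂ) else 0)) * (y m / (β * m : ℝ)) with hI2
  set I3 := ∑ n ∈ Finset.Icc (1 : ℤ) N, ∑ m ∈ Finset.Icc (1 : ℤ) M,
    e n m * ((x n + y m) * (1 / (α * n) : ℝ)) with hI3
  set I4 := ∑ n ∈ Finset.Icc (1 : ℤ) N, ∑ m ∈ Finset.Icc (1 : ℤ) M,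
    e n m * (y m * ((α * n - β * m) / (α * n * (β * m)) : ℝ)) with hI4
  have hpos : ∀ {γ : ℝ} {N : ℕ} {n : ℤ}, π ≤ γ → n ∈ Finset.Icc (1 : ℤ) N → 1 ≤ γ * n := by
    intro γ N n hγ hn
    have hn1 : (1 : ℝ) ≤ n := by exact_mod_cast (Finset.mem_Icc.1 hn).1
    nlinarith [pi_gt_three]
  have hsplit : ∑ n ∈ Finset.Icc (1 : ℤ) N, x n / (α * n : ℝ) +
      ∑ m ∈ Finset.Icc (1 : ℤ) M, y m / (β * m : ℝ) = I1 + I2 + (I3 + I4) := by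
    have e1 : I1 = ∑ n ∈ Finset.Icc (1 : ℤ) N, x n / (α * n : ℝ) -
        ∑ n ∈ Finset.Icc (1 : ℤ) N, ∑ m ∈ Finset.Icc (1 : ℤ) M, e n m * (x n / (α * n : ℝ)) := by
      rw [hI1, ← Finset.sum_sub_distrib]
      refine Finset.sum_congr rfl fun n _ => ?_
      rw [sub_mul, one_mul, Finset.sum_mul]
    have e2 : I2 = ∑ m ∈ Finset.Icc (1 : ℤ) M, y m / (β * m : ℝ) -
        ∑ n ∈ Finset.Icc (1 : ℤ) N, ∑ m ∈ Finset.Icc (1 : ℤ) M, e n m * (y m / (β * m : ℝ)) := by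
      rw [hI2, Finset.sum_comm (s := Finset.Icc (1 : ℤ) N), ← Finset.sum_sub_distrib]
      refine Finset.sum_congr rfl fun n _ => ?_
      rw [sub_mul, one_mul, Finset.sum_mul]
    have e3 : I3 + I4 = ∑ n ∈ Finset.Icc (1 : ℤ) N, ∑ m ∈ Finset.Icc (1 : ℤ) M, e n m * (x n / (α * n : ℝ)) +
        ∑ n ∈ Finset.Icc (1 : ℤ) N, ∑ m ∈ Finset.Icc (1 : ℤ) M, e n m * (y m / (β * m : ℝ)) := by
      rw [hI3, hI4]
      simp only [← Finset.sum_add_distrib]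
      refine Finset.sum_congr rfl fun n hn => Finset.sum_congr rfl fun m hm => ?_
      have h3 : ((α * n : ℝ) : ℂ) ≠ 0 := by
        rw [Complex.ofReal_ne_zero]; linarith [hpos hα hn]
      have h4 : ((β * m : ℝ) : ℂ) ≠ 0 := by
        rw [Complex.ofReal_ne_zero]; linarith [hpos hβ hm]
      have h5 : (x n + y m) * (1 / (α * n) : ℝ) + y m * ((α * n - β * m) / (α * n * (β * m)) : ℝ) =
          x n / (α * n : ℝ) + y m / (β * m : ℝ) := by
        rw [Complex.ofReal_div, Complex.ofReal_div, Complex.ofReal_mul (α * n), Complex.ofReal_sub,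
          Complex.ofReal_one]
        field_simp
        ring
      rw [← mul_add, h5, mul_add]
    rw [e1, e2, e3]; ring
  obtain ⟨σ, hσ⟩ := exists_partnerGap hα N (fun m => β * m)
  have h3 := h (fun _ => 0) σ (fun n _ => ⟨le_rfl, by positivity, fun _ _ => abs_nonneg _⟩)
    (fun m _ => (hσ m).1)
  simp only [ne_eq, OfNat.ofNat_ne_zero, not_false_eq_true, zero_pow, zero_mul,
      Finset.sum_const_zero, zero_add] at h3
  have hA : 0 ≤ ∑ m ∈ Finset.Icc (1 : ℤ) M, σ m ^ 2 * ‖y m‖ ^ 2 :=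
    Finset.sum_nonneg fun m _ => by positivity
  have hB : 0 ≤ ∑ n ∈ Finset.Icc (1 : ℤ) N, ∑ m ∈ Finset.Icc (1 : ℤ) M,
        (if |α * n - β * m| ≤ π / 4 then ‖x n + y m‖ ^ 2 else 0) :=
      Finset.sum_nonneg fun n _ => Finset.sum_nonneg fun m _ => by split_ifs <;> positivity
  have he1 : ∀ n, ∑ m ∈ Finset.Icc (1 : ℤ) M, ‖e n m‖ ^ 2 ≤ 1 := by
    intro n
    by_cases hex : ∃ m ∈ Finset.Icc (1 : ℤ) M, |α * n - β * m| ≤ π / 4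
    · obtain ⟨m, hm, hnm⟩ := hex
      rw [Finset.sum_eq_single_of_mem m hm]
      · simp [he, hnm]
      · intro k _ hk
        have : ¬ |α * n - β * k| ≤ π / 4 := by
          intro hkm
          rw [abs_sub_comm] at hkm hnm
          exact hk (partner_unique hβ hkm (by linarith [pi_pos]))
        simp [he, this]
    · push Not at hex
      rw [Finset.sum_eq_zero]
      · exact zero_le_one
      · intro m hm
        simp [he, not_le.2 (hex m hm)]
  have hcs : ∀ f : ℤ → ℤ → ℝ, (∀ n m, 0 ≤ f n m) →
      (∑ n ∈ Finset.Icc (1 : ℤ) N, ∑ m ∈ Finset.Icc (1 : ℤ) M,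
        (‖e n m‖ * f n m) * (‖e n m‖ * (1 / (α * n)))) ^ 2 ≤
      ∑ n ∈ Finset.Icc (1 : ℤ) N, ∑ m ∈ Finset.Icc (1 : ℤ) M, (‖e n m‖ * f n m) ^ 2 := by
    intro f hf
    have c1 := Finset.sum_mul_sq_le_sq_mul_sq (Finset.Icc (1 : ℤ) N ×ˢ Finset.Icc (1 : ℤ) M)
      (fun p => ‖e p.1 p.2‖ * f p.1 p.2) (fun p => ‖e p.1 p.2‖ * (1 / (α * p.1)))
    simp only [Finset.sum_product] at c1
    have c2 : ∑ n ∈ Finset.Icc (1 : ℤ) N, ∑ m ∈ Finset.Icc (1 : ℤ) M,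
        (‖e n m‖ * (1 / (α * n))) ^ 2 ≤ 1 := by
      refine le_trans (Finset.sum_le_sum fun n _ => ?_) (sum_inv_freq_sq_le hα N)
      simp only [mul_pow]
      rw [← Finset.sum_mul]
      have := he1 n
      have h5 : 0 ≤ (1 / (α * n)) ^ 2 := by positivity
      nlinarith
    refine c1.trans ?_
    have c3 : 0 ≤ ∑ n ∈ Finset.Icc (1 : ℤ) N, ∑ m ∈ Finset.Icc (1 : ℤ) M, (‖e n m‖ * f n m) ^ 2 :=
      Finset.sum_nonneg fun n _ => Finset.sum_nonneg fun m _ => by positivity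
    nlinarith
  have he2 : ∀ n m, ‖e n m‖ * ‖e n m‖ = ‖e n m‖ := by
    intro n m; simp only [he]; split_ifs <;> simp
  have h4 : ‖I3‖ ^ 2 ≤ B := by
    have : ‖I3‖ ≤ ∑ n ∈ Finset.Icc (1 : ℤ) N, ∑ m ∈ Finset.Icc (1 : ℤ) M,
        (‖e n m‖ * ‖x n + y m‖) * (‖e n m‖ * (1 / (α * n))) := by
      refine (norm_sum_le _ _).trans (Finset.sum_le_sum fun n hn => ?_)
      refine (norm_sum_le _ _).trans (Finset.sum_le_sum fun m hm => ?_)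
      rw [norm_mul, norm_mul, Complex.norm_real, Real.norm_eq_abs,
        abs_of_nonneg (by have := hpos hα hn; positivity)]
      apply le_of_eq
      linear_combination (-(‖x n + y m‖ * (1 / (α * n)))) * he2 n m
    refine (pow_le_pow_left₀ (norm_nonneg _) this 2).trans
      ((hcs _ fun _ _ => norm_nonneg _).trans (le_trans (le_of_eq ?_) (le_trans (le_add_of_nonneg_left hA) h3)))
    refine Finset.sum_congr rfl fun n _ => Finset.sum_congr rfl fun m _ => ?_
    simp only [he]
    split_ifs <;> simp
  have h5 : ‖I4‖ ^ 2 ≤ B := by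
    have : ‖I4‖ ≤ ∑ n ∈ Finset.Icc (1 : ℤ) N, ∑ m ∈ Finset.Icc (1 : ℤ) M,
        (‖e n m‖ * (|α * n - β * m| * ‖y m‖)) * (‖e n m‖ * (1 / (α * n))) := by
      refine (norm_sum_le _ _).trans (Finset.sum_le_sum fun n hn => ?_)
      refine (norm_sum_le _ _).trans (Finset.sum_le_sum fun m hm => ?_)
      have p1 := hpos hα hn
      have p2 := hpos hβ hm
      rw [norm_mul, norm_mul, Complex.norm_real, Real.norm_eq_abs, abs_div, abs_mul (α * n),
        abs_of_pos (by linarith : 0 < α * n), abs_of_pos (by linarith : 0 < β * m)]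
      have p3 : |α * n - β * m| / (α * n * (β * m)) ≤ |α * n - β * m| * (1 / (α * n)) := by
        rw [mul_one_div]
        exact div_le_div_of_nonneg_left (abs_nonneg _) (by linarith) (by nlinarith)
      calc ‖e n m‖ * (‖y m‖ * (|α * n - β * m| / (α * n * (β * m))))
          ≤ ‖e n m‖ * (‖y m‖ * (|α * n - β * m| * (1 / (α * n)))) := by gcongr
        _ = _ := by linear_combination (-(|α * n - β * m| * ‖y m‖ * (1 / (α * n)))) * he2 n m
    refine (pow_le_pow_left₀ (norm_nonneg _) this 2).trans
      ((hcs _ fun _ _ => by positivity).trans (le_trans ?_ (le_trans (le_add_of_nonneg_right hB) h3)))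
    rw [Finset.sum_comm]
    refine Finset.sum_le_sum fun m _ => ?_
    refine le_trans (le_of_eq ?_) (mul_le_mul_of_nonneg_right (hσ m).2 (by positivity : 0 ≤ ‖y m‖ ^ 2))
    rw [Finset.sum_mul]
    refine Finset.sum_congr rfl fun n _ => ?_
    simp only [he]
    split_ifs <;> simp [mul_pow]
  rw [hsplit]
  have n1 := norm_add₃_le (a := I1) (b := I2) (c := I3 + I4)
  have n2 := norm_add_le I3 I4
  have n3 : ‖I1 + I2 + (I3 + I4)‖ ^ 2 ≤ (‖I1‖ + ‖I2‖ + ‖I3‖ + ‖I4‖) ^ 2 :=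
    pow_le_pow_left₀ (norm_nonneg _) (by linarith) 2
  nlinarith [sq_nonneg (‖I1‖ - ‖I2‖), sq_nonneg (‖I1‖ - ‖I3‖), sq_nonneg (‖I1‖ - ‖I4‖),
    sq_nonneg (‖I2‖ - ‖I3‖), sq_nonneg (‖I2‖ - ‖I4‖), sq_nonneg (‖I3‖ - ‖I4‖)]

/-- A Diophantine lower bound for the distances between the two families turns the weights in
`PairBound` into powers of the index. -/
lemma PairBound.weighted {α β c s : ℝ} {N M : ℕ} {x y : ℤ → ℂ} {B : ℝ}
    (h : PairBound α β N M x y B) (hc : 0 < c) (hcπ : c ≤ π / 2) (hs : 0 < s)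
    (hd : ∀ n m : ℤ, 1 ≤ n → 1 ≤ m → c * (n : ℝ) ^ (-(1 + s)) ≤ |α * n - β * m| ∧
      c * (m : ℝ) ^ (-(1 + s)) ≤ |α * n - β * m|) :
    ∑ n ∈ Finset.Icc (1 : ℤ) N, ((n : ℝ) ^ (-(1 + s))) ^ 2 * ‖x n‖ ^ 2 +
      ∑ m ∈ Finset.Icc (1 : ℤ) M, ((m : ℝ) ^ (-(1 + s))) ^ 2 * ‖y m‖ ^ 2 ≤ B / c ^ 2 := by
  have hle : ∀ n : ℤ, 1 ≤ n → 0 ≤ c * (n : ℝ) ^ (-(1 + s)) ∧ c * (n : ℝ) ^ (-(1 + s)) ≤ π / 2 := by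
    intro n hn
    have hn1 : (1 : ℝ) ≤ n := by exact_mod_cast hn
    have h1 : (n : ℝ) ^ (-(1 + s)) ≤ 1 := rpow_le_one_of_one_le_of_nonpos hn1 (by linarith)
    have h2 : 0 ≤ (n : ℝ) ^ (-(1 + s)) := rpow_nonneg (by linarith) _
    exact ⟨by positivity, by nlinarith⟩
  have h1 := h (fun n => c * (n : ℝ) ^ (-(1 + s))) (fun n => c * (n : ℝ) ^ (-(1 + s)))
    (fun n hn => ⟨(hle n (Finset.mem_Icc.1 hn).1).1, (hle n (Finset.mem_Icc.1 hn).1).2,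
      fun m hm => (hd n m (Finset.mem_Icc.1 hn).1 (Finset.mem_Icc.1 hm).1).1⟩)
    (fun n hn => ⟨(hle n (Finset.mem_Icc.1 hn).1).1, (hle n (Finset.mem_Icc.1 hn).1).2,
      fun m hm => (hd m n (Finset.mem_Icc.1 hm).1 (Finset.mem_Icc.1 hn).1).2⟩)
  have h3 : 0 ≤ ∑ n ∈ Finset.Icc (1 : ℤ) N, ∑ m ∈ Finset.Icc (1 : ℤ) M,
        (if |α * n - β * m| ≤ π / 4 then ‖x n + y m‖ ^ 2 else 0) :=
      Finset.sum_nonneg fun n _ => Finset.sum_nonneg fun m _ => by split_ifs <;> positivity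
  rw [le_div_iff₀ (by positivity), add_mul, Finset.sum_mul, Finset.sum_mul]
  have e : ∀ (N : ℕ) (x : ℤ → ℂ), ∑ n ∈ Finset.Icc (1 : ℤ) N, (c * (n : ℝ) ^ (-(1 + s))) ^ 2 * ‖x n‖ ^ 2 =
      ∑ n ∈ Finset.Icc (1 : ℤ) N, ((n : ℝ) ^ (-(1 + s))) ^ 2 * ‖x n‖ ^ 2 * c ^ 2 := by
    intro N x
    refine Finset.sum_congr rfl fun n _ => by ring
  rw [e, e] at h1
  linarith

lemma trigSum_neg (α β h : ℝ) (N M : ℕ) (x y : ℤ → ℂ) (j : ℤ) :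
    trigSum α β h N M (fun n => x (-n)) (fun m => y (-m)) j = trigSum α β h N M x y (-j) := by
  have : ∀ (γ : ℝ) (N : ℕ) (x : ℤ → ℂ), ∑ n ∈ modes N, x (-n) * cis (γ * n * (j * h)) =
      ∑ n ∈ modes N, x n * cis (γ * n * (((-j : ℤ) : ℝ) * h)) := by
    intro γ N x
    refine Finset.sum_bij (fun n _ => -n) ?_ ?_ ?_ ?_
    · intro n hn; rw [mem_modes] at hn ⊢; omega
    · intro a _ b _ hab; exact neg_injective hab
    · intro b hb
      refine ⟨-b, ?_, neg_neg b⟩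
      rw [mem_modes] at hb ⊢; omega
    · intro n _
      push_cast
      congr 2
      ring
  rw [trigSum, trigSum, this, this]

/-- The estimate for samples around the time `t`. The factors `cis (α n t)` are Lipschitz in the
frequency, so `PairBound.of_mult` removes them. Reversing the order of the samples gives the negative
frequencies. -/
theorem pairBound_shifted {α β τ : ℝ} (hα : π ≤ α) (hβ : π ≤ β)
    (hne : ∀ n m : ℤ, 1 ≤ n → 1 ≤ m → α * n ≠ β * m) (hτ : 2 < τ) (t : ℝ) : ∃ C : ℝ, 0 < C ∧
    ∀ {h : ℝ} {N M : ℕ} {J : ℤ} (x y : ℤ → ℂ), 0 < h → J * h = τ →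
      α * N ≤ π / h - π / 4 → β * M ≤ π / h - π / 4 → ∀ O : ℝ,
      O = h * ∑ j ∈ Finset.Icc (-J) J, ‖∑ n ∈ modes N, x n * cis (α * n * (t + j * h)) +
          ∑ m ∈ modes M, y m * cis (β * m * (t + j * h))‖ ^ 2 →
      PairBound α β N M x y (C * O) ∧
      PairBound α β N M (fun n => x (-n)) (fun m => y (-m)) (C * O) := by
  obtain ⟨C, hC, hb⟩ := pairBound_uniform hα hβ hne hτ
  refine ⟨(3 + 2 * |t| ^ 2 / 1 ^ 2) / 1 ^ 2 * C, by positivity, ?_⟩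
  intro h N M J x y hh hJ hN hM O hO
  have e : O = h * ∑ j ∈ Finset.Icc (-J) J, ‖trigSum α β h N M (fun n => cis (α * n * t) * x n)
      (fun m => cis (β * m * t) * y m) j‖ ^ 2 := by
    rw [hO]
    congr 1
    refine Finset.sum_congr rfl fun j _ => ?_
    have : ∀ (γ : ℝ) (N : ℕ) (x : ℤ → ℂ), ∑ n ∈ modes N, x n * cis (γ * n * (t + j * h)) =
        ∑ n ∈ modes N, cis (γ * n * t) * x n * cis (γ * n * (j * h)) := by
      intro γ N x
      refine Finset.sum_congr rfl fun n _ => ?_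
      rw [mul_add, cis_add]; ring
    rw [trigSum, this, this]
  have e' : O = h * ∑ j ∈ Finset.Icc (-J) J, ‖trigSum α β h N M
      (fun n => cis (α * (-n : ℤ) * t) * x (-n)) (fun m => cis (β * (-m : ℤ) * t) * y (-m)) j‖ ^ 2 := by
    rw [e]
    congr 1
    refine Finset.sum_bij (fun j _ => -j) ?_ ?_ ?_ ?_
    · intro n hn; rw [Finset.mem_Icc] at hn ⊢; omega
    · intro a _ b _ hab; exact neg_injective hab
    · intro b hb
      refine ⟨-b, ?_, neg_neg b⟩
      rw [Finset.mem_Icc] at hb ⊢; omega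
    · intro j _
      rw [trigSum_neg α β h N M (fun n => cis (α * n * t) * x n) (fun m => cis (β * m * t) * y m),
        neg_neg]
  have hlip : ∀ a b : ℝ, ‖cis (a * t) - cis (b * t)‖ ≤ |t| * |a - b| := by
    intro a b
    refine (norm_cis_sub_cis_le _ _).trans_eq ?_
    rw [← sub_mul, abs_mul, mul_comm]
  constructor
  · refine (PairBound.of_mult (p := fun n => cis (α * n * t)) (q := fun m => cis (β * m * t))
      (c := 1) (K := |t|) hα one_pos (fun n _ => (norm_cis _).ge) (fun n _ => (norm_cis _).ge)
      (fun n _ m _ => hlip _ _) (B := C * O) ?_).mono (le_of_eq (by ring))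
    rw [e]
    exact hb _ _ hh hJ hN hM
  · refine (PairBound.of_mult (p := fun n => cis (α * (-n : ℤ) * t))
      (q := fun m => cis (β * (-m : ℤ) * t))
      (c := 1) (K := |t|) hα one_pos (fun n _ => (norm_cis _).ge) (fun n _ => (norm_cis _).ge)
      (fun n _ m _ => ?_) (B := C * O) ?_).mono (le_of_eq (by ring))
    · refine (hlip _ _).trans_eq ?_
      push_cast
      rw [← abs_neg (α * n - β * m)]
      congr 2; ring
    · rw [e']
      exact hb _ _ hh hJ hN hM

/-! ### Diophantine approximation -/

lemma exists_lower_bound_of_irrational {a : ℝ} (ha : Irrational a) (K : ℕ) :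
    ∃ c : ℝ, 0 < c ∧ ∀ k : ℕ, 1 ≤ k → k < K → ∀ m : ℤ, c ≤ |k * a - m| := by
  induction K with
  | zero => exact ⟨1, one_pos, fun k _ h => absurd h (Nat.not_lt_zero k)⟩
  | succ K ih =>
    obtain ⟨c, hc, hK⟩ := ih
    rcases Nat.eq_zero_or_pos K with rfl | hpos
    · exact ⟨1, one_pos, fun k h1 h2 => by omega⟩
    refine ⟨min c |K * a - round (K * a)|, lt_min hc ?_, fun k h1 h2 m => ?_⟩
    · have := (ha.natCast_mul (by omega : K ≠ 0)).ne_int (round (K * a))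
      exact abs_pos.2 (sub_ne_zero.2 this)
    · rcases Nat.lt_succ_iff_lt_or_eq.1 h2 with h | rfl
      · exact (min_le_left _ _).trans (hK k h1 h m)
      · exact (min_le_right _ _).trans (round_le (k * a) m)

lemma exists_dioph_of_not_liouvilleWith {a s : ℝ} (ha : Irrational a) (hs : 0 < s)
    (h : ¬ LiouvilleWith (2 + s) a) :
    ∃ c : ℝ, 0 < c ∧ ∀ k : ℕ, 1 ≤ k → ∀ m : ℤ, c * (k : ℝ) ^ (-(1 + s)) ≤ |k * a - m| := by
  unfold LiouvilleWith at h
  push Not at h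
  have h1 := h 1
  rw [Filter.eventually_atTop] at h1
  obtain ⟨K, hK⟩ := h1
  obtain ⟨c, hc, hcK⟩ := exists_lower_bound_of_irrational ha K
  refine ⟨min c 1, lt_min hc one_pos, fun k hk m => ?_⟩
  have hk1 : (1 : ℝ) ≤ k := by exact_mod_cast hk
  have hk0 : (0 : ℝ) < k := by linarith
  have hp : 0 ≤ (k : ℝ) ^ (-(1 + s)) := rpow_nonneg hk0.le _
  rcases lt_or_ge k K with hlt | hge
  · have h2 : (k : ℝ) ^ (-(1 + s)) ≤ 1 := rpow_le_one_of_one_le_of_nonpos hk1 (by linarith)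
    calc min c 1 * (k : ℝ) ^ (-(1 + s)) ≤ c * 1 :=
          mul_le_mul (min_le_left _ _) h2 hp hc.le
      _ = c := mul_one c
      _ ≤ _ := hcK k hk hlt m
  · have hne : a ≠ m / k := by
      intro e
      have := (ha.natCast_mul (by omega : k ≠ 0)).ne_int m
      apply this
      rw [e]; field_simp
    have h2 := hK k hge m hne
    have h3 : |(k : ℝ) * a - m| = k * |a - m / k| := by
      rw [← abs_of_pos hk0, ← abs_mul, abs_of_pos hk0, mul_sub, mul_div_cancel₀ _ hk0.ne']
    have h4 : (k : ℝ) * (1 / (k : ℝ) ^ (2 + s)) = (k : ℝ) ^ (-(1 + s)) := by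
      rw [one_div, ← rpow_neg hk0.le]
      nth_rewrite 1 [← rpow_one (k : ℝ)]
      rw [← rpow_add hk0]
      congr 1; ring
    rw [h3]
    calc min c 1 * (k : ℝ) ^ (-(1 + s)) ≤ 1 * (k : ℝ) ^ (-(1 + s)) := by
          gcongr; exact min_le_right _ _
      _ = k * (1 / (k : ℝ) ^ (2 + s)) := by rw [one_mul, h4]
      _ ≤ _ := by gcongr

/-- For almost every `a` the two families of frequencies approach each other at most polynomially,
with an exponent arbitrarily close to `1`. -/
theorem ae_dioph : ∀ᵐ a : ℝ ∂volume, a ∈ Ioo (0 : ℝ) 1 → ∀ s : ℝ, 0 < s → ∃ c : ℝ, 0 < c ∧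
    ∀ n m : ℤ, 1 ≤ n → 1 ≤ m → c * (n : ℝ) ^ (-(1 + s)) ≤ |n / a - m / (1 - a)| ∧
      c * (m : ℝ) ^ (-(1 + s)) ≤ |n / a - m / (1 - a)| := by
  have hirr : ∀ᵐ a : ℝ ∂volume, Irrational a :=
    (countable_range ((↑) : ℚ → ℝ)).ae_notMem volume
  filter_upwards [ae_not_liouvilleWith, hirr] with a ha hia ha01 s hs
  obtain ⟨c, hc, hck⟩ := exists_dioph_of_not_liouvilleWith hia hs (ha (2 + s) (by linarith))
  have ha0 : 0 < a := ha01.1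
  have ha1 : 0 < 1 - a := by linarith [ha01.2]
  set L := 2 + 1 / a + 1 / (1 - a) with hL
  have hL0 : 0 < L := by positivity
  set c' := min (c * L ^ (-(1 + s))) 1 with hc'
  have hLs : 0 < L ^ (-(1 + s)) := rpow_pos_of_pos hL0 _
  refine ⟨c', lt_min (by positivity) one_pos, fun n m hn hm => ?_⟩
  have hn1 : (1 : ℝ) ≤ n := by exact_mod_cast hn
  have hm1 : (1 : ℝ) ≤ m := by exact_mod_cast hm
  set X := |(n : ℝ) / a - m / (1 - a)| with hX
  have hXge : c * ((n : ℝ) + m) ^ (-(1 + s)) ≤ X := by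
    have h1 := hck (n + m).toNat (by omega) n
    have h2 : (((n + m).toNat : ℕ) : ℝ) = n + m := by
      have : (((n + m).toNat : ℕ) : ℤ) = n + m := Int.toNat_of_nonneg (by omega)
      exact_mod_cast this
    rw [h2] at h1
    have h3 : (n : ℝ) / a - m / (1 - a) = -((n + m) * a - n) / (a * (1 - a)) := by
      field_simp; ring
    rw [hX, h3, abs_div, abs_neg, abs_of_pos (by positivity : 0 < a * (1 - a))]
    refine h1.trans (le_div_self (abs_nonneg _) (by positivity) ?_)
    nlinarith
  have key : ∀ k : ℝ, 1 ≤ k → (X < 1 → (n : ℝ) + m ≤ k * L) → c' * k ^ (-(1 + s)) ≤ X := by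
    intro k hk hkL
    have hk0 : 0 ≤ k ^ (-(1 + s)) := rpow_nonneg (by linarith) _
    rcases lt_or_ge X 1 with hlt | hge
    · have h1 : (k * L) ^ (-(1 + s)) ≤ ((n : ℝ) + m) ^ (-(1 + s)) :=
        rpow_le_rpow_of_nonpos (by linarith) (hkL hlt) (by linarith)
      rw [mul_rpow (by linarith) hL0.le] at h1
      calc c' * k ^ (-(1 + s)) ≤ c * L ^ (-(1 + s)) * k ^ (-(1 + s)) := by
            gcongr; exact min_le_left _ _
        _ = c * (k ^ (-(1 + s)) * L ^ (-(1 + s))) := by ring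
        _ ≤ c * ((n : ℝ) + m) ^ (-(1 + s)) := by gcongr
        _ ≤ X := hXge
    · calc c' * k ^ (-(1 + s)) ≤ 1 * 1 :=
            mul_le_mul (min_le_right _ _) (rpow_le_one_of_one_le_of_nonpos hk (by linarith)) hk0
              zero_le_one
        _ ≤ X := by linarith
  have hia1 : 0 < 1 / a := by positivity
  have hia2 : 0 < 1 / (1 - a) := by positivity
  have e1 : (n : ℝ) / a = n * (1 / a) := by ring
  have e2 : (m : ℝ) / (1 - a) = m * (1 / (1 - a)) := by ring
  have g1 : 1 ≤ 1 / a := by rw [le_div_iff₀ ha0]; linarith [ha01.2]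
  have g2 : 1 ≤ 1 / (1 - a) := by rw [le_div_iff₀ ha1]; linarith
  constructor
  · apply key _ hn1
    intro hlt
    rw [hX, abs_lt, e1, e2] at hlt
    nlinarith [hlt.1]
  · apply key _ hm1
    intro hlt
    rw [hX, abs_lt, e1, e2] at hlt
    nlinarith [hlt.2]

/-! ### Sobolev norms and trigonometric sums on an interval -/

/-- The Cauchy-Schwarz inequality for continuous square integrable functions. -/
lemma sq_integral_mul_le {f g : ℝ → ℝ} (hf : Continuous f) (hg : Continuous g)
    (hf2 : Integrable fun x => f x ^ 2) (hg2 : Integrable fun x => g x ^ 2) :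
    Integrable (fun x => f x * g x) ∧
      (∫ x, f x * g x) ^ 2 ≤ (∫ x, f x ^ 2) * ∫ x, g x ^ 2 := by
  have hfg : Integrable (fun x => f x * g x) := by
    refine Integrable.mono' (hf2.add hg2) (hf.mul hg).aestronglyMeasurable
      (Eventually.of_forall fun x => ?_)
    simp only [Pi.add_apply]
    rw [Real.norm_eq_abs, abs_le]
    constructor <;> nlinarith [sq_nonneg (f x + g x), sq_nonneg (f x - g x)]
  refine ⟨hfg, ?_⟩
  have h := discrim_le_zero (a := ∫ x, f x ^ 2) (b := 2 * ∫ x, f x * g x) (c := ∫ x, g x ^ 2) ?_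
  · rw [discrim] at h; nlinarith
  · intro t
    have e : (∫ x, f x ^ 2) * (t * t) + (2 * ∫ x, f x * g x) * t + ∫ x, g x ^ 2 =
        ∫ x, (t * f x + g x) ^ 2 := by
      have : ∀ x, (t * f x + g x) ^ 2 = (t * t) * f x ^ 2 + (2 * t) * (f x * g x) + g x ^ 2 :=
        fun x => by ring
      simp_rw [this]
      have i12 : Integrable fun x => (t * t) * f x ^ 2 + (2 * t) * (f x * g x) :=
        (hf2.const_mul _).add (hfg.const_mul _)
      rw [integral_add i12 hg2,
        integral_add (hf2.const_mul _) (hfg.const_mul _), integral_const_mul, integral_const_mul]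
      ring
    rw [e]
    exact integral_nonneg fun x => sq_nonneg _

lemma one_add_sq_rpow_mono {s s' : ℝ} (h : s ≤ s') (ξ : ℝ) : (1 + ξ ^ 2) ^ s ≤ (1 + ξ ^ 2) ^ s' :=
  rpow_le_rpow_of_exponent_le (by nlinarith [sq_nonneg ξ]) h

lemma continuous_one_add_sq_rpow (s : ℝ) : Continuous fun ξ : ℝ => (1 + ξ ^ 2) ^ s :=
  (by fun_prop : Continuous fun ξ : ℝ => 1 + ξ ^ 2).rpow_const
    fun ξ => Or.inl (by positivity)

lemma integrable_sobolev (s : ℝ) (Φ : 𝓢(ℝ, ℂ)) :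
    Integrable fun ξ : ℝ => (1 + ξ ^ 2) ^ s * ‖𝓕 Φ ξ‖ ^ 2 := by
  obtain ⟨k, hk⟩ := exists_nat_ge s
  set M := SchwartzMap.seminorm ℝ 0 0 (𝓕 Φ) with hM
  have h1 := (SchwartzMap.integrable_pow_mul volume (𝓕 Φ) 0).add
    (SchwartzMap.integrable_pow_mul volume (𝓕 Φ) (2 * k))
  refine Integrable.mono' (h1.const_mul (2 ^ (k - 1) * M)) ?_ (Eventually.of_forall fun ξ => ?_)
  · exact ((continuous_one_add_sq_rpow s).mul ((𝓕 Φ).continuous.norm.pow 2)).aestronglyMeasurable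
  · have h2 : ‖𝓕 Φ ξ‖ ≤ M := SchwartzMap.norm_le_seminorm ℝ (𝓕 Φ) ξ
    have h3 : (1 + ξ ^ 2) ^ s ≤ 2 ^ (k - 1) * (1 + ‖ξ‖ ^ (2 * k)) := by
      refine (one_add_sq_rpow_mono hk ξ).trans ?_
      rw [rpow_natCast, ← sq_abs ξ, ← Real.norm_eq_abs]
      have := add_pow_le zero_le_one (sq_nonneg ‖ξ‖) k
      rwa [one_pow, ← pow_mul] at this
    have h4 : 0 ≤ (1 + ξ ^ 2) ^ s := rpow_nonneg (by positivity) _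
    rw [Real.norm_eq_abs, abs_of_nonneg (by positivity)]
    simp only [Pi.add_apply, pow_zero, one_mul]
    calc (1 + ξ ^ 2) ^ s * ‖𝓕 Φ ξ‖ ^ 2
        ≤ 2 ^ (k - 1) * (1 + ‖ξ‖ ^ (2 * k)) * (M * ‖𝓕 Φ ξ‖) := by
          rw [sq ‖𝓕 Φ ξ‖]; gcongr
      _ = _ := by ring

lemma sobolevNormSq_nonneg (s : ℝ) (Φ : 𝓢(ℝ, ℂ)) : 0 ≤ sobolevNormSq s Φ :=
  integral_nonneg fun ξ => mul_nonneg (rpow_nonneg (by positivity) _) (by positivity)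

lemma sobolevNormSq_mono {s s' : ℝ} (h : s ≤ s') (Φ : 𝓢(ℝ, ℂ)) :
    sobolevNormSq s Φ ≤ sobolevNormSq s' Φ :=
  integral_mono (integrable_sobolev s Φ) (integrable_sobolev s' Φ) fun ξ =>
    mul_le_mul_of_nonneg_right (one_add_sq_rpow_mono h ξ) (by positivity)

lemma fourier_derivCLM (Φ : 𝓢(ℝ, ℂ)) (ξ : ℝ) :
    𝓕 (SchwartzMap.derivCLM ℂ ℂ Φ) ξ = (2 * π * Complex.I * ξ) * 𝓕 Φ ξ := by
  have h1 : ((SchwartzMap.derivCLM ℂ ℂ Φ : 𝓢(ℝ, ℂ)) : ℝ → ℂ) = deriv Φ :=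
    funext fun x => SchwartzMap.derivCLM_apply ℂ Φ x
  have h2 := Real.fourier_deriv (f := Φ) Φ.integrable Φ.differentiable
    (by rw [← h1]; exact SchwartzMap.integrable _)
  rw [SchwartzMap.fourier_coe, h1, h2, SchwartzMap.fourier_coe]
  rfl

lemma sobolevNormSq_derivCLM_le (s : ℝ) (Φ : 𝓢(ℝ, ℂ)) :
    sobolevNormSq s (SchwartzMap.derivCLM ℂ ℂ Φ) ≤ 4 * π ^ 2 * sobolevNormSq (1 + s) Φ := by
  unfold sobolevNormSq
  rw [← integral_const_mul]
  refine integral_mono (integrable_sobolev s _) ((integrable_sobolev (1 + s) Φ).const_mul _)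
    fun ξ => ?_
  simp only
  have h0 : (0 : ℝ) < 1 + ξ ^ 2 := by positivity
  have h1 : 0 ≤ (1 + ξ ^ 2) ^ s := rpow_nonneg h0.le _
  have h2 : ‖(2 * π * Complex.I * ξ : ℂ)‖ ^ 2 = 4 * π ^ 2 * ξ ^ 2 := by
    simp only [norm_mul, Complex.norm_I, Complex.norm_real, Real.norm_eq_abs, Complex.norm_ofNat,
      mul_one, mul_pow, sq_abs]
    ring
  rw [fourier_derivCLM, norm_mul, mul_pow, h2, rpow_add h0, rpow_one]
  have h3 : 0 ≤ 4 * π ^ 2 * ((1 + ξ ^ 2) ^ s * ‖𝓕 Φ ξ‖ ^ 2) := by positivity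
  nlinarith

/-- Fourier inversion. -/
lemma schwartz_eq_integral (Φ : 𝓢(ℝ, ℂ)) (x : ℝ) :
    Φ x = ∫ ξ : ℝ, 𝓕 Φ ξ * cis (2 * π * ξ * x) := by
  have h1 : Φ x = 𝓕⁻ (𝓕 Φ) x := by rw [FourierTransform.fourierInv_fourier_eq]
  rw [h1, SchwartzMap.fourierInv_coe, Real.fourierInv_eq']
  refine integral_congr_ae (Eventually.of_forall fun ξ => ?_)
  simp only [smul_eq_mul, cis]
  rw [mul_comm]
  congr 2
  rw [mul_comm]
  congr 2
  simp
  ring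

/-- The embedding of `H^s(ℝ)` into the bounded functions, for `s ≥ 1`. -/
lemma sq_norm_apply_le {s : ℝ} (hs : 1 ≤ s) (Φ : 𝓢(ℝ, ℂ)) (x : ℝ) :
    ‖Φ x‖ ^ 2 ≤ π * sobolevNormSq s Φ := by
  have hc1 : Continuous fun ξ : ℝ => (1 + ξ ^ 2) ^ (-(1 / 2) : ℝ) := continuous_one_add_sq_rpow _
  have hc2 : Continuous fun ξ : ℝ => (1 + ξ ^ 2) ^ (1 / 2 : ℝ) * ‖𝓕 Φ ξ‖ :=
    (continuous_one_add_sq_rpow _).mul (𝓕 Φ).continuous.norm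
  have e1 : ∀ ξ : ℝ, ((1 + ξ ^ 2) ^ (-(1 / 2) : ℝ)) ^ 2 = (1 + ξ ^ 2)⁻¹ := by
    intro ξ
    rw [← rpow_natCast, ← rpow_mul (by positivity)]
    norm_num [rpow_neg_one]
  have e2 : ∀ ξ : ℝ, ((1 + ξ ^ 2) ^ (1 / 2 : ℝ) * ‖𝓕 Φ ξ‖) ^ 2 = (1 + ξ ^ 2) ^ (1 : ℝ) * ‖𝓕 Φ ξ‖ ^ 2 := by
    intro ξ
    rw [mul_pow, ← rpow_natCast ((1 + ξ ^ 2) ^ (1 / 2 : ℝ)), ← rpow_mul (by positivity)]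
    norm_num
  have h := sq_integral_mul_le hc1 hc2 (by simp_rw [e1]; exact integrable_inv_one_add_sq)
    (by simp_rw [e2]; exact integrable_sobolev 1 Φ)
  simp_rw [e1, e2] at h
  rw [integral_univ_inv_one_add_sq] at h
  have h1 : ‖Φ x‖ ≤ ∫ ξ : ℝ, (1 + ξ ^ 2) ^ (-(1 / 2) : ℝ) * ((1 + ξ ^ 2) ^ (1 / 2 : ℝ) * ‖𝓕 Φ ξ‖) := by
    rw [schwartz_eq_integral Φ x]
    refine (norm_integral_le_integral_norm _).trans_eq (integral_congr_ae (Eventually.of_forall fun ξ => ?_))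
    simp only [norm_mul, norm_cis, mul_one]
    rw [← mul_assoc, ← rpow_add (by positivity)]
    norm_num
  calc ‖Φ x‖ ^ 2 ≤ _ := pow_le_pow_left₀ (norm_nonneg _) h1 2
    _ ≤ π * sobolevNormSq 1 Φ := h.2
    _ ≤ _ := by gcongr; exact sobolevNormSq_mono hs Φ

/-- The Fourier transform of the indicator function of `(l, r)`. -/
noncomputable def intervalExp (l r ν : ℝ) : ℂ := ∫ x in l..r, cis (ν * x)

lemma continuous_intervalExp (l r : ℝ) : Continuous (intervalExp l r) := by
  unfold intervalExp
  apply intervalIntegral.continuous_parametric_intervalIntegral_of_continuous'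
  exact continuous_cis.comp (by fun_prop)

lemma norm_intervalExp_le {l r : ℝ} (hlr : l ≤ r) (ν : ℝ) :
    ‖intervalExp l r ν‖ ≤ (r - l + 2) * (1 + |ν|)⁻¹ := by
  have h1 : ‖intervalExp l r ν‖ ≤ r - l := by
    have := intervalIntegral.norm_integral_le_of_norm_le_const (a := l) (b := r)
      (f := fun x => cis (ν * x)) (C := 1) fun x _ => (norm_cis _).le
    rwa [one_mul, abs_of_nonneg (by linarith)] at this
  have h2 : |ν| * ‖intervalExp l r ν‖ ≤ 2 := by
    have e : Complex.I * ν * intervalExp l r ν = cis (ν * r) - cis (ν * l) := by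
      rw [intervalExp, ← intervalIntegral.integral_const_mul]
      apply intervalIntegral.integral_eq_sub_of_hasDerivAt
      · intro x _
        exact hasDerivAt_cis ν x
      · exact (continuous_const.mul (continuous_cis.comp (by fun_prop))).intervalIntegrable _ _
    have : ‖Complex.I * ν * intervalExp l r ν‖ ≤ 1 + 1 := by
      rw [e]
      refine (norm_sub_le _ _).trans ?_
      rw [norm_cis, norm_cis]
    rw [norm_mul, norm_mul, Complex.norm_I, one_mul, Complex.norm_real, Real.norm_eq_abs] at this
    linarith
  rw [← div_eq_mul_inv, le_div_iff₀ (by positivity)]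
  linarith

lemma integral_cis_mul_schwartz {l r : ℝ} (hlr : l ≤ r) (ω : ℝ) (Ψ : 𝓢(ℝ, ℂ)) :
    ∫ x in l..r, cis (ω * x) * Ψ x = ∫ ξ : ℝ, 𝓕 Ψ ξ * intervalExp l r (ω + 2 * π * ξ) := by
  have h1 : ∀ x, cis (ω * x) * Ψ x = ∫ ξ : ℝ, 𝓕 Ψ ξ * cis ((ω + 2 * π * ξ) * x) := by
    intro x
    rw [schwartz_eq_integral Ψ x, ← integral_const_mul]
    refine integral_congr_ae (Eventually.of_forall fun ξ => ?_)
    simp only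
    rw [add_mul, cis_add]; ring
  simp_rw [h1]
  rw [intervalIntegral.integral_of_le hlr, integral_integral_swap]
  · refine integral_congr_ae (Eventually.of_forall fun ξ => ?_)
    simp only
    rw [intervalExp, intervalIntegral.integral_of_le hlr, integral_const_mul]
  · have h2 : Integrable (fun z : ℝ × ℝ => (1 : ℂ) * 𝓕 Ψ z.2) ((volume.restrict (Ioc l r)).prod volume) :=
      Integrable.mul_prod (f := fun _ : ℝ => (1 : ℂ)) (integrable_const _) (𝓕 Ψ).integrable
    refine h2.mono ?_ (Eventually.of_forall fun z => ?_)
    · apply Continuous.aestronglyMeasurable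
      exact ((𝓕 Ψ).continuous.comp continuous_snd).mul (continuous_cis.comp (by fun_prop))
    · simp [Function.uncurry]

/-- A sum over an arithmetic progression is bounded uniformly in its offset. -/
lemma exists_sum_progression_le {α p : ℝ} (hα : α ≠ 0) (hp : 1 < p) : ∃ K : ℝ, 0 < K ∧
    ∀ (N : ℕ) (y : ℝ), ∑ n ∈ Finset.Icc 1 N, (1 + |α * n + y|) ^ (-p) ≤ K := by
  have hsum : Summable fun k : ℤ => (1 + |(k : ℝ)|) ^ (-p) := by
    refine Summable.of_norm_bounded_eventually (Real.summable_abs_int_rpow hp) ?_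
    have : ∀ᶠ k : ℤ in cofinite, k ≠ 0 := (Set.finite_singleton (0 : ℤ)).compl_mem_cofinite
    filter_upwards [this] with k hk
    have h1 : 0 < |(k : ℝ)| := abs_pos.2 (by exact_mod_cast hk)
    rw [Real.norm_eq_abs, abs_of_nonneg (rpow_nonneg (by positivity) _)]
    exact rpow_le_rpow_of_nonpos h1 (by linarith) (by linarith)
  set c := min |α| 1 with hc
  have hc0 : 0 < c := lt_min (abs_pos.2 hα) one_pos
  refine ⟨(c / 2) ^ (-p) * ∑' k : ℤ, (1 + |(k : ℝ)|) ^ (-p) + 1, ?_, fun N y => ?_⟩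
  · have : 0 ≤ ∑' k : ℤ, (1 + |(k : ℝ)|) ^ (-p) := tsum_nonneg fun k => rpow_nonneg (by positivity) _
    have h2 : 0 ≤ (c / 2) ^ (-p) := rpow_nonneg (by positivity) _
    positivity
  -- `-m` is the offset `y` in units of `α`, up to rounding
  set m := round (-y / α) with hm
  have hpt : ∀ n : ℕ, (1 + |α * n + y|) ^ (-p) ≤
      (c / 2) ^ (-p) * (1 + |(((n : ℤ) - m : ℤ) : ℝ)|) ^ (-p) := by
    intro n
    rw [← mul_rpow (by positivity) (by positivity)]
    apply rpow_le_rpow_of_nonpos (by positivity) _ (by linarith)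
    have h1 : |(-y / α) - m| ≤ 1 / 2 := abs_sub_round _
    have h2 : |α * n + y| = |α| * |(n : ℝ) - -y / α| := by
      rw [← abs_mul]; congr 1; field_simp; ring
    have h3 := abs_sub_le (n : ℝ) (-y / α) m
    have h4 : c * |(n : ℝ) - -y / α| ≤ |α| * |(n : ℝ) - -y / α| := by
      gcongr; exact min_le_left _ _
    have h5 : c ≤ 1 := min_le_right _ _
    rw [h2]
    push_cast
    nlinarith [abs_nonneg ((n : ℝ) - m)]
  have h1 : ∑ n ∈ Finset.Icc 1 N, (1 + |(((n : ℤ) - m : ℤ) : ℝ)|) ^ (-p) ≤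
      ∑' k : ℤ, (1 + |(k : ℝ)|) ^ (-p) := by
    have e : ∑ n ∈ Finset.Icc 1 N, (1 + |(((n : ℤ) - m : ℤ) : ℝ)|) ^ (-p) =
        ∑ k ∈ (Finset.Icc 1 N).image (fun n : ℕ => (n : ℤ) - m), (1 + |(k : ℝ)|) ^ (-p) := by
      rw [Finset.sum_image]
      intro a _ b _ hab
      simp only at hab
      omega
    rw [e]
    exact hsum.sum_le_tsum _ fun k _ => rpow_nonneg (by positivity) _
  calc ∑ n ∈ Finset.Icc 1 N, (1 + |α * n + y|) ^ (-p)
      ≤ ∑ n ∈ Finset.Icc 1 N, (c / 2) ^ (-p) * (1 + |(((n : ℤ) - m : ℤ) : ℝ)|) ^ (-p) :=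
        Finset.sum_le_sum fun n _ => hpt n
    _ ≤ (c / 2) ^ (-p) * ∑' k : ℤ, (1 + |(k : ℝ)|) ^ (-p) := by
        rw [← Finset.mul_sum]
        exact mul_le_mul_of_nonneg_left h1 (rpow_nonneg (by positivity) _)
    _ ≤ _ := by linarith

/-- The weight of the Sobolev norm against the decay in `ν = ω + 2 π ξ` of the transform of an
interval. Part of the weight gives a power of `n`, and what remains is integrable in `ξ`. -/
lemma weight_le {ε C n A B : ℝ} (hε : 0 < ε) (hε1 : ε ≤ 1) (hn : 0 < n) (hA : 1 ≤ A)
    (hB : 1 ≤ B) (hC : 0 < C) (h : n ≤ C * (A * B)) :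
    A ^ (-(2 * ε)) * B ^ (-(1 - ε / 2)) ≤
      C ^ (ε / 2) * n ^ (-(ε / 2)) * (A ^ (-(1 + ε / 2)) + B ^ (-(1 + ε / 2))) := by
  have hA0 : 0 < A := by linarith
  have hB0 : 0 < B := by linarith
  have e : A ^ (-(2 * ε)) * B ^ (-(1 - ε / 2)) =
      (A * B) ^ (-(ε / 2)) * (A ^ (-(3 * ε / 2)) * B ^ (-(1 - ε))) := by
    rw [mul_rpow hA0.le hB0.le]
    have e1 : A ^ (-(2 * ε)) = A ^ (-(ε / 2)) * A ^ (-(3 * ε / 2)) := by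
      rw [← rpow_add hA0]; congr 1; ring
    have e2 : B ^ (-(1 - ε / 2)) = B ^ (-(ε / 2)) * B ^ (-(1 - ε)) := by
      rw [← rpow_add hB0]; congr 1; ring
    rw [e1, e2]; ring
  have h1 : (A * B) ^ (-(ε / 2)) ≤ C ^ (ε / 2) * n ^ (-(ε / 2)) := by
    have h2 : (C * (A * B)) ^ (-(ε / 2)) ≤ n ^ (-(ε / 2)) :=
      rpow_le_rpow_of_nonpos hn h (by linarith)
    rw [mul_rpow hC.le (by positivity), rpow_neg hC.le] at h2
    have h3 : 0 < C ^ (ε / 2) := rpow_pos_of_pos hC _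
    calc (A * B) ^ (-(ε / 2)) = C ^ (ε / 2) * ((C ^ (ε / 2))⁻¹ * (A * B) ^ (-(ε / 2))) := by
          rw [← mul_assoc, mul_inv_cancel₀ h3.ne', one_mul]
      _ ≤ _ := by gcongr
  have h2 : A ^ (-(3 * ε / 2)) * B ^ (-(1 - ε)) ≤ A ^ (-(1 + ε / 2)) + B ^ (-(1 + ε / 2)) := by
    have pA := rpow_nonneg hA0.le (-(1 + ε / 2))
    have pB := rpow_nonneg hB0.le (-(1 + ε / 2))
    rcases le_total A B with hle | hle
    · have h3 : B ^ (-(1 - ε)) ≤ A ^ (-(1 - ε)) := rpow_le_rpow_of_nonpos hA0 hle (by linarith)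
      calc A ^ (-(3 * ε / 2)) * B ^ (-(1 - ε)) ≤ A ^ (-(3 * ε / 2)) * A ^ (-(1 - ε)) := by gcongr
        _ = A ^ (-(1 + ε / 2)) := by rw [← rpow_add hA0]; congr 1; ring
        _ ≤ _ := by linarith
    · have h3 : A ^ (-(3 * ε / 2)) ≤ B ^ (-(3 * ε / 2)) := rpow_le_rpow_of_nonpos hB0 hle (by linarith)
      calc A ^ (-(3 * ε / 2)) * B ^ (-(1 - ε)) ≤ B ^ (-(3 * ε / 2)) * B ^ (-(1 - ε)) := by gcongr
        _ = B ^ (-(1 + ε / 2)) := by rw [← rpow_add hB0]; congr 1; ring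
        _ ≤ _ := by linarith
  rw [e]
  exact mul_le_mul h1 h2 (by positivity) (by positivity)

/-- A trigonometric sum on an interval as a functional on `H^ε(ℝ)`, `0 < ε ≤ 1`, with a loss in the
exponent of the weights. No boundary condition on `Ψ` is needed. -/
theorem exists_norm_integral_trig_le {α ε l r : ℝ} (hα : α ≠ 0) (hε : 0 < ε) (hε1 : ε ≤ 1)
    (hlr : l ≤ r) : ∃ C : ℝ, 0 < C ∧ ∀ (N : ℕ) (β : ℕ → ℂ) (Ψ : 𝓢(ℝ, ℂ)),
      ‖∫ x in l..r, (∑ n ∈ Finset.Icc 1 N, β n * cis (α * n * x)) * Ψ x‖ ^ 2 ≤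
        C * (∑ n ∈ Finset.Icc 1 N, (n : ℝ) ^ (-(ε / 2)) * ‖β n‖ ^ 2) * sobolevNormSq ε Ψ := by
  set q := 1 + ε / 2 with hq
  obtain ⟨K, hK, hKb⟩ := exists_sum_progression_le hα (by linarith : 1 < q)
  set D := r - l + 2 with hD
  have hD0 : 0 < D := by linarith
  set C₁ := (1 + 2 * π) / |α| with hC₁
  have hα0 : 0 < |α| := abs_pos.2 hα
  have hC₁0 : 0 < C₁ := by positivity
  have hint : Integrable fun ξ : ℝ => (1 + |ξ|) ^ (-q) := by
    have := integrable_one_add_norm (E := ℝ) (μ := volume) (r := q) (by simp; linarith)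
    simpa using this
  set I := ∫ ξ : ℝ, (1 + |ξ|) ^ (-q) with hI
  have hI0 : 0 ≤ I := integral_nonneg fun ξ => rpow_nonneg (by positivity) _
  have hintB : ∀ ω : ℝ, Integrable (fun ξ : ℝ => (1 + |ω + 2 * π * ξ|) ^ (-q)) ∧
      ∫ ξ : ℝ, (1 + |ω + 2 * π * ξ|) ^ (-q) ≤ I := by
    intro ω
    have h2π : (2 * π) ≠ 0 := by positivity
    have i1 : Integrable fun η : ℝ => (1 + |ω + η|) ^ (-q) := hint.comp_add_left ω
    refine ⟨i1.comp_mul_left' h2π, ?_⟩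
    rw [Measure.integral_comp_mul_left (fun η : ℝ => (1 + |ω + η|) ^ (-q)),
      integral_add_left_eq_self (fun η : ℝ => (1 + |η|) ^ (-q)) ω, smul_eq_mul,
      abs_of_pos (by positivity)]
    have h3 : (2 * π)⁻¹ ≤ 1 := inv_le_one_of_one_le₀ (by linarith [pi_gt_three])
    calc (2 * π)⁻¹ * I ≤ 1 * I := by gcongr
      _ = I := one_mul I
  set E := C₁ ^ (ε / 2) with hE
  have hE0 : 0 < E := rpow_pos_of_pos hC₁0 _
  refine ⟨4 * D ^ 2 * K * E * (I + 1), by positivity, fun N β Ψ => ?_⟩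
  set g : ℝ → ℂ := fun ξ => ∑ n ∈ Finset.Icc 1 N, β n * intervalExp l r (α * n + 2 * π * ξ) with hg
  have hgc : Continuous g := by
    simp only [hg]
    refine continuous_finsetSum _ fun n _ => continuous_const.mul
      ((continuous_intervalExp l r).comp (by fun_prop))
  -- the sum in question as an integral over frequencies
  have e1 : ∫ x in l..r, (∑ n ∈ Finset.Icc 1 N, β n * cis (α * n * x)) * Ψ x =
      ∫ ξ : ℝ, 𝓕 Ψ ξ * g ξ := by
    have h1 : ∀ x, (∑ n ∈ Finset.Icc 1 N, β n * cis (α * n * x)) * Ψ x =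
        ∑ n ∈ Finset.Icc 1 N, β n * (cis (α * n * x) * Ψ x) := by
      intro x
      rw [Finset.sum_mul]
      exact Finset.sum_congr rfl fun n _ => by ring
    simp_rw [h1]
    have hcont : ∀ n : ℕ, Continuous fun x => β n * (cis (α * n * x) * Ψ x) := fun n =>
      continuous_const.mul ((continuous_cis.comp (by fun_prop)).mul Ψ.continuous)
    rw [intervalIntegral.integral_finsetSum fun n _ => (hcont n).intervalIntegrable _ _]
    simp_rw [intervalIntegral.integral_const_mul, integral_cis_mul_schwartz hlr]
    simp only [hg, Finset.mul_sum]
    rw [integral_finsetSum]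
    · refine Finset.sum_congr rfl fun n _ => ?_
      rw [← integral_const_mul]
      refine integral_congr_ae (Eventually.of_forall fun ξ => ?_)
      simp only; ring
    · intro n _
      refine ((𝓕 Ψ).integrable.norm.mul_const (‖β n‖ * D)).mono' ?_ (Eventually.of_forall fun ξ => ?_)
      · exact ((𝓕 Ψ).continuous.mul (continuous_const.mul
          ((continuous_intervalExp l r).comp (by fun_prop)))).aestronglyMeasurable
      · rw [norm_mul, norm_mul]
        gcongr
        refine (norm_intervalExp_le hlr _).trans ?_
        have : (1 + |α * n + 2 * π * ξ|)⁻¹ ≤ 1 :=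
          inv_le_one_of_one_le₀ (by linarith [abs_nonneg (α * n + 2 * π * ξ)])
        calc D * (1 + |α * n + 2 * π * ξ|)⁻¹ ≤ D * 1 := by gcongr
          _ = D := mul_one D
  set w : ℕ → ℝ := fun n => (n : ℝ) ^ (-(ε / 2)) * ‖β n‖ ^ 2 with hw
  set R : ℝ → ℝ := fun ξ => ∑ n ∈ Finset.Icc 1 N,
    w n * ((1 + |ξ|) ^ (-q) + (1 + |α * n + 2 * π * ξ|) ^ (-q)) with hR
  have hterm : ∀ n : ℕ, Integrable fun ξ : ℝ =>
      w n * ((1 + |ξ|) ^ (-q) + (1 + |α * n + 2 * π * ξ|) ^ (-q)) :=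
    fun n => (hint.add (hintB (α * n)).1).const_mul _
  have hRint : Integrable R := integrable_finsetSum _ fun n _ => hterm n
  have hw0 : ∀ n, 0 ≤ w n := fun n => mul_nonneg (rpow_nonneg (by positivity) _) (by positivity)
  have hRle : ∫ ξ, R ξ ≤ (∑ n ∈ Finset.Icc 1 N, w n) * (2 * I) := by
    simp only [hR]
    rw [integral_finsetSum _ fun n _ => hterm n, Finset.sum_mul]
    refine Finset.sum_le_sum fun n _ => ?_
    rw [integral_const_mul, integral_add hint (hintB (α * n)).1]
    have := (hintB (α * n)).2
    exact mul_le_mul_of_nonneg_left (by linarith) (hw0 n)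
  -- Cauchy-Schwarz in `ξ` for the two factors `u` and `v`
  set u : ℝ → ℝ := fun ξ => (1 + ξ ^ 2) ^ (ε / 2) * ‖𝓕 Ψ ξ‖ with hu
  set v : ℝ → ℝ := fun ξ => (1 + ξ ^ 2) ^ (-(ε / 2)) * ‖g ξ‖ with hv
  have hu2 : ∀ ξ, u ξ ^ 2 = (1 + ξ ^ 2) ^ ε * ‖𝓕 Ψ ξ‖ ^ 2 := by
    intro ξ
    simp only [hu]
    rw [mul_pow, ← rpow_natCast ((1 + ξ ^ 2) ^ (ε / 2)), ← rpow_mul (by positivity)]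
    congr 2
    push_cast; ring
  have hv2 : ∀ ξ, v ξ ^ 2 ≤ 2 * D ^ 2 * K * E * R ξ := by
    intro ξ
    have hA : 1 ≤ 1 + |ξ| := by linarith [abs_nonneg ξ]
    have hB : ∀ n : ℕ, 1 ≤ 1 + |α * n + 2 * π * ξ| := fun n => by
      linarith [abs_nonneg (α * n + 2 * π * ξ)]
    -- Cauchy-Schwarz in `n`, with the decay of `intervalExp` split between the two factors
    have s1 : ‖g ξ‖ ≤ D * ∑ n ∈ Finset.Icc 1 N,
        (‖β n‖ * (1 + |α * n + 2 * π * ξ|) ^ (-((1 - ε / 2) / 2))) *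
          (1 + |α * n + 2 * π * ξ|) ^ (-(q / 2)) := by
      rw [Finset.mul_sum]
      refine (norm_sum_le _ _).trans (Finset.sum_le_sum fun n _ => ?_)
      have e : (1 + |α * n + 2 * π * ξ|) ^ (-((1 - ε / 2) / 2)) *
          (1 + |α * n + 2 * π * ξ|) ^ (-(q / 2)) = (1 + |α * n + 2 * π * ξ|)⁻¹ := by
        rw [← rpow_add (by linarith [hB n]), ← rpow_neg_one]
        congr 1; rw [hq]; ring
      rw [norm_mul, mul_assoc ‖β n‖, e]
      have := mul_le_mul_of_nonneg_left (norm_intervalExp_le hlr (α * n + 2 * π * ξ)) (norm_nonneg (β n))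
      linarith
    have s2 := Finset.sum_mul_sq_le_sq_mul_sq (Finset.Icc 1 N)
      (fun n : ℕ => ‖β n‖ * (1 + |α * n + 2 * π * ξ|) ^ (-((1 - ε / 2) / 2)))
      (fun n : ℕ => (1 + |α * n + 2 * π * ξ|) ^ (-(q / 2)))
    have sqr : ∀ {x y : ℝ}, 0 ≤ x → (x ^ (-(y / 2))) ^ 2 = x ^ (-y) := by
      intro x y hx
      rw [← rpow_natCast, ← rpow_mul hx]
      congr 1; push_cast; ring
    have s3 : ∑ n ∈ Finset.Icc 1 N, ((1 + |α * n + 2 * π * ξ|) ^ (-(q / 2))) ^ 2 ≤ K := by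
      refine le_trans (le_of_eq ?_) (hKb N (2 * π * ξ))
      refine Finset.sum_congr rfl fun n _ => ?_
      rw [sqr (by linarith [hB n])]
    have s4 : ∑ n ∈ Finset.Icc 1 N, (‖β n‖ * (1 + |α * n + 2 * π * ξ|) ^ (-((1 - ε / 2) / 2))) ^ 2 =
        ∑ n ∈ Finset.Icc 1 N, ‖β n‖ ^ 2 * (1 + |α * n + 2 * π * ξ|) ^ (-(1 - ε / 2)) := by
      refine Finset.sum_congr rfl fun n _ => ?_
      rw [mul_pow, sqr (by linarith [hB n])]
    rw [s4] at s2
    have s5 : ‖g ξ‖ ^ 2 ≤ D ^ 2 * (K * ∑ n ∈ Finset.Icc 1 N,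
        ‖β n‖ ^ 2 * (1 + |α * n + 2 * π * ξ|) ^ (-(1 - ε / 2))) := by
      have s6 : 0 ≤ ∑ n ∈ Finset.Icc 1 N, ‖β n‖ ^ 2 * (1 + |α * n + 2 * π * ξ|) ^ (-(1 - ε / 2)) :=
        Finset.sum_nonneg fun n _ => mul_nonneg (by positivity) (rpow_nonneg (by linarith [hB n]) _)
      refine (pow_le_pow_left₀ (norm_nonneg _) s1 2).trans ?_
      rw [mul_pow]
      gcongr
      refine s2.trans ?_
      rw [mul_comm K]
      exact mul_le_mul_of_nonneg_left s3 s6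
    have s7 : ((1 + ξ ^ 2) ^ (-(ε / 2))) ^ 2 ≤ 2 * (1 + |ξ|) ^ (-(2 * ε)) := by
      rw [sqr (by positivity)]
      have h1 : (1 + |ξ|) ^ 2 / 2 ≤ 1 + ξ ^ 2 := by
        rw [← sq_abs ξ]; nlinarith [sq_nonneg (1 - |ξ|)]
      have h2 : (1 + ξ ^ 2) ^ (-ε) ≤ ((1 + |ξ|) ^ 2 / 2) ^ (-ε) :=
        rpow_le_rpow_of_nonpos (by positivity) h1 (by linarith)
      have h3 : ((1 + |ξ|) ^ 2 / 2) ^ (-ε) = 2 ^ ε * (1 + |ξ|) ^ (-(2 * ε)) := by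
        rw [div_rpow (by positivity) (by norm_num), rpow_neg (by norm_num : (0 : ℝ) ≤ 2),
          div_inv_eq_mul, mul_comm, ← rpow_natCast, ← rpow_mul (by positivity)]
        congr 2; push_cast; ring
      have h4 : (2 : ℝ) ^ ε ≤ 2 := by
        calc (2 : ℝ) ^ ε ≤ 2 ^ (1 : ℝ) := rpow_le_rpow_of_exponent_le (by norm_num) hε1
          _ = 2 := rpow_one 2
      rw [h3] at h2
      refine h2.trans ?_
      have : 0 ≤ (1 + |ξ|) ^ (-(2 * ε)) := rpow_nonneg (by positivity) _
      gcongr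
    have s8 : ∀ n ∈ Finset.Icc 1 N, (1 + |ξ|) ^ (-(2 * ε)) *
        (‖β n‖ ^ 2 * (1 + |α * n + 2 * π * ξ|) ^ (-(1 - ε / 2))) ≤
        E * (w n * ((1 + |ξ|) ^ (-q) + (1 + |α * n + 2 * π * ξ|) ^ (-q))) := by
      intro n hn
      have hn1 : (0 : ℝ) < n := by exact_mod_cast (Finset.mem_Icc.1 hn).1
      have h1 : (n : ℝ) ≤ C₁ * ((1 + |ξ|) * (1 + |α * n + 2 * π * ξ|)) := by
        rw [hC₁, div_mul_eq_mul_div, le_div_iff₀ hα0]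
        have h2 : n * |α| ≤ |α * n + 2 * π * ξ| + 2 * π * |ξ| := by
          have := abs_sub (α * n + 2 * π * ξ) (2 * π * ξ)
          rw [add_sub_cancel_right, abs_mul, abs_of_pos hn1, abs_mul (2 * π), abs_of_pos (by positivity : 0 < 2 * π)] at this
          linarith
        have h3 : 0 ≤ |ξ| * |α * n + 2 * π * ξ| := by positivity
        nlinarith [abs_nonneg ξ, abs_nonneg (α * n + 2 * π * ξ), pi_pos, mul_nonneg pi_pos.le h3,
          mul_nonneg pi_pos.le (abs_nonneg (α * n + 2 * π * ξ))]
      have h2 := weight_le hε hε1 hn1 hA (hB n) hC₁0 h1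
      calc _ = ‖β n‖ ^ 2 * ((1 + |ξ|) ^ (-(2 * ε)) * (1 + |α * n + 2 * π * ξ|) ^ (-(1 - ε / 2))) := by ring
        _ ≤ ‖β n‖ ^ 2 * _ := mul_le_mul_of_nonneg_left h2 (sq_nonneg _)
        _ = _ := by simp only [hw, hq, hE]; ring
    have s9 : 0 ≤ (1 + |ξ|) ^ (-(2 * ε)) := rpow_nonneg (by positivity) _
    calc v ξ ^ 2 = ((1 + ξ ^ 2) ^ (-(ε / 2))) ^ 2 * ‖g ξ‖ ^ 2 := by simp only [hv]; rw [mul_pow]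
      _ ≤ (2 * (1 + |ξ|) ^ (-(2 * ε))) * (D ^ 2 * (K * ∑ n ∈ Finset.Icc 1 N,
        ‖β n‖ ^ 2 * (1 + |α * n + 2 * π * ξ|) ^ (-(1 - ε / 2)))) := by gcongr
      _ = 2 * D ^ 2 * K * ∑ n ∈ Finset.Icc 1 N, (1 + |ξ|) ^ (-(2 * ε)) *
        (‖β n‖ ^ 2 * (1 + |α * n + 2 * π * ξ|) ^ (-(1 - ε / 2))) := by
          rw [← Finset.mul_sum]; ring
      _ ≤ 2 * D ^ 2 * K * ∑ n ∈ Finset.Icc 1 N,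
          E * (w n * ((1 + |ξ|) ^ (-q) + (1 + |α * n + 2 * π * ξ|) ^ (-q))) := by
          exact mul_le_mul_of_nonneg_left (Finset.sum_le_sum s8) (by positivity)
      _ = _ := by rw [← Finset.mul_sum]; ring
  have huc : Continuous u := (continuous_one_add_sq_rpow _).mul (𝓕 Ψ).continuous.norm
  have hvc : Continuous v := (continuous_one_add_sq_rpow _).mul hgc.norm
  have hv2int : Integrable fun ξ => v ξ ^ 2 := by
    refine (hRint.const_mul (2 * D ^ 2 * K * E)).mono' (hvc.pow 2).aestronglyMeasurable
      (Eventually.of_forall fun ξ => ?_)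
    rw [Real.norm_eq_abs, abs_of_nonneg (sq_nonneg _)]
    exact hv2 ξ
  have hcs := (sq_integral_mul_le huc hvc (by simp_rw [hu2]; exact integrable_sobolev ε Ψ) hv2int).2
  simp_rw [hu2] at hcs
  have hle : ‖∫ ξ : ℝ, 𝓕 Ψ ξ * g ξ‖ ≤ ∫ ξ, u ξ * v ξ := by
    refine (norm_integral_le_integral_norm _).trans_eq (integral_congr_ae (Eventually.of_forall fun ξ => ?_))
    simp only [hu, hv, norm_mul]
    have : (1 + ξ ^ 2) ^ (ε / 2) * (1 + ξ ^ 2) ^ (-(ε / 2)) = 1 := by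
      rw [← rpow_add (by positivity)]; simp
    linear_combination (-(‖𝓕 Ψ ξ‖ * ‖g ξ‖)) * this
  have hsob : 0 ≤ sobolevNormSq ε Ψ := sobolevNormSq_nonneg ε Ψ
  have hW : 0 ≤ ∑ n ∈ Finset.Icc 1 N, w n := Finset.sum_nonneg fun n _ => hw0 n
  have hvint : ∫ ξ, v ξ ^ 2 ≤ 2 * D ^ 2 * K * E * ((∑ n ∈ Finset.Icc 1 N, w n) * (2 * I)) := by
    refine (integral_mono hv2int (hRint.const_mul (2 * D ^ 2 * K * E)) hv2).trans ?_
    rw [integral_const_mul]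
    gcongr
  rw [e1]
  calc ‖∫ ξ : ℝ, 𝓕 Ψ ξ * g ξ‖ ^ 2 ≤ (∫ ξ, u ξ * v ξ) ^ 2 := pow_le_pow_left₀ (norm_nonneg _) hle 2
    _ ≤ sobolevNormSq ε Ψ * ∫ ξ, v ξ ^ 2 := hcs
    _ ≤ sobolevNormSq ε Ψ * (2 * D ^ 2 * K * E * ((∑ n ∈ Finset.Icc 1 N, w n) * (2 * I))) := by gcongr
    _ = 4 * D ^ 2 * K * E * I * (∑ n ∈ Finset.Icc 1 N, w n) * sobolevNormSq ε Ψ := by ring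
    _ ≤ 4 * D ^ 2 * K * E * (I + 1) * (∑ n ∈ Finset.Icc 1 N, w n) * sobolevNormSq ε Ψ := by
      gcongr
      linarith

/-! ### Solutions of the wave equation on one string -/

/-- The sines `sin (λ_n y)`, `λ_n = n π / L`, are complete in `L²(0, L)`. -/
lemma eqOn_zero_of_sine_coeff {l r : ℝ} (hlr : l < r) {F : ℝ → ℂ} (hF : ContinuousOn F (Icc l r))
    (h : ∀ k : ℕ, 1 ≤ k → ∫ x in l..r, F x * (sin (k * π / (r - l) * (x - l)) : ℂ) = 0) :
    ∀ x ∈ Icc l r, F x = 0 := by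
  set L := r - l with hL
  have hL0 : 0 < L := sub_pos.2 hlr
  -- the odd extension of `F`
  set H : ℝ → ℂ := fun y => F (projIcc l r hlr.le (l + |y|)) with hH
  have hHc : Continuous H :=
    hF.comp_continuous (continuous_subtype_val.comp (continuous_projIcc.comp (by fun_prop)))
      fun y => (projIcc l r hlr.le (l + |y|)).2
  have hHF : ∀ y ∈ Icc 0 L, H y = F (l + y) := by
    intro y hy
    simp only [hH, abs_of_nonneg hy.1]
    rw [projIcc_of_mem hlr.le (show l + y ∈ Icc l r from ⟨by linarith [hy.1], by linarith [hy.2]⟩)]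
  set G : ℝ → ℂ := fun y => if y < 0 then -H y else H y with hG
  have hGm : Measurable G := Measurable.ite measurableSet_Iio hHc.measurable.neg hHc.measurable
  have hGn : ∀ y, ‖G y‖ = ‖H y‖ := by
    intro y; simp only [hG]; split_ifs <;> simp
  obtain ⟨B, hB⟩ := (isCompact_Icc : IsCompact (Icc (-L) L)).exists_bound_of_continuousOn hHc.continuousOn
  have hlt : -L < L := by linarith
  have hmem : MemLp G 2 (volume.restrict (Ioc (-L) L)) := by
    refine MemLp.of_bound hGm.aestronglyMeasurable B ?_
    filter_upwards [ae_restrict_mem measurableSet_Ioc] with y hy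
    rw [hGn]
    exact hB y ⟨hy.1.le, hy.2⟩
  have hii : ∀ {φ : ℝ → ℂ} (a b : ℝ), Continuous φ → IntervalIntegrable (fun y => φ y * H y) volume a b :=
    fun a b hφ => (hφ.mul hHc).intervalIntegrable a b
  -- all Fourier coefficients on `(-L, L)` are sine coefficients of `F`
  have hcoef : ∀ n : ℤ, fourierCoeffOn hlt G n = 0 := by
    intro n
    rw [fourierCoeffOn_eq_integral]
    have e0 : ∀ y : ℝ, (fourier (-n) (y : AddCircle (L - -L)) : ℂ) = cis (-(n * π / L * y)) := by
      intro y
      rw [fourier_coe_apply, cis]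
      congr 1
      have : (L : ℂ) ≠ 0 := by exact_mod_cast hL0.ne'
      push_cast
      field_simp
      ring
    have e1 : ∫ y in (-L)..L, (fourier (-n) (y : AddCircle (L - -L)) : ℂ) • G y =
        ∫ y in (0 : ℝ)..L, (cis (-(n * π / L * y)) - cis (n * π / L * y)) * H y := by
      simp_rw [e0, smul_eq_mul]
      have c1 : Continuous fun y : ℝ => cis (-(n * π / L * y)) := continuous_cis.comp (by fun_prop)
      have c2 : Continuous fun y : ℝ => cis (n * π / L * y) := continuous_cis.comp (by fun_prop)
      have a1 : ∫ y in (0 : ℝ)..L, cis (-(n * π / L * y)) * G y =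
          ∫ y in (0 : ℝ)..L, cis (-(n * π / L * y)) * H y := by
        refine intervalIntegral.integral_congr fun y hy => ?_
        rw [uIcc_of_le hL0.le] at hy
        simp only [hG, if_neg (not_lt.2 hy.1)]
      have a2' : ∀ᵐ y : ℝ, y ∈ uIoc (-L) 0 → cis (-(n * π / L * y)) * G y = -(cis (-(n * π / L * y)) * H y) := by
        have : ∀ᵐ y : ℝ, y ≠ 0 := by simp [ae_iff, measure_singleton]
        filter_upwards [this] with y hy0 hy
        rw [uIoc_of_le (by linarith)] at hy
        simp only [hG, if_pos (lt_of_le_of_ne hy.2 hy0)]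
        ring
      have a2 : ∫ y in (-L)..0, cis (-(n * π / L * y)) * G y =
          -∫ y in (0 : ℝ)..L, cis (n * π / L * y) * H y := by
        rw [intervalIntegral.integral_congr_ae a2', intervalIntegral.integral_neg]
        congr 1
        have := intervalIntegral.integral_comp_neg (a := 0) (b := L)
          (fun y => cis (-(n * π / L * y)) * H y)
        rw [neg_zero] at this
        rw [← this]
        refine intervalIntegral.integral_congr fun y _ => ?_
        simp only [hH, abs_neg, mul_neg, neg_neg]
      have i1 : IntervalIntegrable (fun y => cis (-(n * π / L * y)) * G y) volume (-L) 0 :=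
        ((hii (-L) 0 c1).neg).congr_ae (by
          rw [Filter.EventuallyEq, ae_restrict_iff' measurableSet_uIoc]
          filter_upwards [a2'] with y hy hm
          rw [hy hm]; rfl)
      have i2 : IntervalIntegrable (fun y => cis (-(n * π / L * y)) * G y) volume 0 L := by
        refine (hii 0 L c1).congr fun y hy => ?_
        rw [uIoc_of_le hL0.le] at hy
        simp only [hG, if_neg (not_lt.2 hy.1.le)]
      rw [← intervalIntegral.integral_add_adjacent_intervals i1 i2, a1, a2, neg_add_eq_sub,
        ← intervalIntegral.integral_sub (hii 0 L c1) (hii 0 L c2)]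
      refine intervalIntegral.integral_congr fun y _ => ?_
      ring
    have hs : ∀ k : ℕ, 1 ≤ k → ∫ y in (0 : ℝ)..L, (sin (k * π / L * y) : ℂ) * H y = 0 := by
      intro k hk
      rw [← h k hk]
      have := intervalIntegral.integral_comp_sub_right (a := l) (b := r)
        (fun y : ℝ => (sin (k * π / L * y) : ℂ) * H y) l
      rw [sub_self] at this
      rw [← this]
      refine intervalIntegral.integral_congr fun x hx => ?_
      rw [uIcc_of_le hlr.le] at hx
      rw [hHF (x - l) ⟨by linarith [hx.1], by linarith [hx.2]⟩, add_sub_cancel, mul_comm]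
    have e2 : ∀ θ : ℝ, cis (-θ) - cis θ = (-2 * Complex.I) * (sin θ : ℂ) := by
      intro θ
      rw [cis_eq, cis_eq, cos_neg, sin_neg]
      push_cast; ring
    rw [e1]
    simp_rw [e2, mul_assoc, intervalIntegral.integral_const_mul]
    have e3 : ∫ y in (0 : ℝ)..L, (sin (n * π / L * y) : ℂ) * H y = 0 := by
      rcases lt_trichotomy n 0 with hn | hn | hn
      · have := hs n.natAbs (by omega)
        have hc : ((n.natAbs : ℕ) : ℝ) = -(n : ℝ) := by
          rw [Nat.cast_natAbs, abs_of_neg hn]; push_cast; ring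
        rw [hc] at this
        have e4 : ∀ y : ℝ, (sin (-(n : ℝ) * π / L * y) : ℂ) * H y = -((sin (n * π / L * y) : ℂ) * H y) := by
          intro y
          rw [show -(n : ℝ) * π / L * y = -(n * π / L * y) by ring, sin_neg]
          push_cast; ring
        simp_rw [e4, intervalIntegral.integral_neg, neg_eq_zero] at this
        exact this
      · simp [hn]
      · have := hs n.natAbs (by omega)
        rwa [Nat.cast_natAbs, abs_of_pos hn] at this
    rw [e3]; simp
  have hz : ∫ y in (-L)..L, ‖G y‖ ^ 2 = 0 := by
    have := tsum_sq_fourierCoeffOn hlt hmem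
    simp only [hcoef, norm_zero] at this
    norm_num at this
    rcases this with h0 | h0
    · linarith
    · exact h0
  simp_rw [hGn] at hz
  have hz2 : ∀ y ∈ Ioo (-L) L, H y = 0 := by
    have hle : -L ≤ L := hlt.le
    rw [intervalIntegral.integral_of_le hle, ← integral_Icc_eq_integral_Ioc] at hz
    intro y hy
    by_contra hne
    have hpos := (intervalIntegral.integral_pos hlt (f := fun y => ‖H y‖ ^ 2) (hHc.norm.pow 2).continuousOn
      (fun _ _ => by positivity) ⟨y, ⟨hy.1.le, hy.2.le⟩, by positivity⟩)
    rw [intervalIntegral.integral_of_le hle, ← integral_Icc_eq_integral_Ioc] at hpos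
    linarith
  have hz3 : ∀ y ∈ Icc (-L) L, H y = 0 := by
    have : closure (Ioo (-L) L) = Icc (-L) L := closure_Ioo hlt.ne
    intro y hy
    rw [← this] at hy
    exact (isClosed_singleton.preimage hHc).closure_subset_iff.2 (fun z hz => hz2 z hz) hy
  intro x hx
  have := hz3 (x - l) ⟨by linarith [hx.1], by linarith [hx.2]⟩
  rwa [hHF (x - l) ⟨by linarith [hx.1], by linarith [hx.2]⟩, add_sub_cancel] at this

lemma integral_sin_mul_sin {l r : ℝ} (hlr : l < r) {n k : ℕ} (hnk : n ≠ k) :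
    ∫ x in l..r, sin (n * π / (r - l) * (x - l)) * sin (k * π / (r - l) * (x - l)) = 0 := by
  have hL : 0 < r - l := sub_pos.2 hlr
  set p := n * π / (r - l) with hp
  set q := k * π / (r - l) with hq
  have hr : ∀ j : ℕ, sin (j * π / (r - l) * (r - l)) = 0 := fun j => by
    rw [div_mul_cancel₀ _ hL.ne']; exact sin_nat_mul_pi j
  have hpq : q ^ 2 - p ^ 2 ≠ 0 := by
    have h0 : 0 ≤ p := by positivity
    have h1 : 0 ≤ q := by positivity
    intro h
    have h2 : q = p := by
      rcases mul_eq_zero.1 (show (q - p) * (q + p) = 0 by linarith) with h3 | h3 <;> linarith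
    rw [hp, hq, div_left_inj' hL.ne', mul_left_inj' pi_ne_zero] at h2
    exact hnk (by exact_mod_cast h2.symm)
  have hd : ∀ x ∈ uIcc l r, HasDerivAt (fun x => p * (cos (p * (x - l)) * sin (q * (x - l))) -
      q * (sin (p * (x - l)) * cos (q * (x - l))))
      ((q ^ 2 - p ^ 2) * (sin (p * (x - l)) * sin (q * (x - l)))) x := by
    intro x _
    have hp' : HasDerivAt (fun x : ℝ => p * (x - l)) p x := by
      simpa using ((hasDerivAt_id x).sub_const l).const_mul p
    have hq' : HasDerivAt (fun x : ℝ => q * (x - l)) q x := by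
      simpa using ((hasDerivAt_id x).sub_const l).const_mul q
    have hcs := hp'.cos.fun_mul hq'.sin
    have hsc := hp'.sin.fun_mul hq'.cos
    exact ((hcs.const_mul p).fun_sub (hsc.const_mul q)).congr_deriv (by ring)
  have := intervalIntegral.integral_eq_sub_of_hasDerivAt hd
    (Continuous.intervalIntegrable (by fun_prop) _ _)
  rw [intervalIntegral.integral_const_mul] at this
  simp only [sub_self, mul_zero, sin_zero, zero_mul] at this
  rw [hp, hq, hr, hr, ← hp, ← hq] at this
  simpa [hpq] using this

/-- A smooth cutoff function of the interval `(l, r)`, equal to `1` where `(x-l)(r-x) ≥ 2 η`. -/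
noncomputable def cutoff (l r η x : ℝ) : ℝ := smoothTransition ((x - l) * (r - x) / η - 1)

lemma cutoff_eq_zero {l r η x : ℝ} (hη : 0 < η) (h : (x - l) * (r - x) ≤ η) : cutoff l r η x = 0 :=
  smoothTransition.zero_of_nonpos (by rw [sub_nonpos, div_le_one hη]; exact h)

lemma cutoff_eq_one {l r η x : ℝ} (hη : 0 < η) (h : 2 * η ≤ (x - l) * (r - x)) : cutoff l r η x = 1 :=
  smoothTransition.one_of_one_le (by rw [le_sub_iff_add_le, le_div_iff₀ hη]; linarith)

lemma abs_cutoff_le (l r η x : ℝ) : |cutoff l r η x| ≤ 1 := by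
  rw [cutoff, abs_of_nonneg (smoothTransition.nonneg _)]
  exact smoothTransition.le_one _

lemma contDiff_cutoff (l r η : ℝ) {n : ℕ∞} : ContDiff ℝ n (cutoff l r η) :=
  smoothTransition.contDiff.comp (by fun_prop)

lemma exists_bound_deriv_smoothTransition : ∃ M : ℝ, 0 ≤ M ∧ ∀ y,
    |deriv smoothTransition y| ≤ M ∧ |deriv (deriv smoothTransition) y| ≤ M ∧
    (1 < y → deriv smoothTransition y = 0 ∧ deriv (deriv smoothTransition) y = 0) := by
  have hsmooth : ContDiff ℝ 2 smoothTransition := smoothTransition.contDiff (n := 2)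
  have h1 : ContDiff ℝ 1 (deriv smoothTransition) := hsmooth.iterate_deriv' 1 1
  have h2 : ContDiff ℝ 0 (deriv (deriv smoothTransition)) := hsmooth.iterate_deriv' 0 2
  have z0 : ∀ y < 0, deriv smoothTransition y = 0 := fun y hy => by
    have : smoothTransition =ᶠ[𝓝 y] fun _ => 0 := by
      filter_upwards [Iio_mem_nhds hy] with z hz using smoothTransition.zero_of_nonpos (le_of_lt hz)
    rw [this.deriv_eq, deriv_const]
  have z1 : ∀ y, 1 < y → deriv smoothTransition y = 0 := fun y hy => by
    have : smoothTransition =ᶠ[𝓝 y] fun _ => 1 := by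
      filter_upwards [Ioi_mem_nhds hy] with z hz using smoothTransition.one_of_one_le (le_of_lt hz)
    rw [this.deriv_eq, deriv_const]
  have w0 : ∀ y < 0, deriv (deriv smoothTransition) y = 0 := fun y hy => by
    have : deriv smoothTransition =ᶠ[𝓝 y] fun _ => 0 := by
      filter_upwards [Iio_mem_nhds hy] with z hz using z0 z hz
    rw [this.deriv_eq, deriv_const]
  have w1 : ∀ y, 1 < y → deriv (deriv smoothTransition) y = 0 := fun y hy => by
    have : deriv smoothTransition =ᶠ[𝓝 y] fun _ => 0 := by
      filter_upwards [Ioi_mem_nhds hy] with z hz using z1 z hz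
    rw [this.deriv_eq, deriv_const]
  obtain ⟨A, hA⟩ := (isCompact_Icc : IsCompact (Icc (0 : ℝ) 1)).exists_bound_of_continuousOn
    h1.continuous.continuousOn
  obtain ⟨B, hB⟩ := (isCompact_Icc : IsCompact (Icc (0 : ℝ) 1)).exists_bound_of_continuousOn
    h2.continuous.continuousOn
  refine ⟨max (max A B) 0, le_max_right _ _, fun y => ⟨?_, ?_, fun hy => ⟨z1 y hy, w1 y hy⟩⟩⟩
  · by_cases h : y ∈ Icc (0 : ℝ) 1
    · exact (hA y h).trans ((le_max_left _ _).trans (le_max_left _ _))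
    · rw [mem_Icc, not_and_or, not_le, not_le] at h
      rcases h with h | h
      · rw [z0 y h]; simp
      · rw [z1 y h]; simp
  · by_cases h : y ∈ Icc (0 : ℝ) 1
    · exact (hB y h).trans ((le_max_right _ _).trans (le_max_left _ _))
    · rw [mem_Icc, not_and_or, not_le, not_le] at h
      rcases h with h | h
      · rw [w0 y h]; simp
      · rw [w1 y h]; simp

/-- The function `x ↦ sin (k (x - l))`, cut off near the endpoints of `(l, r)`. -/
noncomputable def cutoffSin (l r η k x : ℝ) : ℂ := ((cutoff l r η x * sin (k * (x - l)) : ℝ) : ℂ)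

lemma contDiff_cutoffSin (l r η k : ℝ) {n : ℕ∞} : ContDiff ℝ n (cutoffSin l r η k) :=
  Complex.ofRealCLM.contDiff.comp ((contDiff_cutoff l r η).mul (contDiff_sin.comp (by fun_prop)))

lemma tsupport_cutoffSin_subset {l r η k : ℝ} (hlr : l < r) (hη : 0 < η) :
    tsupport (cutoffSin l r η k) ⊆ Ioo l r := by
  have h : tsupport (cutoffSin l r η k) ⊆ {x | η ≤ (x - l) * (r - x)} := by
    refine closure_minimal (fun x hx => ?_) (isClosed_le continuous_const (by fun_prop))
    by_contra h
    exact hx (by rw [cutoffSin, cutoff_eq_zero hη (not_le.1 h).le]; simp)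
  intro x hx
  have h1 : η ≤ (x - l) * (r - x) := h hx
  by_contra hx'
  rw [mem_Ioo, not_and_or, not_lt, not_lt] at hx'
  rcases hx' with h2 | h2
  · nlinarith
  · nlinarith

/-- `cutoffSin` as a test function. -/
noncomputable def cutoffSinTest {l r : ℝ} (hlr : l < r) (k : ℝ) {η : ℝ} (hη : 0 < η) : 𝓓(openInterval l r, ℂ) where
  toFun := cutoffSin l r η k
  contDiff' := contDiff_cutoffSin l r η k
  hasCompactSupport' := isCompact_Icc.of_isClosed_subset (isClosed_tsupport _)
    ((tsupport_cutoffSin_subset hlr hη).trans Ioo_subset_Icc_self)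
  tsupport_subset' := tsupport_cutoffSin_subset hlr hη

/-- The commutator of the cutoff with the operator `d²/dx² + k²`, applied to `sin (k (x - l))`. -/
noncomputable def cutoffError (l r η k x : ℝ) : ℝ :=
  (deriv (deriv smoothTransition) ((x - l) * (r - x) / η - 1) * ((l + r - 2 * x) / η) ^ 2 +
    deriv smoothTransition ((x - l) * (r - x) / η - 1) * (-2 / η)) * sin (k * (x - l)) +
  2 * k * (deriv smoothTransition ((x - l) * (r - x) / η - 1) * ((l + r - 2 * x) / η) *
    cos (k * (x - l)))

lemma iteratedDeriv_cutoffSin (l r η k x : ℝ) :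
    iteratedDeriv 2 (cutoffSin l r η k) x =
      -(k ^ 2 : ℝ) * cutoffSin l r η k x + (cutoffError l r η k x : ℂ) := by
  have hsmooth : ContDiff ℝ 2 smoothTransition := smoothTransition.contDiff (n := 2)
  have h1 : ContDiff ℝ 1 (deriv smoothTransition) := hsmooth.iterate_deriv' 1 1
  have hS : ∀ y, HasDerivAt smoothTransition (deriv smoothTransition y) y := fun y =>
    (hsmooth.differentiable (by norm_num) y).hasDerivAt
  have hS' : ∀ y, HasDerivAt (deriv smoothTransition) (deriv (deriv smoothTransition) y) y := fun y =>
    (h1.differentiable (by norm_num) y).hasDerivAt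
  have hp : ∀ x, HasDerivAt (fun x => (x - l) * (r - x) / η - 1) ((l + r - 2 * x) / η) x := by
    intro x
    have := ((((hasDerivAt_id x).sub_const l).fun_mul ((hasDerivAt_id x).const_sub r)).div_const η).sub_const 1
    exact this.congr_deriv (by simp only [id]; ring)
  have hp' : ∀ x, HasDerivAt (fun x => (l + r - 2 * x) / η) (-2 / η) x := by
    intro x
    have := ((((hasDerivAt_id x).const_mul 2).const_sub (l + r)).div_const η)
    exact this.congr_deriv (by simp)
  have hk : ∀ x, HasDerivAt (fun x => k * (x - l)) k x := fun x => by
    simpa using ((hasDerivAt_id x).sub_const l).const_mul k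
  have d1 : ∀ x, HasDerivAt (cutoffSin l r η k)
      ((deriv smoothTransition ((x - l) * (r - x) / η - 1) * ((l + r - 2 * x) / η) * sin (k * (x - l)) +
        smoothTransition ((x - l) * (r - x) / η - 1) * (cos (k * (x - l)) * k) : ℝ) : ℂ) x := by
    intro x
    have a := (hS _).comp x (hp x)
    exact (a.fun_mul (hk x).sin).ofReal_comp
  have d2 : HasDerivAt (fun x =>
      ((deriv smoothTransition ((x - l) * (r - x) / η - 1) * ((l + r - 2 * x) / η) * sin (k * (x - l)) +
        smoothTransition ((x - l) * (r - x) / η - 1) * (cos (k * (x - l)) * k) : ℝ) : ℂ))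
      ((-(k ^ 2) * (cutoff l r η x * sin (k * (x - l))) + cutoffError l r η k x : ℝ) : ℂ) x := by
    have a := (hS _).comp x (hp x)
    have b := (hS' _).comp x (hp x)
    have c := ((b.fun_mul (hp' x)).fun_mul (hk x).sin).fun_add (a.fun_mul ((hk x).cos.mul_const k))
    refine (HasDerivAt.congr_deriv c ?_).ofReal_comp
    simp only [cutoffError, cutoff, Function.comp]
    ring
  rw [iteratedDeriv_succ, iteratedDeriv_one]
  have : deriv (cutoffSin l r η k) = _ := funext fun x => (d1 x).deriv
  rw [this, d2.deriv, cutoffSin]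
  push_cast; ring

lemma abs_sin_le_boundary {l r k x : ℝ} (hlr : l < r) (hk : 0 ≤ k) (hs : sin (k * (r - l)) = 0)
    (hx : x ∈ Icc l r) : |sin (k * (x - l))| ≤ 2 * k / (r - l) * ((x - l) * (r - x)) := by
  have hL : 0 < r - l := sub_pos.2 hlr
  have h1 : 0 ≤ x - l := by linarith [hx.1]
  have h2 : 0 ≤ r - x := by linarith [hx.2]
  rw [div_mul_eq_mul_div, le_div_iff₀ hL]
  have b1 : |sin (k * (x - l))| ≤ k * (x - l) := by
    refine abs_sin_le_abs.trans_eq (abs_of_nonneg (by positivity))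
  have b2 : |sin (k * (x - l))| ≤ k * (r - x) := by
    have e : sin (k * (x - l)) = -(cos (k * (r - l)) * sin (k * (r - x))) := by
      rw [show k * (x - l) = k * (r - l) - k * (r - x) by ring, sin_sub, hs]; ring
    rw [e, abs_neg, abs_mul]
    calc _ ≤ 1 * |sin (k * (r - x))| := by gcongr; exact abs_cos_le_one _
      _ ≤ |k * (r - x)| := by rw [one_mul]; exact abs_sin_le_abs
      _ = _ := abs_of_nonneg (by positivity)
  rcases le_total (x - l) (r - x) with h | h
  · have := mul_nonneg (mul_nonneg hk h1) (show 0 ≤ 2 * (r - x) - (r - l) by linarith)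
    nlinarith
  · have := mul_nonneg (mul_nonneg hk h2) (show 0 ≤ 2 * (x - l) - (r - l) by linarith)
    nlinarith

lemma continuous_cutoffError (l r η k : ℝ) : Continuous (cutoffError l r η k) := by
  have hsmooth : ContDiff ℝ 2 smoothTransition := smoothTransition.contDiff (n := 2)
  have h1 : Continuous (deriv smoothTransition) := (hsmooth.iterate_deriv' 1 1).continuous
  have h2 : Continuous (deriv (deriv smoothTransition)) := (hsmooth.iterate_deriv' 0 2).continuous
  unfold cutoffError
  fun_prop

/-- The second derivative of the cutoff is of order `1 / η²`, but it comes with the factor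
`sin (k (x - l))`, which is `O(η)` where the cutoff is not constant. -/
lemma exists_cutoffError_bound {l r k : ℝ} (hlr : l < r) (hk : 0 ≤ k) (hs : sin (k * (r - l)) = 0) :
    ∃ K : ℝ, 0 ≤ K ∧ ∀ η, 0 < η → η ≤ 1 → ∀ x ∈ Icc l r, |cutoffError l r η k x| ≤ K / η ∧
      (2 * η < (x - l) * (r - x) → cutoffError l r η k x = 0) := by
  obtain ⟨M, hM, hb⟩ := exists_bound_deriv_smoothTransition
  have hL : 0 < r - l := sub_pos.2 hlr
  refine ⟨(M * (r - l) ^ 2 + M * 2) * (4 * k / (r - l)) + 2 * k * (M * (r - l)), by positivity,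
    fun η hη hη1 x hx => ?_⟩
  obtain ⟨b1, b2, b3⟩ := hb ((x - l) * (r - x) / η - 1)
  have hzero : 2 * η < (x - l) * (r - x) → cutoffError l r η k x = 0 := by
    intro h
    have : 1 < (x - l) * (r - x) / η - 1 := by
      rw [lt_sub_iff_add_lt, lt_div_iff₀ hη]; linarith
    rw [cutoffError, (b3 this).1, (b3 this).2]; ring
  refine ⟨?_, hzero⟩
  by_cases hreg : 2 * η < (x - l) * (r - x)
  · rw [hzero hreg, abs_zero]; positivity
  rw [not_lt] at hreg
  have hsin : |sin (k * (x - l))| ≤ 4 * k / (r - l) * η := by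
    refine (abs_sin_le_boundary hlr hk hs hx).trans ?_
    calc 2 * k / (r - l) * ((x - l) * (r - x)) ≤ 2 * k / (r - l) * (2 * η) := by gcongr
      _ = _ := by ring
  have hp1 : |(l + r - 2 * x) / η| ≤ (r - l) / η := by
    rw [abs_div, abs_of_pos hη]
    gcongr
    rw [abs_le]
    constructor <;> linarith [hx.1, hx.2]
  have hp2 : |((l + r - 2 * x) / η) ^ 2| ≤ ((r - l) / η) ^ 2 := by
    rw [abs_pow]; gcongr
  have hc : |cos (k * (x - l))| ≤ 1 := abs_cos_le_one _
  have hq : |-2 / η| = 2 / η := by rw [abs_div, abs_of_pos hη, abs_neg, abs_two]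
  have hη2 : 2 / η ≤ 2 / η ^ 2 := by
    gcongr; nlinarith
  calc |cutoffError l r η k x|
      ≤ (M * ((r - l) / η) ^ 2 + M * (2 / η)) * (4 * k / (r - l) * η) + 2 * k * (M * ((r - l) / η) * 1) := by
        rw [cutoffError]
        refine (abs_add_le _ _).trans ?_
        rw [abs_mul, abs_mul (2 * k), abs_of_nonneg (by positivity : 0 ≤ 2 * k), abs_mul (_ * _), abs_mul (deriv smoothTransition _)]
        gcongr
        refine (abs_add_le _ _).trans ?_
        rw [abs_mul, abs_mul, hq]
        gcongr
    _ ≤ (M * ((r - l) / η) ^ 2 + M * (2 / η ^ 2)) * (4 * k / (r - l) * η) + 2 * k * (M * ((r - l) / η) * 1) := by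
        gcongr
    _ = _ := by field_simp

/-- The commutator error is of order `1/η` on a set of measure `O(η)` at the endpoints, so it is
harmless against a function that is small there. -/
lemma exists_integral_cutoffError_le {l r k : ℝ} (hlr : l < r) (hk : 0 ≤ k)
    (hs : sin (k * (r - l)) = 0) : ∃ K : ℝ, 0 ≤ K ∧ ∀ η, 0 < η → η ≤ 1 → ∀ (w : ℝ → ℂ) (ω : ℝ),
      (∀ x ∈ Icc l r, x - l ≤ 4 * η / (r - l) ∨ r - x ≤ 4 * η / (r - l) → ‖w x‖ ≤ ω) →
      ‖∫ x in l..r, w x * (cutoffError l r η k x : ℂ)‖ ≤ K * ω := by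
  obtain ⟨K, hK, hb⟩ := exists_cutoffError_bound hlr hk hs
  have hL : 0 < r - l := sub_pos.2 hlr
  refine ⟨K * 8 / (r - l), by positivity, fun η hη hη1 w ω hw => ?_⟩
  set c := 4 * η / (r - l) with hc
  have hc0 : 0 < c := by positivity
  have hω : 0 ≤ ω := (norm_nonneg (w l)).trans (hw l ⟨le_rfl, hlr.le⟩ (Or.inl (by linarith)))
  set A : Set ℝ := Icc l (l + c) ∪ Icc (r - c) r with hA
  have hAm : volume.real A ≤ 2 * c := by
    refine (measureReal_union_le _ _).trans ?_
    rw [Real.volume_real_Icc_of_le (by linarith), Real.volume_real_Icc_of_le (by linarith)]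
    linarith
  have hAfin : volume A < ⊤ := by
    refine (measure_union_le _ _).trans_lt ?_
    simp [Real.volume_Icc]
  have hpt : ∀ x ∈ Icc l r, ‖w x * (cutoffError l r η k x : ℂ)‖ ≤ ω * (K / η) ∧
      (x ∉ A → w x * (cutoffError l r η k x : ℂ) = 0) := by
    intro x hx
    obtain ⟨b1, b2⟩ := hb η hη hη1 x hx
    have hfar : x ∉ A → cutoffError l r η k x = 0 := by
      intro hxA
      rw [hA, mem_union, not_or, mem_Icc, mem_Icc, not_and_or, not_and_or, not_le, not_le, not_le, not_le] at hxA
      have h1 : c < x - l := by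
        rcases hxA.1 with h | h <;> linarith [hx.1]
      have h2 : c < r - x := by
        rcases hxA.2 with h | h <;> linarith [hx.2]
      refine b2 ?_
      have h3 : c * (r - l) = 4 * η := div_mul_cancel₀ _ hL.ne'
      rcases le_total (x - l) (r - x) with h | h
      · nlinarith
      · nlinarith
    refine ⟨?_, fun h => by rw [hfar h]; simp⟩
    by_cases hreg : x ∈ A
    · rw [norm_mul, Complex.norm_real, Real.norm_eq_abs]
      have : ‖w x‖ ≤ ω := hw x hx (by
        rcases hreg with h | h
        · left; linarith [h.2]
        · right; linarith [h.1])
      gcongr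
    · rw [hfar hreg]; simp; positivity
  rw [intervalIntegral.integral_of_le hlr.le]
  have e : ∫ x in Ioc l r, w x * (cutoffError l r η k x : ℂ) =
      ∫ x in Ioc l r ∩ A, w x * (cutoffError l r η k x : ℂ) := by
    refine setIntegral_eq_of_subset_of_forall_sdiff_eq_zero measurableSet_Ioc inter_subset_left ?_
    intro x hx
    exact (hpt x (Ioc_subset_Icc_self hx.1)).2 fun h => hx.2 ⟨hx.1, h⟩
  rw [e]
  have hfin : volume (Ioc l r ∩ A) < ⊤ := (measure_mono inter_subset_right).trans_lt hAfin
  refine (norm_setIntegral_le_of_norm_le_const hfin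
    (fun x hx => (hpt x (Ioc_subset_Icc_self hx.1)).1)).trans ?_
  have hm : volume.real (Ioc l r ∩ A) ≤ 2 * c :=
    (measureReal_mono inter_subset_right hAfin.ne).trans hAm
  calc ω * (K / η) * volume.real (Ioc l r ∩ A) ≤ ω * (K / η) * (2 * c) := by gcongr
    _ = K * 8 / (r - l) * ω := by rw [hc]; field_simp; ring

lemma tendsto_integral_cutoffSin {l r k : ℝ} (hlr : l < r) {w : ℝ → ℂ} (hw : ContinuousOn w (Icc l r)) :
    Tendsto (fun η => ∫ x in l..r, w x * cutoffSin l r η k x) (𝓝[>] 0)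
      (𝓝 (∫ x in l..r, w x * (sin (k * (x - l)) : ℂ))) := by
  have hint : IntervalIntegrable w volume l r := by
    rw [← uIcc_of_le hlr.le] at hw
    exact hw.intervalIntegrable
  refine intervalIntegral.tendsto_integral_filter_of_dominated_convergence (fun x => ‖w x‖) ?_ ?_ ?_ ?_
  · refine Eventually.of_forall fun η => ?_
    exact hint.def'.aestronglyMeasurable.mul
      (contDiff_cutoffSin l r η k (n := 0)).continuous.aestronglyMeasurable
  · refine Eventually.of_forall fun η => Eventually.of_forall fun x _ => ?_
    rw [norm_mul, cutoffSin, Complex.norm_real, Real.norm_eq_abs, abs_mul]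
    calc ‖w x‖ * (|cutoff l r η x| * |sin (k * (x - l))|) ≤ ‖w x‖ * (1 * 1) := by
          gcongr
          · exact abs_cutoff_le l r η x
          · exact abs_sin_le_one _
      _ = ‖w x‖ := by ring
  · exact hint.norm
  · have hr : ∀ᵐ x : ℝ, x ≠ r := by simp [ae_iff, measure_singleton]
    filter_upwards [hr] with x hxr hx
    rw [uIoc_of_le hlr.le] at hx
    have hpos : 0 < (x - l) * (r - x) :=
      mul_pos (by linarith [hx.1]) (sub_pos.2 (lt_of_le_of_ne hx.2 hxr))
    refine tendsto_const_nhds.congr' ?_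
    filter_upwards [Ioc_mem_nhdsGT (by positivity : 0 < (x - l) * (r - x) / 2)] with η hη
    rw [cutoffSin, cutoff_eq_one hη.1 (by linarith [hη.2]), one_mul]

/-- The equation of one mode, `U'' = - k² U` for `U(t) = ∫ u(x,t) sin (k (x - l)) dx`, in solved
form. -/
lemma IsStringSolution.mode {l r k : ℝ} (hlr : l < r) (hk : 0 ≤ k) (hs : sin (k * (r - l)) = 0)
    {u : ℝ → ℝ → ℂ} {f g : ℝ → ℂ} (hf : Continuous f) (hg : Continuous g)
    (h : IsStringSolution l r u f g) (t : ℝ) :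
    k * ∫ x in l..r, u x t * (sin (k * (x - l)) : ℂ) =
      k * (∫ x in l..r, f x * (sin (k * (x - l)) : ℂ)) * cos (k * t) +
        (∫ x in l..r, g x * (sin (k * (x - l)) : ℂ)) * sin (k * t) := by
  obtain ⟨K, hK, hKb⟩ := exists_integral_cutoffError_le hlr hk hs
  have hL : 0 < r - l := sub_pos.2 hlr
  have hus : ∀ s, ContinuousOn (fun x => u x s) (Icc l r) := fun s =>
    h.continuousOn.comp (f := fun x : ℝ => (x, s)) (by fun_prop) fun x hx => ⟨hx, mem_univ _⟩
  have hui : ∀ s {φ : ℝ → ℂ}, Continuous φ → IntervalIntegrable (fun x => u x s * φ x) volume l r := by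
    intro s φ hφ
    have := (hus s).mul hφ.continuousOn
    rw [← uIcc_of_le hlr.le] at this
    exact this.intervalIntegrable
  have hce : ∀ η, Continuous fun x => (cutoffError l r η k x : ℂ) := fun η =>
    Complex.continuous_ofReal.comp (continuous_cutoffError l r η k)
  have hcs : ∀ η, Continuous (cutoffSin l r η k) := fun η => (contDiff_cutoffSin l r η k (n := 0)).continuous
  have h0 : ∀ φ : ℝ → ℂ, ∫ x in l..r, u x 0 * φ x = ∫ x in l..r, f x * φ x := by
    intro φ
    refine intervalIntegral.integral_congr_ae ?_
    have hr : ∀ᵐ x : ℝ, x ≠ r := by simp [ae_iff, measure_singleton]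
    filter_upwards [hr] with x hxr hx
    rw [uIoc_of_le hlr.le] at hx
    rw [h.position x ⟨hx.1, lt_of_le_of_ne hx.2 hxr⟩]
  have key : ∀ ω : ℝ, 0 < ω →
      ‖k * (∫ x in l..r, u x t * (sin (k * (x - l)) : ℂ)) -
      (k * (∫ x in l..r, f x * (sin (k * (x - l)) : ℂ)) * cos (k * t) +
        (∫ x in l..r, g x * (sin (k * (x - l)) : ℂ)) * sin (k * t))‖ ≤ K * ω * |t| := by
    intro ω hω
    -- `u` is uniformly small near the endpoints
    have huc : UniformContinuousOn (fun p : ℝ × ℝ => u p.1 p.2) (Icc l r ×ˢ Icc (-|t|) |t|) :=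
      (isCompact_Icc.prod isCompact_Icc).uniformContinuousOn_of_continuous
        (h.continuousOn.mono (prod_mono_right (subset_univ _)))
    obtain ⟨c, hc, hcu⟩ := Metric.uniformContinuousOn_iff.1 huc ω hω
    have hsmall : ∀ s ∈ Icc (-|t|) |t|, ∀ x ∈ Icc l r, x - l < c ∨ r - x < c → ‖u x s‖ ≤ ω := by
      intro s hs' x hx hxc
      rcases hxc with hxc | hxc
      · have := hcu (x, s) ⟨hx, hs'⟩ (l, s) ⟨⟨le_rfl, hlr.le⟩, hs'⟩ (by
          rw [Prod.dist_eq, dist_self, max_eq_left dist_nonneg, Real.dist_eq, abs_of_nonneg (by linarith [hx.1])]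
          exact hxc)
        simp only [h.left s, dist_zero_right] at this
        exact this.le
      · have := hcu (x, s) ⟨hx, hs'⟩ (r, s) ⟨⟨hlr.le, le_rfl⟩, hs'⟩ (by
          rw [Prod.dist_eq, dist_self, max_eq_left dist_nonneg, Real.dist_eq, abs_sub_comm, abs_of_nonneg (by linarith [hx.2])]
          exact hxc)
        simp only [h.right s, dist_zero_right] at this
        exact this.le
    have hη : ∀ᶠ η in 𝓝[>] (0 : ℝ), ‖k * (∫ x in l..r, u x t * cutoffSin l r η k x) -
        (k * (∫ x in l..r, f x * cutoffSin l r η k x) * cos (k * t) +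
        (∫ x in l..r, g x * cutoffSin l r η k x) * sin (k * t))‖ ≤ K * ω * |t| := by
      filter_upwards [Ioo_mem_nhdsGT (show 0 < min 1 (c * (r - l) / 4) by positivity)] with η hη
      have hη0 : 0 < η := hη.1
      have hη1 : η ≤ 1 := (hη.2.trans_le (min_le_left _ _)).le
      have hηc : 4 * η / (r - l) < c := by
        rw [div_lt_iff₀ hL]; linarith [hη.2.trans_le (min_le_right _ _)]
      obtain ⟨v, hv1, hv2, hv3⟩ := h.wave (cutoffSinTest hlr k hη0)
      change ∀ t, HasDerivAt (fun s => ∫ x in l..r, u x s * cutoffSin l r η k x) (v t) t at hv1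
      change ∀ t, HasDerivAt v (∫ x in l..r, u x t * iteratedDeriv 2 (cutoffSin l r η k) x) t at hv2
      change v 0 = ∫ x in l..r, g x * cutoffSin l r η k x at hv3
      set U : ℝ → ℂ := fun s => ∫ x in l..r, u x s * cutoffSin l r η k x with hU
      set R : ℝ → ℂ := fun s => ∫ x in l..r, u x s * (cutoffError l r η k x : ℂ) with hR
      have hv2' : ∀ s, HasDerivAt v (-(k ^ 2 : ℝ) * U s + R s) s := by
        intro s
        convert hv2 s using 1
        simp only [hU, hR]
        rw [← intervalIntegral.integral_const_mul, ← intervalIntegral.integral_add]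
        · refine intervalIntegral.integral_congr fun x _ => ?_
          simp only [iteratedDeriv_cutoffSin]
          ring
        · exact (hui s (hcs η)).const_mul _
        · exact hui s (hce η)
      have hRb : ∀ s ∈ Icc (-|t|) |t|, ‖R s‖ ≤ K * ω := by
        intro s hs'
        refine hKb η hη0 hη1 (fun x => u x s) ω fun x hx hxc => hsmall s hs' x hx ?_
        exact hxc.imp (fun h => h.trans_lt hηc) fun h => h.trans_lt hηc
      -- Duhamel's formula for the approximate equation `U'' = -k² U + R`
      set F : ℝ → ℂ := fun s => k * (U s * (cos (k * (t - s)) : ℂ)) + v s * (sin (k * (t - s)) : ℂ) with hF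
      have hFd : ∀ s, HasDerivAt F (R s * (sin (k * (t - s)) : ℂ)) s := by
        intro s
        have hθ : HasDerivAt (fun s => k * (t - s)) (-k) s := by
          simpa using ((hasDerivAt_id s).const_sub t).const_mul k
        have a := ((hv1 s).fun_mul hθ.cos.ofReal_comp).const_mul (k : ℂ)
        have b := (hv2' s).fun_mul hθ.sin.ofReal_comp
        refine (a.fun_add b).congr_deriv ?_
        push_cast; ring
      have hFle := Convex.norm_image_sub_le_of_norm_hasDerivWithin_le (f := F) (s := Icc (-|t|) |t|)
        (C := K * ω) (x := 0) (y := t) (fun s _ => (hFd s).hasDerivWithinAt)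
        (fun s hs' => by
          rw [norm_mul, Complex.norm_real, Real.norm_eq_abs]
          calc ‖R s‖ * |sin (k * (t - s))| ≤ K * ω * 1 := by
                gcongr
                · exact hRb s hs'
                · exact abs_sin_le_one _
            _ = K * ω := mul_one _)
        (convex_Icc _ _) ⟨by simp, by simp⟩ ⟨neg_abs_le t, le_abs_self t⟩
      rw [sub_zero, Real.norm_eq_abs] at hFle
      have hU0 : U 0 = ∫ x in l..r, f x * cutoffSin l r η k x := h0 _
      have e : F t - F 0 = k * U t - (k * U 0 * cos (k * t) + v 0 * sin (k * t)) := by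
        simp only [hF, sub_self, mul_zero, cos_zero, sin_zero, sub_zero, Complex.ofReal_one,
          Complex.ofReal_zero]
        ring
      rw [e, hU0, hv3] at hFle
      exact hFle
    refine le_of_tendsto ?_ hη
    refine Tendsto.norm (Tendsto.sub ?_ (Tendsto.add ?_ ?_))
    · exact (tendsto_integral_cutoffSin hlr (hus t)).const_mul _
    · exact ((tendsto_integral_cutoffSin hlr hf.continuousOn).const_mul _).mul_const _
    · exact (tendsto_integral_cutoffSin hlr hg.continuousOn).mul_const _
  have hlim : Tendsto (fun ω : ℝ => K * ω * |t|) (𝓝[>] 0) (𝓝 0) := by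
    have : Tendsto (fun ω : ℝ => K * ω * |t|) (𝓝 0) (𝓝 (K * 0 * |t|)) :=
      (Continuous.tendsto (by fun_prop) 0)
    rw [mul_zero, zero_mul] at this
    exact this.mono_left nhdsWithin_le_nhds
  have := ge_of_tendsto hlim (eventually_mem_nhdsWithin.mono fun ω hω => key ω hω)
  exact sub_eq_zero.1 (norm_le_zero_iff.1 this)

/-- With finite sine sums as data, the solution is the finite sum given by separation of
variables. -/
theorem IsStringSolution.eq_sum {l r : ℝ} (hlr : l < r) {N : ℕ} {α β : ℕ → ℂ}
    {u : ℝ → ℝ → ℂ} {f g : ℝ → ℂ}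
    (hf : ∀ x, f x = ∑ n ∈ Finset.Icc 1 N, α n * (sin (n * π / (r - l) * (x - l)) : ℂ))
    (hg : ∀ x, g x = ∑ n ∈ Finset.Icc 1 N,
      (n * π / (r - l) : ℝ) * β n * (sin (n * π / (r - l) * (x - l)) : ℂ))
    (h : IsStringSolution l r u f g) (t : ℝ) : ∀ x ∈ Icc l r,
    u x t = ∑ n ∈ Finset.Icc 1 N, (α n * cos (n * π / (r - l) * t) +
      β n * sin (n * π / (r - l) * t)) * (sin (n * π / (r - l) * (x - l)) : ℂ) := by
  have hL : 0 < r - l := sub_pos.2 hlr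
  set k : ℕ → ℝ := fun n => n * π / (r - l) with hk
  set e : ℕ → ℝ → ℂ := fun n x => (sin (k n * (x - l)) : ℂ) with he
  have hec : ∀ n, Continuous (e n) := fun n => by simp only [he]; fun_prop
  have hfc : Continuous f := by
    rw [show f = _ from funext hf]; fun_prop
  have hgc : Continuous g := by
    rw [show g = _ from funext hg]; fun_prop
  have hint : ∀ (m : ℕ) (c : ℕ → ℂ), ∫ x in l..r, (∑ n ∈ Finset.Icc 1 N, c n * e n x) * e m x =
      ∑ n ∈ Finset.Icc 1 N, c n * ∫ x in l..r, e n x * e m x := by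
    intro m c
    have hcont : ∀ n, Continuous fun x => c n * (e n x * e m x) := fun n =>
      continuous_const.mul ((hec n).mul (hec m))
    simp_rw [Finset.sum_mul, mul_assoc]
    rw [intervalIntegral.integral_finsetSum fun n _ => (hcont n).intervalIntegrable _ _]
    simp_rw [intervalIntegral.integral_const_mul]
  have horth : ∀ n m, n ≠ m → ∫ x in l..r, e n x * e m x = 0 := by
    intro n m hnm
    have h2 : ∫ x in l..r, e n x * e m x =
        ((∫ x in l..r, sin (k n * (x - l)) * sin (k m * (x - l)) : ℝ) : ℂ) := by
      rw [← intervalIntegral.integral_ofReal]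
      refine intervalIntegral.integral_congr fun x _ => ?_
      simp only [he]; push_cast; rfl
    rw [h2, integral_sin_mul_sin hlr hnm, Complex.ofReal_zero]
  set w : ℝ → ℂ := fun x => ∑ n ∈ Finset.Icc 1 N, (α n * cos (k n * t) + β n * sin (k n * t)) * e n x with hw
  have hwc : Continuous w := by simp only [hw]; fun_prop
  have huc : ContinuousOn (fun x => u x t) (Icc l r) :=
    h.continuousOn.comp (f := fun x : ℝ => (x, t)) (by fun_prop) fun x hx => ⟨hx, mem_univ _⟩
  have hz := eqOn_zero_of_sine_coeff hlr (F := fun x => u x t - w x) (huc.sub hwc.continuousOn) ?_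
  · intro x hx
    exact sub_eq_zero.1 (hz x hx)
  intro m hm
  have hkm : 0 < k m := by
    have : (0 : ℝ) < m := by exact_mod_cast hm
    simp only [hk]; positivity
  have hs : sin (k m * (r - l)) = 0 := by
    simp only [hk]; rw [div_mul_cancel₀ _ hL.ne']; exact sin_nat_mul_pi m
  have hmode := IsStringSolution.mode hlr hkm.le hs hfc hgc h t
  have iu : IntervalIntegrable (fun x => u x t * e m x) volume l r := by
    have := huc.mul (hec m).continuousOn
    rw [← uIcc_of_le hlr.le] at this
    exact this.intervalIntegrable
  change ∫ x in l..r, (u x t - w x) * e m x = 0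
  simp_rw [sub_mul]
  have iw : IntervalIntegrable (fun x => w x * e m x) volume l r :=
    (hwc.mul (hec m)).intervalIntegrable _ _
  rw [intervalIntegral.integral_sub iu iw, sub_eq_zero]
  have hkm' : (k m : ℂ) ≠ 0 := by exact_mod_cast hkm.ne'
  refine mul_left_cancel₀ hkm' (hmode.trans ?_)
  change k m * (∫ x in l..r, f x * e m x) * _ + (∫ x in l..r, g x * e m x) * _ = _
  have hf' : ∀ x, f x = ∑ n ∈ Finset.Icc 1 N, α n * e n x := hf
  have hg' : ∀ x, g x = ∑ n ∈ Finset.Icc 1 N, (k n * β n) * e n x := hg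
  simp_rw [hf', hg', hw]
  rw [hint, hint, hint, Finset.mul_sum, Finset.mul_sum, Finset.sum_mul, Finset.sum_mul,
    ← Finset.sum_add_distrib]
  refine Finset.sum_congr rfl fun n _ => ?_
  by_cases hnm : n = m
  · subst hnm; ring
  · rw [horth n m hnm]; ring

/-- The derivative of a finite sine sum on `(l, r)` has the expected one-sided limits. -/
lemma tendsto_deriv_of_eq_sum {l r : ℝ} (hlr : l < r) {N : ℕ} {k : ℕ → ℝ} {c : ℕ → ℂ} {v : ℝ → ℂ}
    (h : ∀ x ∈ Icc l r, v x = ∑ n ∈ Finset.Icc 1 N, c n * (sin (k n * (x - l)) : ℂ)) :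
    Tendsto (deriv v) (𝓝[<] r) (𝓝 (∑ n ∈ Finset.Icc 1 N, c n * ((k n * cos (k n * (r - l)) : ℝ) : ℂ))) ∧
    Tendsto (deriv v) (𝓝[>] l) (𝓝 (∑ n ∈ Finset.Icc 1 N, c n * (k n : ℂ))) := by
  set d : ℝ → ℂ := fun x => ∑ n ∈ Finset.Icc 1 N, c n * ((k n * cos (k n * (x - l)) : ℝ) : ℂ) with hd
  have hdc : Continuous d := by simp only [hd]; fun_prop
  have hder : ∀ x ∈ Ioo l r, deriv v x = d x := by
    intro x hx
    have e : v =ᶠ[𝓝 x] fun x => ∑ n ∈ Finset.Icc 1 N, c n * (sin (k n * (x - l)) : ℂ) := by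
      filter_upwards [Icc_mem_nhds hx.1 hx.2] with y hy using h y hy
    rw [e.deriv_eq]
    refine HasDerivAt.deriv (HasDerivAt.fun_sum fun n _ => ?_)
    have hk : HasDerivAt (fun x => k n * (x - l)) (k n) x := by
      simpa using ((hasDerivAt_id x).sub_const l).const_mul (k n)
    refine ((hk.sin.ofReal_comp).const_mul (c n)).congr_deriv ?_
    push_cast; ring
  constructor
  · refine (hdc.tendsto r).mono_left nhdsWithin_le_nhds |>.congr' ?_
    filter_upwards [Ioo_mem_nhdsLT hlr] with x hx using (hder x hx).symm
  · have e : d l = ∑ n ∈ Finset.Icc 1 N, c n * (k n : ℂ) := by simp [hd]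
    rw [← e]
    refine (hdc.tendsto l).mono_left nhdsWithin_le_nhds |>.congr' ?_
    filter_upwards [Ioo_mem_nhdsGT hlr] with x hx using (hder x hx).symm

/-- Elements of the span of finitely many functions, with the index set an initial segment. -/
lemma exists_coeff_of_mem_span {X : ℝ} {e : ℕ → ℝ → ℂ} {f : ℝ → ℂ}
    (hf : f ∈ Submodule.span ℂ {f | ∃ n : ℕ, 1 ≤ n ∧ (n : ℝ) ≤ X ∧ f = e n}) :
    ∃ c : ℕ → ℂ, ∀ x, f x = ∑ n ∈ Finset.Icc 1 ⌊X⌋₊, c n * e n x := by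
  induction hf using Submodule.span_induction with
  | mem f hf =>
    obtain ⟨n, hn, hnX, rfl⟩ := hf
    have hmem : n ∈ Finset.Icc 1 ⌊X⌋₊ := Finset.mem_Icc.2 ⟨hn, Nat.le_floor hnX⟩
    refine ⟨fun m => if m = n then 1 else 0, fun x => ?_⟩
    rw [Finset.sum_eq_single_of_mem n hmem]
    · simp
    · intro m _ hmn; simp [hmn]
  | zero => exact ⟨0, fun x => by simp⟩
  | add f g _ _ hf hg =>
    obtain ⟨c, hc⟩ := hf
    obtain ⟨d, hd⟩ := hg
    refine ⟨c + d, fun x => ?_⟩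
    simp only [Pi.add_apply, hc, hd, add_mul, Finset.sum_add_distrib]
  | smul z f _ hf =>
    obtain ⟨c, hc⟩ := hf
    refine ⟨z • c, fun x => ?_⟩
    simp only [Pi.smul_apply, hc, smul_eq_mul, Finset.mul_sum, mul_assoc]

/-! ### Observability of the coefficients of two strings -/

lemma sum_modes (N : ℕ) (f : ℤ → ℂ) :
    ∑ n ∈ modes N, f n = ∑ n ∈ Finset.Icc 1 N, f n + ∑ n ∈ Finset.Icc 1 N, f (-n) := by
  have e : modes N = Finset.Icc (1 : ℤ) N ∪ Finset.Icc (-(N : ℤ)) (-1) := by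
    ext n
    rw [mem_modes, Finset.mem_union, Finset.mem_Icc, Finset.mem_Icc]
    omega
  have hd : Disjoint (Finset.Icc (1 : ℤ) N) (Finset.Icc (-(N : ℤ)) (-1)) := by
    rw [Finset.disjoint_left]
    intro n h1 h2
    rw [Finset.mem_Icc] at h1 h2
    omega
  rw [e, Finset.sum_union hd, ← sum_Icc_int N f, ← sum_Icc_int N fun n => f (-n)]
  congr 1
  refine Finset.sum_nbij' (fun n => -n) (fun n => -n) ?_ ?_ ?_ ?_ ?_
  · intro n hn; rw [Finset.mem_Icc] at hn ⊢; omega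
  · intro n hn; rw [Finset.mem_Icc] at hn ⊢; omega
  · intros; simp
  · intros; simp
  · intros; simp

/-- The coefficients of `cis (n θ)`, `n ∈ ℤ`, in `∑ w_n (A_n cos (n θ) + B_n sin (n θ))`. -/
noncomputable def phasor (w A B : ℕ → ℂ) (n : ℤ) : ℂ :=
  w n.natAbs * (A n.natAbs - n.sign * Complex.I * B n.natAbs) / 2

lemma phasor_natCast (w A B : ℕ → ℂ) {n : ℕ} (hn : 1 ≤ n) :
    phasor w A B n = w n * (A n - Complex.I * B n) / 2 := by
  have : (n : ℤ).sign = 1 := Int.sign_eq_one_of_pos (by omega)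
  simp [phasor, this]

lemma phasor_neg_natCast (w A B : ℕ → ℂ) {n : ℕ} (hn : 1 ≤ n) :
    phasor w A B (-n) = w n * (A n + Complex.I * B n) / 2 := by
  have : (n : ℤ).sign = 1 := Int.sign_eq_one_of_pos (by omega)
  simp [phasor, this]

lemma sum_phasor_cis (w A B : ℕ → ℂ) (N : ℕ) (θ : ℝ) :
    ∑ n ∈ modes N, phasor w A B n * cis (n * θ) =
      ∑ n ∈ Finset.Icc 1 N, w n * (A n * cos (n * θ) + B n * sin (n * θ)) := by
  rw [sum_modes, ← Finset.sum_add_distrib]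
  refine Finset.sum_congr rfl fun n hn => ?_
  have h1 := (Finset.mem_Icc.1 hn).1
  rw [phasor_natCast w A B h1, phasor_neg_natCast w A B h1]
  push_cast
  rw [neg_mul, cis_eq, cis_eq, cos_neg, sin_neg]
  push_cast
  ring_nf
  rw [Complex.I_sq]
  ring

lemma sq_norm_phasor_add (w A B : ℕ → ℂ) {n : ℕ} (hn : 1 ≤ n) :
    ‖phasor w A B n‖ ^ 2 + ‖phasor w A B (-n)‖ ^ 2 = ‖w n‖ ^ 2 * (‖A n‖ ^ 2 + ‖B n‖ ^ 2) / 2 := by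
  rw [phasor_natCast w A B hn, phasor_neg_natCast w A B hn]
  have h := parallelogram_law_with_norm ℝ (A n) (Complex.I * B n)
  rw [norm_mul Complex.I, Complex.norm_I, one_mul] at h
  simp only [norm_div, norm_mul, div_pow, mul_pow, Complex.norm_ofNat]
  linear_combination (‖w n‖ ^ 2 / 4) * h

set_option maxHeartbeats 800000 in
/-- The boundary observation controls the Fourier coefficients, with a loss of `s` in the weight,
and without loss the one combination of them that enters in the boundary terms at `a`. -/
theorem exists_observability {a c s T : ℝ} (ha : a ∈ Ioo (0 : ℝ) 1) (hs : 0 < s) (hc : 0 < c)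
    (hd : ∀ n m : ℤ, 1 ≤ n → 1 ≤ m → c * (n : ℝ) ^ (-(1 + s)) ≤ |n / a - m / (1 - a)| ∧
      c * (m : ℝ) ^ (-(1 + s)) ≤ |n / a - m / (1 - a)|)
    (hT : 2 * max a (1 - a) < T) (t' : ℝ) : ∃ C : ℝ, 0 < C ∧
    ∀ {δ : ℝ} {J : ℤ} {N M : ℕ} (A B A' B' : ℕ → ℂ), 0 < δ → J * δ = T →
      N / a ≤ 1 / δ - 1 / 4 * min (1 / a) (1 / (1 - a)) →
      M / (1 - a) ≤ 1 / δ - 1 / 4 * min (1 / a) (1 / (1 - a)) → ∀ P : ℝ → ℂ,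
      (∀ t, P t = ∑ n ∈ Finset.Icc 1 N, (-1) ^ n * (n * π / a : ℝ) *
          (A n * cos (n * π / a * t) + B n * sin (n * π / a * t)) -
        ∑ m ∈ Finset.Icc 1 M, (m * π / (1 - a) : ℝ) *
          (A' m * cos (m * π / (1 - a) * t) + B' m * sin (m * π / (1 - a) * t))) →
      (∑ n ∈ Finset.Icc 1 N, (n : ℝ) ^ (-(2 * s)) * (‖A n‖ ^ 2 + ‖B n‖ ^ 2) +
        ∑ m ∈ Finset.Icc 1 M, (m : ℝ) ^ (-(2 * s)) * (‖A' m‖ ^ 2 + ‖B' m‖ ^ 2)) +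
        ‖∑ n ∈ Finset.Icc 1 N, (-1) ^ n * B n - ∑ m ∈ Finset.Icc 1 M, B' m‖ ^ 2 ≤
      C * (δ * ∑ j ∈ Finset.Icc (-J) J, ‖P (t' + j * δ)‖ ^ 2) := by
  have ha0 : 0 < a := ha.1
  have ha1 : 0 < 1 - a := sub_pos.2 ha.2
  set κ := min (1 / a) (1 / (1 - a)) with hκ
  have hκ1 : 1 ≤ κ := le_min ((one_le_div ha0).2 ha.2.le) ((one_le_div ha1).2 (by linarith))
  have hκ0 : 0 < κ := by linarith
  have hκa : a * κ ≤ 1 := by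
    have : κ ≤ 1 / a := min_le_left _ _
    rw [le_div_iff₀ ha0] at this; linarith
  have hκa' : (1 - a) * κ ≤ 1 := by
    have : κ ≤ 1 / (1 - a) := min_le_right _ _
    rw [le_div_iff₀ ha1] at this; linarith
  -- time is measured in units in which the smaller one of the two gaps becomes `π`
  set α := π / (a * κ) with hα
  set β := π / ((1 - a) * κ) with hβ
  have hαπ : π ≤ α := by
    rw [hα, le_div_iff₀ (by positivity)]; nlinarith [pi_pos]
  have hβπ : π ≤ β := by
    rw [hβ, le_div_iff₀ (by positivity)]; nlinarith [pi_pos]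
  have hdiff : ∀ n m : ℤ, |α * n - β * m| = π / κ * |n / a - m / (1 - a)| := by
    intro n m
    have e : α * n - β * m = π / κ * (n / a - m / (1 - a)) := by
      rw [hα, hβ]; field_simp
    rw [e, abs_mul, abs_of_pos (by positivity : 0 < π / κ)]
  have hτ : 2 < κ * T := by
    have : 1 ≤ κ * max a (1 - a) := by
      rcases le_total (1 / a) (1 / (1 - a)) with h | h
      · rw [hκ, min_eq_left h]
        calc 1 = 1 / a * a := (one_div_mul_cancel ha0.ne').symm
          _ ≤ _ := by gcongr; exact le_max_left _ _
      · rw [hκ, min_eq_right h]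
        calc 1 = 1 / (1 - a) * (1 - a) := (one_div_mul_cancel ha1.ne').symm
          _ ≤ _ := by gcongr; exact le_max_right _ _
    nlinarith
  set c' := min (π / κ * c) (π / 2) with hc'
  have hc'0 : 0 < c' := lt_min (by positivity) (by positivity)
  have hd' : ∀ n m : ℤ, 1 ≤ n → 1 ≤ m → c' * (n : ℝ) ^ (-(1 + s)) ≤ |α * n - β * m| ∧
      c' * (m : ℝ) ^ (-(1 + s)) ≤ |α * n - β * m| := by
    intro n m hn hm
    have hn0 : (0 : ℝ) < n := by exact_mod_cast hn
    have hm0 : (0 : ℝ) < m := by exact_mod_cast hm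
    rw [hdiff]
    have key : ∀ z : ℝ, 0 ≤ z → c * z ≤ |n / a - m / (1 - a)| →
        c' * z ≤ π / κ * |n / a - m / (1 - a)| := by
      intro z hz h
      calc c' * z ≤ π / κ * c * z := by gcongr; exact min_le_left _ _
        _ = π / κ * (c * z) := by ring
        _ ≤ _ := by gcongr
    exact ⟨key _ (rpow_nonneg hn0.le _) (hd n m hn hm).1, key _ (rpow_nonneg hm0.le _) (hd n m hn hm).2⟩
  have hne : ∀ n m : ℤ, 1 ≤ n → 1 ≤ m → α * n ≠ β * m := by
    intro n m hn hm h
    have h1 := (hd' n m hn hm).1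
    have hn0 : (0 : ℝ) < n := by exact_mod_cast hn
    rw [h, sub_self, abs_zero] at h1
    have : 0 < c' * (n : ℝ) ^ (-(1 + s)) := mul_pos hc'0 (rpow_pos_of_pos hn0 _)
    linarith
  obtain ⟨C, hC, hmain⟩ := pairBound_shifted hαπ hβπ hne hτ (κ * t')
  refine ⟨(2 * C / c' ^ 2 + 96 * C) * κ, by positivity, ?_⟩
  intro δ J N M A B A' B' hδ hJ hN hM P hP
  set w : ℕ → ℂ := fun n => (-1) ^ n * (n * π / a : ℝ) with hw
  set w' : ℕ → ℂ := fun m => -(m * π / (1 - a) : ℝ) with hw'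
  set O := κ * δ * ∑ j ∈ Finset.Icc (-J) J, ‖P (t' + j * δ)‖ ^ 2 with hO
  have hbound : ∀ {b : ℝ} {K : ℕ}, 0 < b → K / b ≤ 1 / δ - 1 / 4 * κ →
      π / (b * κ) * K ≤ π / (κ * δ) - π / 4 := by
    intro b K hb h
    have := mul_le_mul_of_nonneg_left h (by positivity : 0 ≤ π / κ)
    calc π / (b * κ) * K = π / κ * (K / b) := by field_simp
      _ ≤ _ := this
      _ = _ := by field_simp
  have hPO : ∀ j : ℤ, P (t' + j * δ) =
      ∑ n ∈ modes N, phasor w A B n * cis (α * n * (κ * t' + j * (κ * δ))) +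
        ∑ m ∈ modes M, phasor w' A' B' m * cis (β * m * (κ * t' + j * (κ * δ))) := by
    intro j
    have e1 : ∀ n : ℤ, α * n * (κ * t' + j * (κ * δ)) = n * (π / a * (t' + j * δ)) := by
      intro n; rw [hα]; field_simp
    have e2 : ∀ n : ℤ, β * n * (κ * t' + j * (κ * δ)) = n * (π / (1 - a) * (t' + j * δ)) := by
      intro n; rw [hβ]; field_simp
    simp_rw [e1, e2]
    rw [sum_phasor_cis, sum_phasor_cis, hP, sub_eq_add_neg, ← Finset.sum_neg_distrib]
    congr 1
    · refine Finset.sum_congr rfl fun n _ => ?_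
      rw [show (n : ℝ) * (π / a * (t' + j * δ)) = n * π / a * (t' + j * δ) by ring]
    · refine Finset.sum_congr rfl fun n _ => ?_
      rw [show (n : ℝ) * (π / (1 - a) * (t' + j * δ)) = n * π / (1 - a) * (t' + j * δ) by ring]
      simp only [hw']; ring
  obtain ⟨p1, p2⟩ := hmain (phasor w A B) (phasor w' A' B') (by positivity : 0 < κ * δ)
    (by rw [← hJ]; ring) (hbound ha0 hN) (hbound ha1 hM) O (by rw [hO]; simp_rw [hPO])
  have w1 := p1.weighted hc'0 (min_le_right _ _) hs hd'
  have w2 := p2.weighted hc'0 (min_le_right _ _) hs hd'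
  have s1 := p1.pairing hαπ hβπ
  have s2 := p2.pairing hαπ hβπ
  rw [sum_Icc_int N fun n : ℤ => ((n : ℝ) ^ (-(1 + s))) ^ 2 * ‖phasor w A B n‖ ^ 2,
    sum_Icc_int M fun n : ℤ => ((n : ℝ) ^ (-(1 + s))) ^ 2 * ‖phasor w' A' B' n‖ ^ 2] at w1
  rw [sum_Icc_int N fun n : ℤ => ((n : ℝ) ^ (-(1 + s))) ^ 2 * ‖phasor w A B (-n)‖ ^ 2,
    sum_Icc_int M fun n : ℤ => ((n : ℝ) ^ (-(1 + s))) ^ 2 * ‖phasor w' A' B' (-n)‖ ^ 2] at w2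
  rw [sum_Icc_int N fun n : ℤ => phasor w A B n / (α * n : ℝ),
    sum_Icc_int M fun n : ℤ => phasor w' A' B' n / (β * n : ℝ)] at s1
  rw [sum_Icc_int N fun n : ℤ => phasor w A B (-n) / (α * n : ℝ),
    sum_Icc_int M fun n : ℤ => phasor w' A' B' (-n) / (β * n : ℝ)] at s2
  have hweight : ∀ {b : ℝ} (hb : 0 < b) (hb1 : b ≤ 1) {K : ℕ} (v D E : ℕ → ℂ),
      (∀ n, ‖v n‖ = n * π / b) →
      ∑ n ∈ Finset.Icc 1 K, (n : ℝ) ^ (-(2 * s)) * (‖D n‖ ^ 2 + ‖E n‖ ^ 2) ≤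
      ∑ n ∈ Finset.Icc 1 K, (((n : ℤ) : ℝ) ^ (-(1 + s))) ^ 2 * ‖phasor v D E n‖ ^ 2 +
      ∑ n ∈ Finset.Icc 1 K, (((n : ℤ) : ℝ) ^ (-(1 + s))) ^ 2 * ‖phasor v D E (-n)‖ ^ 2 := by
    intro b hb hb1 K v D E hv
    rw [← Finset.sum_add_distrib]
    refine Finset.sum_le_sum fun n hn => ?_
    have hn1 := (Finset.mem_Icc.1 hn).1
    have hn0 : (0 : ℝ) < n := by exact_mod_cast hn1
    rw [← mul_add, sq_norm_phasor_add v D E hn1, hv]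
    have e1 : ((n : ℝ) ^ (-(1 + s))) ^ 2 * (n : ℝ) ^ 2 = (n : ℝ) ^ (-(2 * s)) := by
      rw [← rpow_natCast, ← rpow_natCast, ← rpow_mul hn0.le, ← rpow_add hn0]
      congr 1; push_cast; ring
    have e2 : 1 ≤ (π / b) ^ 2 / 2 := by
      have : π ≤ π / b := le_div_self pi_pos.le hb hb1
      nlinarith [pi_gt_three]
    push_cast
    calc (n : ℝ) ^ (-(2 * s)) * (‖D n‖ ^ 2 + ‖E n‖ ^ 2)
        ≤ (n : ℝ) ^ (-(2 * s)) * (‖D n‖ ^ 2 + ‖E n‖ ^ 2) * ((π / b) ^ 2 / 2) :=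
          le_mul_of_one_le_right (by positivity) e2
      _ = _ := by rw [← e1]; ring
  have hW := hweight ha0 ha.2.le (K := N) w A B fun n => by
    simp only [hw, norm_mul, norm_pow, norm_neg, norm_one, one_pow, one_mul, Complex.norm_real,
      Real.norm_eq_abs]
    exact abs_of_nonneg (by positivity)
  have hW' := hweight ha1 (by linarith) (K := M) w' A' B' fun n => by
    simp only [hw', norm_neg, Complex.norm_real, Real.norm_eq_abs]
    exact abs_of_nonneg (by positivity)
  set Z₁ := ∑ n ∈ Finset.Icc 1 N, phasor w A B (n : ℤ) / ((α * ((n : ℤ) : ℝ) : ℝ) : ℂ) +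
    ∑ n ∈ Finset.Icc 1 M, phasor w' A' B' (n : ℤ) / ((β * ((n : ℤ) : ℝ) : ℝ) : ℂ) with hZ₁
  set Z₂ := ∑ n ∈ Finset.Icc 1 N, phasor w A B (-(n : ℤ)) / ((α * ((n : ℤ) : ℝ) : ℝ) : ℂ) +
    ∑ n ∈ Finset.Icc 1 M, phasor w' A' B' (-(n : ℤ)) / ((β * ((n : ℤ) : ℝ) : ℝ) : ℂ) with hZ₂
  set S := ∑ n ∈ Finset.Icc 1 N, (-1) ^ n * B n - ∑ m ∈ Finset.Icc 1 M, B' m with hS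
  have hκc : (κ : ℂ) ≠ 0 := by exact_mod_cast hκ0.ne'
  have hac : (a : ℂ) ≠ 0 := by exact_mod_cast ha0.ne'
  have hac' : (1 - a : ℂ) ≠ 0 := by exact_mod_cast ha1.ne'
  have hπc : (π : ℂ) ≠ 0 := by exact_mod_cast pi_ne_zero
  have hZ : Z₂ - Z₁ = Complex.I * κ * S := by
    rw [hZ₁, hZ₂, hS, mul_sub, Finset.mul_sum, Finset.mul_sum, add_sub_add_comm, ← Finset.sum_sub_distrib,
      ← Finset.sum_sub_distrib, sub_eq_add_neg (∑ n ∈ Finset.Icc 1 N, _), ← Finset.sum_neg_distrib]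
    congr 1
    · refine Finset.sum_congr rfl fun n hn => ?_
      have hn1 := (Finset.mem_Icc.1 hn).1
      have hnc : (n : ℂ) ≠ 0 := by exact_mod_cast (by omega : n ≠ 0)
      rw [phasor_natCast w A B hn1, phasor_neg_natCast w A B hn1]
      simp only [hw, hα]
      push_cast
      field_simp
      ring
    · refine Finset.sum_congr rfl fun n hn => ?_
      have hn1 := (Finset.mem_Icc.1 hn).1
      have hnc : (n : ℂ) ≠ 0 := by exact_mod_cast (by omega : n ≠ 0)
      rw [phasor_natCast w' A' B' hn1, phasor_neg_natCast w' A' B' hn1]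
      simp only [hw', hβ]
      push_cast
      field_simp
      ring
  have hSle : ‖S‖ ^ 2 ≤ 96 * C * O := by
    have h1 : κ * ‖S‖ ≤ ‖Z₂‖ + ‖Z₁‖ := by
      calc κ * ‖S‖ = ‖Z₂ - Z₁‖ := by
            rw [hZ, norm_mul, norm_mul, Complex.norm_I, one_mul, Complex.norm_real, Real.norm_eq_abs,
              abs_of_pos hκ0]
        _ ≤ _ := norm_sub_le _ _
    have h2 : ‖S‖ ≤ ‖Z₂‖ + ‖Z₁‖ := le_trans (by nlinarith [norm_nonneg S]) h1
    have h3 : ‖S‖ ^ 2 ≤ (‖Z₂‖ + ‖Z₁‖) ^ 2 := pow_le_pow_left₀ (norm_nonneg _) h2 2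
    have h4 : (‖Z₂‖ + ‖Z₁‖) ^ 2 ≤ 2 * (‖Z₂‖ ^ 2 + ‖Z₁‖ ^ 2) := add_sq_le
    clear_value Z₁ Z₂ S O
    linarith
  calc _ ≤ (C * O / c' ^ 2 + C * O / c' ^ 2) + 96 * C * O := by linarith
    _ = _ := by rw [hO]; ring

/-! ### Negative Sobolev norms of the initial data -/

/-- `exists_norm_integral_trig_le` for functions such as `sin (α n (x - l))`, `cos (α n (x - l))`. -/
lemma exists_norm_integral_sum_le {α ε l r : ℝ} (hα : α ≠ 0) (hε : 0 < ε) (hε1 : ε ≤ 1)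
    (hlr : l ≤ r) : ∃ C : ℝ, 0 < C ∧ ∀ (N : ℕ) (c : ℕ → ℂ) (F : ℕ → ℝ → ℂ) (Ψ : 𝓢(ℝ, ℂ)),
      (∀ n, ∃ A B : ℂ, ‖A‖ ≤ 1 ∧ ‖B‖ ≤ 1 ∧ ∀ x, F n x = A * cis (α * n * x) + B * cis (-α * n * x)) →
      ‖∫ x in l..r, (∑ n ∈ Finset.Icc 1 N, c n * F n x) * Ψ x‖ ^ 2 ≤
        C * (∑ n ∈ Finset.Icc 1 N, (n : ℝ) ^ (-(ε / 2)) * ‖c n‖ ^ 2) * sobolevNormSq ε Ψ := by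
  obtain ⟨C₁, hC₁, h₁⟩ := exists_norm_integral_trig_le hα hε hε1 hlr
  obtain ⟨C₂, hC₂, h₂⟩ := exists_norm_integral_trig_le (neg_ne_zero.2 hα) hε hε1 hlr
  refine ⟨2 * (C₁ + C₂), by positivity, fun N c F Ψ hF => ?_⟩
  choose A B hA hB hAB using hF
  have hweight : ∀ D : ℕ → ℂ, (∀ n, ‖D n‖ ≤ 1) →
      ∑ n ∈ Finset.Icc 1 N, (n : ℝ) ^ (-(ε / 2)) * ‖c n * D n‖ ^ 2 ≤
      ∑ n ∈ Finset.Icc 1 N, (n : ℝ) ^ (-(ε / 2)) * ‖c n‖ ^ 2 := by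
    intro D hD
    refine Finset.sum_le_sum fun n _ => ?_
    have : ‖c n * D n‖ ≤ ‖c n‖ := by
      rw [norm_mul]; exact mul_le_of_le_one_right (norm_nonneg _) (hD n)
    gcongr
  have hS := sobolevNormSq_nonneg ε Ψ
  have hcis : ∀ (ρ : ℝ) (D : ℕ → ℂ), IntervalIntegrable
      (fun x => (∑ n ∈ Finset.Icc 1 N, (c n * D n) * cis (ρ * n * x)) * Ψ x) volume l r := by
    intro ρ D
    have h : Continuous fun x => ∑ n ∈ Finset.Icc 1 N, (c n * D n) * cis (ρ * n * x) :=
      continuous_finsetSum _ fun n _ => continuous_const.mul (continuous_cis.comp (by fun_prop))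
    exact (h.mul Ψ.continuous).intervalIntegrable _ _
  have e : ∫ x in l..r, (∑ n ∈ Finset.Icc 1 N, c n * F n x) * Ψ x =
      (∫ x in l..r, (∑ n ∈ Finset.Icc 1 N, (c n * A n) * cis (α * n * x)) * Ψ x) +
      ∫ x in l..r, (∑ n ∈ Finset.Icc 1 N, (c n * B n) * cis (-α * n * x)) * Ψ x := by
    rw [← intervalIntegral.integral_add (hcis α A) (hcis (-α) B)]
    refine intervalIntegral.integral_congr fun x _ => ?_
    rw [← add_mul, ← Finset.sum_add_distrib]
    congr 1
    refine Finset.sum_congr rfl fun n _ => ?_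
    rw [hAB]; ring
  rw [e]
  set X := ∫ x in l..r, (∑ n ∈ Finset.Icc 1 N, (c n * A n) * cis (α * n * x)) * Ψ x
  set Y := ∫ x in l..r, (∑ n ∈ Finset.Icc 1 N, (c n * B n) * cis (-α * n * x)) * Ψ x
  set W := ∑ n ∈ Finset.Icc 1 N, (n : ℝ) ^ (-(ε / 2)) * ‖c n‖ ^ 2
  have hX : ‖X‖ ^ 2 ≤ C₁ * W * sobolevNormSq ε Ψ := (h₁ N (fun n => c n * A n) Ψ).trans (by
    gcongr; exact hweight A hA)
  have hY : ‖Y‖ ^ 2 ≤ C₂ * W * sobolevNormSq ε Ψ := (h₂ N (fun n => c n * B n) Ψ).trans (by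
    gcongr; exact hweight B hB)
  calc ‖X + Y‖ ^ 2 ≤ (‖X‖ + ‖Y‖) ^ 2 := pow_le_pow_left₀ (norm_nonneg _) (norm_add_le _ _) 2
    _ ≤ 2 * (‖X‖ ^ 2 + ‖Y‖ ^ 2) := add_sq_le
    _ ≤ 2 * (C₁ * W * sobolevNormSq ε Ψ + C₂ * W * sobolevNormSq ε Ψ) := by gcongr
    _ = _ := by ring

lemma sin_eq_cis (α l : ℝ) (n : ℕ) : ∃ A B : ℂ, ‖A‖ ≤ 1 ∧ ‖B‖ ≤ 1 ∧
    ∀ x, (sin (α * n * (x - l)) : ℂ) = A * cis (α * n * x) + B * cis (-α * n * x) := by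
  refine ⟨-(Complex.I / 2) * cis (-(α * n * l)), Complex.I / 2 * cis (α * n * l), ?_, ?_, fun x => ?_⟩
  · simp only [norm_mul, norm_neg, norm_div, Complex.norm_I, norm_cis, Complex.norm_ofNat]; norm_num
  · simp only [norm_mul, norm_div, Complex.norm_I, norm_cis, Complex.norm_ofNat]; norm_num
  · rw [mul_assoc (-(Complex.I / 2)), mul_assoc (Complex.I / 2), ← cis_add, ← cis_add,
      show -(α * n * l) + α * n * x = α * n * (x - l) by ring,
      show α * n * l + -α * n * x = -(α * n * (x - l)) by ring, cis_eq, cis_eq, cos_neg, sin_neg]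
    push_cast
    ring_nf
    rw [Complex.I_sq]
    ring

lemma cos_eq_cis (α l : ℝ) (n : ℕ) : ∃ A B : ℂ, ‖A‖ ≤ 1 ∧ ‖B‖ ≤ 1 ∧
    ∀ x, (cos (α * n * (x - l)) : ℂ) = A * cis (α * n * x) + B * cis (-α * n * x) := by
  refine ⟨1 / 2 * cis (-(α * n * l)), 1 / 2 * cis (α * n * l), ?_, ?_, fun x => ?_⟩
  · simp only [norm_mul, norm_div, norm_one, norm_cis, Complex.norm_ofNat]; norm_num
  · simp only [norm_mul, norm_div, norm_one, norm_cis, Complex.norm_ofNat]; norm_num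
  · rw [mul_assoc (1 / 2 : ℂ), mul_assoc (1 / 2 : ℂ), ← cis_add, ← cis_add,
      show -(α * n * l) + α * n * x = α * n * (x - l) by ring,
      show α * n * l + -α * n * x = -(α * n * (x - l)) by ring, cis_eq, cis_eq, cos_neg, sin_neg]
    push_cast
    ring

/-- A finite sine sum against a Schwartz function, integrated by parts. -/
lemma integral_sine_sum_by_parts {l r : ℝ} (hlr : l < r) (N : ℕ) (B : ℕ → ℂ) (Φ : 𝓢(ℝ, ℂ)) :
    ∫ x in l..r, (∑ n ∈ Finset.Icc 1 N, (n * π / (r - l) : ℝ) * B n *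
        (sin (n * π / (r - l) * (x - l)) : ℂ)) * Φ x =
      Φ l * ∑ n ∈ Finset.Icc 1 N, B n - Φ r * ∑ n ∈ Finset.Icc 1 N, (-1) ^ n * B n +
      ∫ x in l..r, (∑ n ∈ Finset.Icc 1 N, B n * (cos (π / (r - l) * n * (x - l)) : ℂ)) *
        SchwartzMap.derivCLM ℂ ℂ Φ x := by
  have hL : 0 < r - l := sub_pos.2 hlr
  set k : ℕ → ℝ := fun n => n * π / (r - l) with hk
  have hk' : ∀ n : ℕ, π / (r - l) * n = k n := fun n => by simp only [hk]; ring
  simp_rw [hk']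
  set S : ℝ → ℂ := fun x => ∑ n ∈ Finset.Icc 1 N, (k n : ℂ) * B n * (sin (k n * (x - l)) : ℂ) with hS
  set D : ℝ → ℂ := fun x => ∑ n ∈ Finset.Icc 1 N, B n * (cos (k n * (x - l)) : ℂ) with hD
  have hSc : Continuous S := by simp only [hS]; fun_prop
  have hDc : Continuous D := by simp only [hD]; fun_prop
  have hDd : ∀ x, HasDerivAt D (-S x) x := by
    intro x
    simp only [hS, ← Finset.sum_neg_distrib]
    refine HasDerivAt.fun_sum fun n _ => ?_
    have hθ : HasDerivAt (fun x => k n * (x - l)) (k n) x := by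
      simpa using ((hasDerivAt_id x).sub_const l).const_mul (k n)
    refine ((hθ.cos.ofReal_comp).const_mul (B n)).congr_deriv ?_
    push_cast; ring
  have hΦ : ∀ x, HasDerivAt Φ (SchwartzMap.derivCLM ℂ ℂ Φ x) x := by
    intro x
    rw [SchwartzMap.derivCLM_apply]
    exact Φ.differentiableAt.hasDerivAt
  have hΦ'c : Continuous (SchwartzMap.derivCLM ℂ ℂ Φ) := SchwartzMap.continuous _
  have i1 : IntervalIntegrable (fun x => S x * Φ x) volume l r :=
    (hSc.mul Φ.continuous).intervalIntegrable _ _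
  have i2 : IntervalIntegrable (fun x => D x * SchwartzMap.derivCLM ℂ ℂ Φ x) volume l r :=
    (hDc.mul hΦ'c).intervalIntegrable _ _
  have h := intervalIntegral.integral_eq_sub_of_hasDerivAt (a := l) (b := r)
    (f := fun x => D x * Φ x) (f' := fun x => D x * SchwartzMap.derivCLM ℂ ℂ Φ x - S x * Φ x)
    (fun x _ => ((hDd x).fun_mul (hΦ x)).congr_deriv (by ring)) (i2.sub i1)
  rw [intervalIntegral.integral_sub i2 i1] at h
  have hDl : D l = ∑ n ∈ Finset.Icc 1 N, B n := by simp [hD]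
  have hDr : D r = ∑ n ∈ Finset.Icc 1 N, (-1) ^ n * B n := by
    refine Finset.sum_congr rfl fun n _ => ?_
    have : k n * (r - l) = n * π := div_mul_cancel₀ _ hL.ne'
    rw [this, cos_nat_mul_pi]
    push_cast; ring
  rw [← hDl, ← hDr]
  change ∫ x in l..r, S x * Φ x = _ + ∫ x in l..r, D x * SchwartzMap.derivCLM ℂ ℂ Φ x
  linear_combination -h

lemma negSobolevNorm_sq_le {s K : ℝ} {f : ℝ → ℂ} (hK : 0 ≤ K)
    (h : ∀ (φ : 𝓓(openInterval 0 1, ℂ)) (Φ : 𝓢(ℝ, ℂ)), EqOn Φ φ (Ioo 0 1) →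
      ‖∫ x in (0 : ℝ)..1, f x * φ x‖ ^ 2 ≤ K * sobolevNormSq s Φ) :
    negSobolevNorm s f ^ 2 ≤ ENNReal.ofReal K := by
  have h1 : negSobolevNorm s f ≤ ENNReal.ofReal (√K) := by
    refine iSup_le fun φ => iSup_le fun Φ => iSup_le fun hΦ => iSup_le fun hs => ?_
    rw [← ofReal_norm]
    refine ENNReal.ofReal_le_ofReal (le_sqrt_of_sq_le ((h φ Φ hΦ).trans ?_))
    exact mul_le_of_le_one_right hK hs
  calc negSobolevNorm s f ^ 2 ≤ ENNReal.ofReal (√K) ^ 2 := by gcongr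
    _ = ENNReal.ofReal K := by rw [← ENNReal.ofReal_pow (sqrt_nonneg _), sq_sqrt hK]

lemma eq_zero_of_eqOn_testFunction {φ : 𝓓(openInterval 0 1, ℂ)} {Φ : 𝓢(ℝ, ℂ)}
    (h : EqOn Φ φ (Ioo 0 1)) : Φ 0 = 0 ∧ Φ 1 = 0 := by
  have h1 : EqOn Φ φ (Icc 0 1) := by
    rw [← closure_Ioo zero_ne_one]
    exact h.closure Φ.continuous φ.continuous
  have h2 : ∀ x ∉ Ioo (0 : ℝ) 1, φ x = 0 := fun x hx =>
    image_eq_zero_of_notMem_tsupport fun hx' => hx (φ.tsupport_subset hx')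
  exact ⟨(h1 ⟨le_rfl, zero_le_one⟩).trans (h2 0 (by simp)),
    (h1 ⟨zero_le_one, le_rfl⟩).trans (h2 1 (by simp))⟩

lemma integral_glue {a : ℝ} (ha : a ∈ Ioo (0 : ℝ) 1) {f g : ℝ → ℂ} (hf : Continuous f)
    (hg : Continuous g) {φ : 𝓓(openInterval 0 1, ℂ)} {Φ : 𝓢(ℝ, ℂ)} (h : EqOn Φ φ (Ioo 0 1)) :
    ∫ x in (0 : ℝ)..1, glue a f g x * φ x =
      (∫ x in (0 : ℝ)..a, f x * Φ x) + ∫ x in a..1, g x * Φ x := by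
  have hne : ∀ z : ℝ, ∀ᵐ x : ℝ, x ≠ z := fun z => by simp [ae_iff, measure_singleton]
  have e1 : ∀ᵐ x : ℝ, x ∈ uIoc 0 a → f x * Φ x = glue a f g x * φ x := by
    filter_upwards [hne a] with x hx hxm
    rw [uIoc_of_le ha.1.le] at hxm
    have hlt : x < a := lt_of_le_of_ne hxm.2 hx
    rw [glue, if_pos hlt, h ⟨hxm.1, hlt.trans ha.2⟩]
  have e2 : ∀ᵐ x : ℝ, x ∈ uIoc a 1 → g x * Φ x = glue a f g x * φ x := by
    filter_upwards [hne 1] with x hx hxm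
    rw [uIoc_of_le ha.2.le] at hxm
    rw [glue, if_neg (not_lt.2 hxm.1.le), h ⟨ha.1.trans hxm.1, lt_of_le_of_ne hxm.2 hx⟩]
  have i1 : IntervalIntegrable (fun x => glue a f g x * φ x) volume 0 a :=
    ((hf.mul Φ.continuous).intervalIntegrable 0 a).congr_ae
      ((ae_restrict_iff' measurableSet_uIoc).2 e1)
  have i2 : IntervalIntegrable (fun x => glue a f g x * φ x) volume a 1 :=
    ((hg.mul Φ.continuous).intervalIntegrable a 1).congr_ae
      ((ae_restrict_iff' measurableSet_uIoc).2 e2)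
  rw [intervalIntegral.integral_congr_ae e1, intervalIntegral.integral_congr_ae e2,
    intervalIntegral.integral_add_adjacent_intervals i1 i2]

set_option maxHeartbeats 1000000 in
/-- The dual norms of the initial data in terms of weighted Fourier coefficients. For the velocities
the integration by parts costs the boundary term at `a`, which involves a single combination of the
coefficients of both strings. -/
theorem exists_negSobolevNorm_le {a ε : ℝ} (ha : a ∈ Ioo (0 : ℝ) 1) (hε : 0 < ε) :
    ∃ C : ℝ, 0 < C ∧ ∀ (N M : ℕ) (A B A' B' : ℕ → ℂ) (f₀ f₁ g₀ g₁ : ℝ → ℂ),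
      (∀ x, f₀ x = ∑ n ∈ Finset.Icc 1 N, A n * (sin (n * π / (a - 0) * (x - 0)) : ℂ)) →
      (∀ x, f₁ x = ∑ n ∈ Finset.Icc 1 N, (n * π / (a - 0) : ℝ) * B n *
        (sin (n * π / (a - 0) * (x - 0)) : ℂ)) →
      (∀ x, g₀ x = ∑ n ∈ Finset.Icc 1 M, A' n * (sin (n * π / (1 - a) * (x - a)) : ℂ)) →
      (∀ x, g₁ x = ∑ n ∈ Finset.Icc 1 M, (n * π / (1 - a) : ℝ) * B' n *
        (sin (n * π / (1 - a) * (x - a)) : ℂ)) →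
      negSobolevNorm ε (glue a f₀ g₀) ^ 2 + negSobolevNorm (1 + ε) (glue a f₁ g₁) ^ 2 ≤
        ENNReal.ofReal (C * ((∑ n ∈ Finset.Icc 1 N, (n : ℝ) ^ (-(2 * (min ε 1 / 4))) *
            (‖A n‖ ^ 2 + ‖B n‖ ^ 2) +
          ∑ m ∈ Finset.Icc 1 M, (m : ℝ) ^ (-(2 * (min ε 1 / 4))) * (‖A' m‖ ^ 2 + ‖B' m‖ ^ 2)) +
          ‖∑ n ∈ Finset.Icc 1 N, (-1) ^ n * B n - ∑ m ∈ Finset.Icc 1 M, B' m‖ ^ 2)) := by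
  set η := min ε 1 with hη
  have hη0 : 0 < η := lt_min hε one_pos
  have hη1 : η ≤ 1 := min_le_right _ _
  have hηε : η ≤ ε := min_le_left _ _
  have ha0 : 0 < a - 0 := by linarith [ha.1]
  have ha1 : 0 < 1 - a := sub_pos.2 ha.2
  obtain ⟨C₁, hC₁, h₁⟩ := exists_norm_integral_sum_le (l := 0) (r := a)
    (div_pos pi_pos ha0).ne' hη0 hη1 ha.1.le
  obtain ⟨C₂, hC₂, h₂⟩ := exists_norm_integral_sum_le (l := a) (r := 1)
    (div_pos pi_pos ha1).ne' hη0 hη1 ha.2.le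
  refine ⟨2 * (C₁ + C₂) + (3 * π + 12 * π ^ 2 * (C₁ + C₂)), by positivity, ?_⟩
  intro N M A B A' B' f₀ f₁ g₀ g₁ hf₀ hf₁ hg₀ hg₁
  have hq : 2 * (η / 4) = η / 2 := by ring
  rw [hq]
  set w : ℕ → ℝ := fun n => (n : ℝ) ^ (-(η / 2)) with hw
  have hw0 : ∀ n, 0 ≤ w n := fun n => rpow_nonneg (by positivity) _
  set S := ∑ n ∈ Finset.Icc 1 N, (-1) ^ n * B n - ∑ m ∈ Finset.Icc 1 M, B' m with hS
  set V := ∑ n ∈ Finset.Icc 1 N, w n * (‖A n‖ ^ 2 + ‖B n‖ ^ 2) +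
    ∑ m ∈ Finset.Icc 1 M, w m * (‖A' m‖ ^ 2 + ‖B' m‖ ^ 2) with hV
  have hpos : ∀ (K : ℕ) (D : ℕ → ℂ), 0 ≤ ∑ n ∈ Finset.Icc 1 K, w n * ‖D n‖ ^ 2 := fun K D =>
    Finset.sum_nonneg fun n _ => mul_nonneg (hw0 n) (sq_nonneg _)
  have hVe : V = ∑ n ∈ Finset.Icc 1 N, w n * ‖A n‖ ^ 2 + ∑ n ∈ Finset.Icc 1 N, w n * ‖B n‖ ^ 2 +
      (∑ n ∈ Finset.Icc 1 M, w n * ‖A' n‖ ^ 2 + ∑ n ∈ Finset.Icc 1 M, w n * ‖B' n‖ ^ 2) := by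
    rw [hV, ← Finset.sum_add_distrib, ← Finset.sum_add_distrib]
    simp_rw [mul_add]
  have hA := hpos N A
  have hB := hpos N B
  have hA' := hpos M A'
  have hB' := hpos M B'
  have hV0 : 0 ≤ V := by rw [hVe]; positivity
  have hfc₀ : Continuous f₀ := by rw [show f₀ = _ from funext hf₀]; fun_prop
  have hfc₁ : Continuous f₁ := by rw [show f₁ = _ from funext hf₁]; fun_prop
  have hgc₀ : Continuous g₀ := by rw [show g₀ = _ from funext hg₀]; fun_prop
  have hgc₁ : Continuous g₁ := by rw [show g₁ = _ from funext hg₁]; fun_prop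
  have hfreq : ∀ (n : ℕ) (L : ℝ), n * π / L = π / L * n := fun n L => by ring
  have n0 : negSobolevNorm ε (glue a f₀ g₀) ^ 2 ≤ ENNReal.ofReal (2 * (C₁ + C₂) * V) := by
    refine negSobolevNorm_sq_le (by positivity) fun φ Φ hΦ => ?_
    rw [integral_glue ha hfc₀ hgc₀ hΦ]
    have hmono := sobolevNormSq_mono hηε Φ
    have hs0 := sobolevNormSq_nonneg η Φ
    have b1 := h₁ N A (fun n x => (sin (π / (a - 0) * n * (x - 0)) : ℂ)) Φ
      fun n => sin_eq_cis _ _ n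
    have b2 := h₂ M A' (fun n x => (sin (π / (1 - a) * n * (x - a)) : ℂ)) Φ
      fun n => sin_eq_cis _ _ n
    simp_rw [hf₀, hg₀, hfreq]
    refine (pow_le_pow_left₀ (norm_nonneg _) (norm_add_le _ _) 2).trans (add_sq_le.trans ?_)
    calc _ ≤ 2 * (C₁ * (∑ n ∈ Finset.Icc 1 N, w n * ‖A n‖ ^ 2) * sobolevNormSq η Φ +
          C₂ * (∑ n ∈ Finset.Icc 1 M, w n * ‖A' n‖ ^ 2) * sobolevNormSq η Φ) := by gcongr
      _ ≤ 2 * (C₁ * V * sobolevNormSq η Φ + C₂ * V * sobolevNormSq η Φ) := by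
          gcongr <;> linarith
      _ = 2 * (C₁ + C₂) * V * sobolevNormSq η Φ := by ring
      _ ≤ _ := by gcongr
  have n1 : negSobolevNorm (1 + ε) (glue a f₁ g₁) ^ 2 ≤
      ENNReal.ofReal ((3 * π + 12 * π ^ 2 * (C₁ + C₂)) * (V + ‖S‖ ^ 2)) := by
    refine negSobolevNorm_sq_le (by positivity) fun φ Φ hΦ => ?_
    rw [integral_glue ha hfc₁ hgc₁ hΦ]
    obtain ⟨z0, z1⟩ := eq_zero_of_eqOn_testFunction hΦ
    set Ψ := SchwartzMap.derivCLM ℂ ℂ Φ with hΨ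
    have hΨle : sobolevNormSq η Ψ ≤ 4 * π ^ 2 * sobolevNormSq (1 + ε) Φ :=
      (sobolevNormSq_derivCLM_le η Φ).trans (by gcongr; exact sobolevNormSq_mono (by linarith) Φ)
    have hs0 := sobolevNormSq_nonneg η Ψ
    have hs1 := sobolevNormSq_nonneg (1 + ε) Φ
    have b1 := h₁ N B (fun n x => (cos (π / (a - 0) * n * (x - 0)) : ℂ)) Ψ
      fun n => cos_eq_cis _ _ n
    have b2 := h₂ M B' (fun n x => (cos (π / (1 - a) * n * (x - a)) : ℂ)) Ψ
      fun n => cos_eq_cis _ _ n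
    have p1 := integral_sine_sum_by_parts ha.1 N B Φ
    have p2 := integral_sine_sum_by_parts ha.2 M B' Φ
    have hb : ‖Φ a‖ ^ 2 ≤ π * sobolevNormSq (1 + ε) Φ := sq_norm_apply_le (by linarith) Φ a
    simp_rw [hf₁, hg₁]
    rw [p1, p2, z0, z1]
    set X := ∫ x in (0 : ℝ)..a, (∑ n ∈ Finset.Icc 1 N,
      B n * (cos (π / (a - 0) * n * (x - 0)) : ℂ)) * Ψ x with hX
    set Y := ∫ x in a..1, (∑ n ∈ Finset.Icc 1 M,
      B' n * (cos (π / (1 - a) * n * (x - a)) : ℂ)) * Ψ x with hY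
    have e : (0 * ∑ n ∈ Finset.Icc 1 N, B n - Φ a * ∑ n ∈ Finset.Icc 1 N, (-1) ^ n * B n + X +
        (Φ a * ∑ n ∈ Finset.Icc 1 M, B' n - 0 * ∑ n ∈ Finset.Icc 1 M, (-1) ^ n * B' n + Y)) =
        -(Φ a * S) + X + Y := by rw [hS]; ring
    rw [e]
    have hXb : ‖X‖ ^ 2 ≤ C₁ * V * (4 * π ^ 2 * sobolevNormSq (1 + ε) Φ) := by
      refine b1.trans ?_
      have : ∑ n ∈ Finset.Icc 1 N, w n * ‖B n‖ ^ 2 ≤ V := by linarith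
      gcongr
    have hYb : ‖Y‖ ^ 2 ≤ C₂ * V * (4 * π ^ 2 * sobolevNormSq (1 + ε) Φ) := by
      refine b2.trans ?_
      have : ∑ n ∈ Finset.Icc 1 M, w n * ‖B' n‖ ^ 2 ≤ V := by linarith
      gcongr
    have hSb : ‖Φ a * S‖ ^ 2 ≤ π * sobolevNormSq (1 + ε) Φ * ‖S‖ ^ 2 := by
      rw [norm_mul, mul_pow]; gcongr
    have h3 : ‖-(Φ a * S) + X + Y‖ ≤ ‖Φ a * S‖ + ‖X‖ + ‖Y‖ := by
      refine norm_add₃_le.trans ?_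
      rw [norm_neg]
    have h4 : (‖Φ a * S‖ + ‖X‖ + ‖Y‖) ^ 2 ≤ 3 * (‖Φ a * S‖ ^ 2 + ‖X‖ ^ 2 + ‖Y‖ ^ 2) := by
      nlinarith [sq_nonneg (‖Φ a * S‖ - ‖X‖), sq_nonneg (‖X‖ - ‖Y‖), sq_nonneg (‖Φ a * S‖ - ‖Y‖)]
    have h5 : 0 ≤ 3 * π * sobolevNormSq (1 + ε) Φ * V := by positivity
    have h6 : 0 ≤ 12 * π ^ 2 * (C₁ + C₂) * ‖S‖ ^ 2 * sobolevNormSq (1 + ε) Φ := by positivity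
    refine (pow_le_pow_left₀ (norm_nonneg _) h3 2).trans (h4.trans ?_)
    calc _ ≤ 3 * (π * sobolevNormSq (1 + ε) Φ * ‖S‖ ^ 2 +
          C₁ * V * (4 * π ^ 2 * sobolevNormSq (1 + ε) Φ) +
          C₂ * V * (4 * π ^ 2 * sobolevNormSq (1 + ε) Φ)) :=
          mul_le_mul_of_nonneg_left (add_le_add (add_le_add hSb hXb) hYb) (by norm_num)
      _ = (3 * π + 12 * π ^ 2 * (C₁ + C₂)) * (V + ‖S‖ ^ 2) * sobolevNormSq (1 + ε) Φ -
          3 * π * sobolevNormSq (1 + ε) Φ * V -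
          12 * π ^ 2 * (C₁ + C₂) * ‖S‖ ^ 2 * sobolevNormSq (1 + ε) Φ := by ring
      _ ≤ _ := (sub_le_self _ h6).trans (sub_le_self _ h5)
  refine (add_le_add n0 n1).trans ?_
  rw [← ENNReal.ofReal_add (by positivity) (by positivity)]
  refine ENNReal.ofReal_le_ofReal ?_
  have : 0 ≤ 2 * (C₁ + C₂) * ‖S‖ ^ 2 := by positivity
  linarith

end StringObs

theorem theorem6 :
    ∀ᵐ a : ℝ ∂volume, a ∈ Ioo (0 : ℝ) 1 →
      ∀ ε : ℝ, 0 < ε → ∀ T : ℝ, 2 * max a (1 - a) < T → ∀ t' : ℝ,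
        ∃ C : ℝ, 0 < C ∧
          ∀ (δ : ℝ) (J : ℤ), 0 < δ → δ ≤ Real.pi / stringGap a → (J : ℝ) * δ = T →
            ∀ f₀ ∈ leftModes a δ, ∀ f₁ ∈ leftModes a δ,
            ∀ g₀ ∈ rightModes a δ, ∀ g₁ ∈ rightModes a δ,
            ∀ u : ℝ → ℝ → ℂ,
              IsStringSolution 0 a u f₀ f₁ → IsStringSolution a 1 u g₀ g₁ →
              ∃ p q : ℝ → ℂ,
                (∀ t, Tendsto (fun x => deriv (fun y => u y t) x) (𝓝[<] a) (𝓝 (p t))) ∧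
                (∀ t, Tendsto (fun x => deriv (fun y => u y t) x) (𝓝[>] a) (𝓝 (q t))) ∧
                negSobolevNorm ε (glue a f₀ g₀) ^ 2 + negSobolevNorm (1 + ε) (glue a f₁ g₁) ^ 2 ≤
                  ENNReal.ofReal (C * (δ * ∑ j ∈ Finset.Icc (-J) J,
                    ‖p (t' + j * δ) - q (t' + j * δ)‖ ^ 2)) := by
  filter_upwards [StringObs.ae_dioph] with a hdioph ha ε hε T hT t'
  have ha0 : 0 < a := ha.1
  have ha1 : 0 < 1 - a := sub_pos.2 ha.2
  have hs : 0 < min ε 1 / 4 := by have : 0 < min ε 1 := lt_min hε one_pos; positivity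
  obtain ⟨c, hc, hd⟩ := hdioph ha _ hs
  obtain ⟨C₁, hC₁, hobs⟩ := StringObs.exists_observability ha hs hc hd hT t'
  obtain ⟨C₂, hC₂, hnorm⟩ := StringObs.exists_negSobolevNorm_le ha hε
  refine ⟨C₂ * C₁, by positivity, fun δ J hδ hδγ hJ f₀ hf₀ f₁ hf₁ g₀ hg₀ g₁ hg₁ u hu hu' => ?_⟩
  obtain ⟨A, hA⟩ := StringObs.exists_coeff_of_mem_span hf₀
  obtain ⟨B, hB⟩ := StringObs.exists_coeff_of_mem_span hf₁
  obtain ⟨A', hA'⟩ := StringObs.exists_coeff_of_mem_span hg₀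
  obtain ⟨B', hB'⟩ := StringObs.exists_coeff_of_mem_span hg₁
  set X := a / δ - 1 / 4 * min 1 (a / (1 - a)) with hX
  set X' := (1 - a) / δ - 1 / 4 * min 1 ((1 - a) / a) with hX'
  set N := ⌊X⌋₊ with hN
  set M := ⌊X'⌋₊ with hM
  set κ := min (1 / a) (1 / (1 - a)) with hκ
  have hκ0 : 0 < κ := lt_min (by positivity) (by positivity)
  -- the bounds of the frequencies also hold when there are no modes, as `κ δ ≤ 2`
  have hκδ : 0 ≤ 1 / δ - 1 / 4 * κ := by
    have h1 : Real.pi / stringGap a = 2 / κ := by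
      rw [stringGap, ← hκ]; field_simp
    rw [h1, le_div_iff₀ hκ0] at hδγ
    have h2 : κ / 2 ≤ 1 / δ := by rw [div_le_div_iff₀ two_pos hδ]; linarith
    linarith
  have hfloor : ∀ {b Z : ℝ}, 0 < b → Z = b * (1 / δ - 1 / 4 * κ) →
      (⌊Z⌋₊ : ℝ) / b ≤ 1 / δ - 1 / 4 * κ := by
    intro b Z hb hZ
    rw [div_le_iff₀ hb, mul_comm, ← hZ]
    exact Nat.floor_le (by rw [hZ]; positivity)
  have hNb : (N : ℝ) / a ≤ 1 / δ - 1 / 4 * κ := hfloor ha0 (by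
    have : min 1 (a / (1 - a)) = a * κ := by
      rw [hκ, mul_min_of_nonneg _ _ ha0.le, mul_one_div_cancel ha0.ne', mul_one_div]
    rw [hX, this]; ring)
  have hMb : (M : ℝ) / (1 - a) ≤ 1 / δ - 1 / 4 * κ := hfloor ha1 (by
    have : min 1 ((1 - a) / a) = (1 - a) * κ := by
      rw [hκ, mul_min_of_nonneg _ _ ha1.le, mul_one_div_cancel ha1.ne', mul_one_div, min_comm]
    rw [hX', this]; ring)
  have hcoef : ∀ {L : ℝ}, 0 < L → ∀ (D : ℕ → ℂ) {n : ℕ}, n ∈ Finset.Icc 1 N ∪ Finset.Icc 1 M →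
      ((n * Real.pi / L : ℝ) : ℂ) * (D n / ((n * Real.pi / L : ℝ) : ℂ)) = D n := by
    intro L hL D n hn
    have hn0 : 0 < n := by
      rcases Finset.mem_union.1 hn with h | h <;> exact (Finset.mem_Icc.1 h).1
    have hn1 : (0 : ℝ) < n := by exact_mod_cast hn0
    refine mul_div_cancel₀ _ ?_
    exact_mod_cast (by positivity : (0 : ℝ) < n * Real.pi / L).ne'
  have hfA : ∀ x, f₀ x = ∑ n ∈ Finset.Icc 1 N, A n *
      (Real.sin (n * Real.pi / (a - 0) * (x - 0)) : ℂ) := fun x => by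
    rw [hA]
    refine Finset.sum_congr rfl fun n _ => ?_
    rw [sub_zero, sub_zero, div_mul_eq_mul_div]
  -- the velocity coefficients enter the solution divided by the frequencies
  set b : ℕ → ℂ := fun n => B n / ((n * Real.pi / (a - 0) : ℝ) : ℂ) with hb
  set b' : ℕ → ℂ := fun n => B' n / ((n * Real.pi / (1 - a) : ℝ) : ℂ) with hb'
  have hfB : ∀ x, f₁ x = ∑ n ∈ Finset.Icc 1 N, ((n * Real.pi / (a - 0) : ℝ) : ℂ) * b n *
      (Real.sin (n * Real.pi / (a - 0) * (x - 0)) : ℂ) := fun x => by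
    rw [hB]
    refine Finset.sum_congr rfl fun n hn => ?_
    rw [hcoef (by linarith) B (Finset.mem_union_left _ hn), sub_zero, sub_zero, div_mul_eq_mul_div]
  have hgA : ∀ x, g₀ x = ∑ n ∈ Finset.Icc 1 M, A' n *
      (Real.sin (n * Real.pi / (1 - a) * (x - a)) : ℂ) := fun x => by
    rw [hA']
    refine Finset.sum_congr rfl fun n _ => ?_
    rw [div_mul_eq_mul_div]
  have hgB : ∀ x, g₁ x = ∑ n ∈ Finset.Icc 1 M, ((n * Real.pi / (1 - a) : ℝ) : ℂ) * b' n *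
      (Real.sin (n * Real.pi / (1 - a) * (x - a)) : ℂ) := fun x => by
    rw [hB']
    refine Finset.sum_congr rfl fun n hn => ?_
    rw [hcoef ha1 B' (Finset.mem_union_right _ hn), div_mul_eq_mul_div]
  have hleft := fun t => StringObs.tendsto_deriv_of_eq_sum ha0
    (StringObs.IsStringSolution.eq_sum ha0 hfA hfB hu t)
  have hright := fun t => StringObs.tendsto_deriv_of_eq_sum ha.2
    (StringObs.IsStringSolution.eq_sum ha.2 hgA hgB hu' t)
  set p : ℝ → ℂ := fun t => ∑ n ∈ Finset.Icc 1 N, (A n * (Real.cos (n * Real.pi / (a - 0) * t) : ℂ) +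
    b n * (Real.sin (n * Real.pi / (a - 0) * t) : ℂ)) *
      ((n * Real.pi / (a - 0) * Real.cos (n * Real.pi / (a - 0) * (a - 0)) : ℝ) : ℂ) with hp
  set q : ℝ → ℂ := fun t => ∑ n ∈ Finset.Icc 1 M, (A' n * (Real.cos (n * Real.pi / (1 - a) * t) : ℂ) +
    b' n * (Real.sin (n * Real.pi / (1 - a) * t) : ℂ)) * ((n * Real.pi / (1 - a) : ℝ) : ℂ) with hq
  have hpq : ∀ t, p t - q t = ∑ n ∈ Finset.Icc 1 N, (-1) ^ n * ((n * Real.pi / a : ℝ) : ℂ) *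
      (A n * (Real.cos (n * Real.pi / a * t) : ℂ) + b n * (Real.sin (n * Real.pi / a * t) : ℂ)) -
      ∑ m ∈ Finset.Icc 1 M, ((m * Real.pi / (1 - a) : ℝ) : ℂ) *
      (A' m * (Real.cos (m * Real.pi / (1 - a) * t) : ℂ) +
        b' m * (Real.sin (m * Real.pi / (1 - a) * t) : ℂ)) := by
    intro t
    simp only [hp, hq]
    congr 1
    · refine Finset.sum_congr rfl fun n _ => ?_
      rw [sub_zero, div_mul_cancel₀ _ ha0.ne', Real.cos_nat_mul_pi]
      push_cast
      ring
    · exact Finset.sum_congr rfl fun n _ => mul_comm _ _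
  refine ⟨p, q, fun t => (hleft t).1, fun t => (hright t).2, ?_⟩
  refine (hnorm N M A b A' b' f₀ f₁ g₀ g₁ hfA hfB hgA hgB).trans (ENNReal.ofReal_le_ofReal ?_)
  rw [mul_assoc]
  exact mul_le_mul_of_nonneg_left (hobs A b A' b' hδ hJ hNb hMb (fun t => p t - q t) hpq) hC₂.le
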